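/- **Theorem (sub-optimality of pessimistic policy learning in the confounded contextual bandit with an instrumental variable and missing data).** *Model.* One trial of the observational process is generated as follows: a context $X\sim p$; given $X$, a confounder $U$, an instrument $Z$ and a noise $\epsilon\in\mathbb R$ with $\mathbb E|\epsilon|<\infty$; a treatment $A\sim\pi_{\mathrm{ob}}(\cdot\mid U,X,Z)$ (drawn without looking at $\epsilon$); the reward $Y=f(A,X)+\epsilon$; indicators $R_Z\in\{0,1\}$ with law depending on $(Z,X)$ only and $R_X\in\{0,1\}$ with law depending on $(Z,X,A)$ only. The law of a trial is $P_{\mathrm{ob}}$. Assume $Z\perp(U,\epsilon)\mid X$, and IV completeness: for every $\sigma$ with $\sigma(X,A)$ integrable given $R_Z=1$, $\mathbb E_{\mathrm{ob}}[\sigma(X,A)\mid Z,R_Z=1]=0$ a.s. if and only if $\sigma(X,A)=0$ a.s. Let $g^*(x,a)=\mathbb E_{\mathrm{ob}}[Y\mid X=x,\mathrm{do}(A=a)]=f(a,x)+\mathbb E_{\mathrm{ob}}[\epsilon\mid X=x]$ and assume that some square-integrable $h_1^*(Y,A,Z)$ satisfies $\mathbb E_{\mathrm{ob}}[g^*(X,A)-h_1^*(Y,A,Z)\mid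 A,X,Z,R_Z=1]=0$. In the interventional process with policy $\pi$ (a Markov kernel from contexts to treatments) the context has law $\tilde p$, $(U,Z,\epsilon)$ has its observational conditional law given $X$, $A\sim\pi(\cdot\mid X)$ and $Y=f(A,X)+\epsilon$; put $v^\pi=\mathbb E_\pi[Y]$ and $v(g,\pi)=\mathbb E_\pi[g(X,A)]$. For a policy class $\Pi$ such that $Y$ is integrable in the interventional process for each $\pi\in\Pi$, let $\pi^*\in\Pi$ maximize $v^\pi$ over $\Pi$ and $\mathrm{SubOpt}(\pi)=v^{\pi^*}-v^\pi$. *Data and estimation.* There are $T$ i.i.d. trials; the dataset $\mathcal D$ records $A,Y$ always, $Z$ only if $R_Z=1$, and $X$ only if $R_X=1$. Let $\mathcal D_1,\mathcal D_2$ be the subsamples with $R_Z=1$ and with $R_X=R_Z=1$, of sizes $n_1,n_2$, and let $\mu_1,\mu_2$ be the corresponding conditional laws of the observed variables. Write $\mathbb E_{\mathcal D_k}$ for empirical means (equal to $0$ if $n_k=0$), $\|\cdot\|_{\mu_k,2}$, $\|\cdot\|_{\mathcal D_k,2}$ for the $L^2$ norms, $Z_1=Z$, $Z_2=(A,X,Z)$,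 and for $h=(h_1,g)$ let $\alpha_1(h)=h_1(Y,A,Z)-Y$, $\alpha_2(h)=g(X,A)-h_1(Y,A,Z)$, $\mathcal T_kh=\mathbb E_{\mu_k}[\alpha_k(h)\mid Z_k]$. Let $\mathcal H=\mathcal H_1\times\mathcal G$ be a hypothesis class and $\Theta_1,\Theta_2$ non-empty test classes of functions of $Z_1,Z_2$, star-shaped about $0$; all classes consist of measurable functions and are pointwise separable (each contains a countable subset of which every member of the class is a pointwise sequential limit). Put $$\mathcal L_{\mathcal D}(h)=\sum_{k=1}^2\sup_{\theta\in\Theta_k}\Big\{\mathbb E_{\mathcal D_k}[\alpha_k(h)\theta(Z_k)]-\tfrac12\|\theta\|_{\mathcal D_k,2}^2\Big\},\qquad \mathrm{CI}_{\mathcal D}(e)=\{g:\exists h_1,\ (h_1,g)\in\mathcal H,\ \mathcal L_{\mathcal D}(h_1,g)\le\inf_{\mathcal H}\mathcal L_{\mathcal D}+e\}.$$ A pessimistic (CAP) policy is any $\hat\pi\in\Pi$ that maximizes $\inf_{g\in\mathrm{CI}_{\mathcal D}(e_{\mathcal D})}v(g,\pi)$ over $\pi\in\Pi$. *Assumptions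 on the classes.* Regularity: given $R_Z=1$, $|Y|\le L_Y$ a.s.; the functions in $\mathcal H_1$ and $\mathcal G$ are bounded by a constant $L_h$ and those in $\Theta_k$ by $L_\theta>0$; and $|\alpha_k(h)|\le L_\alpha$, with $L_\alpha>0$, for all $h\in\mathcal H$ and all arguments with $|y|\le L_Y$. Realizability: some $h_{\mathcal H}^*=(h_1,g_{\mathcal H}^*)\in\mathcal H$ has $(\|\mathcal T_1h^*_{\mathcal H}\|_{\mu_1,2}^2+\|\mathcal T_2h^*_{\mathcal H}\|_{\mu_2,2}^2)^{1/2}\le\varepsilon_{\mathcal H}$ and $\|g_{\mathcal H}^*-g^*\|_{L^2(\tilde p\otimes\pi)}\le\varepsilon_{\mathcal H}$ for all $\pi\in\Pi$. Compatibility: $\inf_{\theta\in\Theta_k}\|\theta-\mathcal T_kh\|_{\mu_k,2}\le\varepsilon_\Theta$ for all $h\in\mathcal H$ and $k=1,2$. *Distribution shift.* Suppose $b_1$ satisfies $$\mathbb E_{\mathrm{ob}}[b_1(Z)\mid A=a,X=x,R_Z=1]=\frac{\tilde p(x)\pi^*(a\mid x)}{p_{\mathrm{ob}}(x,a\mid R_Z=1)},$$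 the right-hand side being the density of $\tilde p\otimes\pi^*$ with respect to the law of $(X,A)$ given $R_Z=1$ (absolute continuity is assumed). Let $b_2(a,x,z)=b_1(z)\,p_{\mathrm{ob}}(a,x,z\mid R_Z=1)/p_{\mathrm{ob}}(a,x,z\mid R_X=R_Z=1)$, where again the ratio is a density and absolute continuity is assumed, and suppose $b_k\in L^2(\mu_k)$ for $k=1,2$. *Critical radii.* For a class $F$ of functions bounded by $c$, a critical radius on $\mathcal D_k$ is any $\delta>0$ with $\mathbb E_\varepsilon\sup\{n_k^{-1}\sum_i\varepsilon_if(w_i):f\in F,\ \|f\|_{\mathcal D_k,2}\le\delta\}\le\delta^2/c$, where the $\varepsilon_i$ are independent random signs and the $w_i$ are the points of $\mathcal D_k$. For constants $C_0,C_1>0$ and $\xi\in(0,1)$, a (possibly data-dependent) number $\eta_k$ *bounds the critical radii with respect to* $\xi$ if $\eta_k\ge C_0\big(\delta+\sqrt{\log(C_1/\xi)/\max(n_k,1)}\big)$ for some $\delta$ that is a critical radius on $\mathcal D_k$ both of $\{\alpha_k(h)\theta(Z_k):h\in\mathcal H,\theta\in\Theta_k\}$ (with $c=L_\alpha L_\theta$)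 and of $\{\theta(Z_k):\theta\in\Theta_k\}$ (with $c=L_\theta$). Let $\eta^2=\eta_1^2+\eta_2^2$, and let $\mathcal E$ be the event that for $k=1,2$, all $h\in\mathcal H$ and all $\theta\in\Theta_k$, $$\big|\mathbb E_{\mathcal D_k}[\alpha_k(h)\theta]-\mathbb E_{\mu_k}[\alpha_k(h)\theta]\big|\le\eta_k(L_\alpha\|\theta\|_{\mu_k,2}+\eta_k),\qquad\big|\|\theta\|_{\mathcal D_k,2}^2-\|\theta\|_{\mu_k,2}^2\big|\le\tfrac12(\|\theta\|_{\mu_k,2}^2+\eta_k^2).$$ *Conclusion.* There are a constant $C>0$ depending only on $L_\alpha$ and constants $C_0,C_1>0$ depending only on $L_\alpha,L_\theta$ such that in every situation as above, for all $T$ and $\xi\in(0,1)$, if $\eta_1,\eta_2$ bound the critical radii with respect to $\xi$ (with these $C_0,C_1$) and $e_{\mathcal D}>2\varepsilon_{\mathcal H}^2+(2L_\alpha^2+5/4)\eta^2$ for every dataset, then $\mathcal E$ has probability at least $1-4\xi$ (its complement has outer probability at most $4\xi$), and on $\mathcal E$ every pessimistic policy $\hat\pi$ satisfies $$\mathrm{SubOpt}(\hat\pi)\le\big(\|b_1\|_{\mu_1,2}+\|b_2\|_{\mu_2,2}\big)\big(C\varepsilon_\Theta+C\varepsilon_{\mathcal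 H}+C\sqrt{e_{\mathcal D}}+C\eta\big).$$ -/

import Mathlib

open MeasureTheory ProbabilityTheory Filter Topology

universe u

noncomputable section

/-! ### The confounded contextual bandit with an instrumental variable -/

/-- Structural model of a confounded contextual bandit with instrumental variable `Z` and
missingness.  The variables are generated in the following order.
* the context `X` has law `ctx`;
* given `X = x`, the confounder `U`, the instrument `Z` and the reward noise `ε` have joint law
  `latent x`;
* the treatment `A` is drawn from the observational policy `behavior (u, x, z)`; it does not see
  the noise, i.e. `ε` is a treatment-independent noise;
* the reward is `Y = f (A, X) + ε`, that is, `p(y | u, x, z, a)` is the law of `f (a, x) + ε` when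
  `ε` has its conditional law given `(u, x, z)`;
* the missingness indicator `R_Z` is caused by `(Z, X)` only and `R_X` by `(Z, X, A)` only. -/
structure CCBIV (𝒰 𝒳 𝒵 𝒜 : Type u) [MeasurableSpace 𝒰] [MeasurableSpace 𝒳]
    [MeasurableSpace 𝒵] [MeasurableSpace 𝒜] where
  /-- marginal law `p(x)` of the context in the observational process -/
  ctx : Measure 𝒳
  /-- conditional law of `(U, Z, ε)` given the context -/
  latent : Kernel 𝒳 (𝒰 × 𝒵 × ℝ)
  /-- the observational policy `π_ob (a | u, x, z)` -/
  behavior : Kernel (𝒰 × 𝒳 × 𝒵) 𝒜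
  /-- the structural reward function `f (a, x)` -/
  f : 𝒜 × 𝒳 → ℝ
  /-- law of `R_Z` given `(Z, X)`; `true` means that `Z` is recorded -/
  missZ : Kernel (𝒵 × 𝒳) Bool
  /-- law of `R_X` given `(Z, X, A)`; `true` means that `X` is recorded -/
  missX : Kernel (𝒵 × 𝒳 × 𝒜) Bool
  prob_ctx : IsProbabilityMeasure ctx
  markov_latent : IsMarkovKernel latent
  markov_behavior : IsMarkovKernel behavior
  measurable_f : Measurable f
  markov_missZ : IsMarkovKernel missZ
  markov_missX : IsMarkovKernel missX

/-- Everything that happens in one trial: `((((x, (u, z, ε)), a), r_Z), r_X)`. -/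
abbrev Trial (𝒰 𝒳 𝒵 𝒜 : Type u) : Type u :=
  (((𝒳 × (𝒰 × 𝒵 × ℝ)) × 𝒜) × Bool) × Bool

namespace Trial

variable {𝒰 𝒳 𝒵 𝒜 : Type u}

/-- the context -/
def X (ω : Trial 𝒰 𝒳 𝒵 𝒜) : 𝒳 := ω.1.1.1.1
/-- the instrument -/
def Z (ω : Trial 𝒰 𝒳 𝒵 𝒜) : 𝒵 := ω.1.1.1.2.2.1
/-- the reward noise -/
def noise (ω : Trial 𝒰 𝒳 𝒵 𝒜) : ℝ := ω.1.1.1.2.2.2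
/-- the treatment -/
def A (ω : Trial 𝒰 𝒳 𝒵 𝒜) : 𝒜 := ω.1.1.2
/-- the indicator that the instrument is recorded -/
def RZ (ω : Trial 𝒰 𝒳 𝒵 𝒜) : Bool := ω.1.2
/-- the indicator that the context is recorded -/
def RX (ω : Trial 𝒰 𝒳 𝒵 𝒜) : Bool := ω.2

end Trial

/-- What is recorded of one trial; `none` stands for a missing entry. -/
structure Record (𝒳 𝒵 𝒜 : Type u) where
  x : Option 𝒳
  a : 𝒜
  y : ℝ
  z : Option 𝒵

/-- The observed dataset of `T` trials. -/
abbrev Dataset (𝒳 𝒵 𝒜 : Type u) (T : ℕ) : Type u := Fin T → Record 𝒳 𝒵 𝒜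

namespace CCBIV

variable {𝒰 𝒳 𝒵 𝒜 : Type u} [MeasurableSpace 𝒰] [MeasurableSpace 𝒳]
  [MeasurableSpace 𝒵] [MeasurableSpace 𝒜] (M : CCBIV 𝒰 𝒳 𝒵 𝒜)

/-- The reward `Y = f (A, X) + ε`. -/
def Y (ω : Trial 𝒰 𝒳 𝒵 𝒜) : ℝ := M.f (ω.A, ω.X) + ω.noise

/-- The law `P_ob` of one trial of the observational process. -/
def obs : Measure (Trial 𝒰 𝒳 𝒵 𝒜) :=
  (((M.ctx ⊗ₘ M.latent)
    ⊗ₘ M.behavior.comap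
        (fun p : 𝒳 × (𝒰 × 𝒵 × ℝ) => (p.2.1, p.1, p.2.2.1)) (by fun_prop))
    ⊗ₘ M.missZ.comap
        (fun p : (𝒳 × (𝒰 × 𝒵 × ℝ)) × 𝒜 => (p.1.2.2.1, p.1.1)) (by fun_prop))
    ⊗ₘ M.missX.comap
        (fun p : ((𝒳 × (𝒰 × 𝒵 × ℝ)) × 𝒜) × Bool => (p.1.1.2.2.1, p.1.1.1, p.1.2))
        (by fun_prop)

/-- `P_ob ( · | R_Z = 1)`. -/
def obsZ : Measure (Trial 𝒰 𝒳 𝒵 𝒜) := M.obs[|{ω | ω.RZ = true}]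

/-- `P_ob ( · | (R_X, R_Z) = (1, 1))`. -/
def obsXZ : Measure (Trial 𝒰 𝒳 𝒵 𝒜) := M.obs[|{ω | ω.RX = true ∧ ω.RZ = true}]

/-- The conditional average treatment effect `g* (x, a) = E_ob [Y | X = x, do (A = a)]`: the
observational policy is deleted and the treatment is set to `a`. -/
def cate (p : 𝒳 × 𝒜) : ℝ := ∫ l, (M.f (p.2, p.1) + l.2.2) ∂(M.latent p.1)

/-- The model assumptions on the instrument, together with integrability of the noise.  That
`ε ⊥ A | (X, U)` and that the missingness is unconfounded and outcome-independent is built into the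
generating mechanism. -/
structure ValidIV : Prop where
  /-- the noise has a finite mean -/
  integrable_noise : Integrable (fun p => p.2.2.2) (M.ctx ⊗ₘ M.latent)
  /-- IV independence: `Z ⊥ (U, ε) | X` -/
  indep : ∀ᵐ x ∂M.ctx,
    IndepFun (fun l : 𝒰 × 𝒵 × ℝ => l.2.1) (fun l : 𝒰 × 𝒵 × ℝ => (l.1, l.2.2)) (M.latent x)
  /-- IV completeness: `E_ob [σ (X, A) | Z, R_Z = 1] = 0` if and only if `σ (X, A) = 0` a.s. -/
  complete : ∀ σ : 𝒳 × 𝒜 → ℝ, Measurable σ →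
    Integrable (fun ω : Trial 𝒰 𝒳 𝒵 𝒜 => σ (ω.X, ω.A)) M.obsZ →
    (M.obsZ[fun ω => σ (ω.X, ω.A) | MeasurableSpace.comap Trial.Z inferInstance] =ᵐ[M.obsZ] 0 ↔
      ∀ᵐ ω ∂M.obs, σ (ω.X, ω.A) = 0)

/-- Existence of a square-integrable bridge function:
`E_ob [g* (X, A) - h₁ (Y, A, Z) | A, X, Z, R_Z = 1] = 0`. -/
def BridgeExists : Prop :=
  ∃ h₁ : ℝ × 𝒜 × 𝒵 → ℝ, Measurable h₁ ∧
    MemLp (fun ω => h₁ (M.Y ω, ω.A, ω.Z)) 2 M.obsZ ∧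
    M.obsZ[fun ω => h₁ (M.Y ω, ω.A, ω.Z) |
        MeasurableSpace.comap (fun ω : Trial 𝒰 𝒳 𝒵 𝒜 => (ω.A, ω.X, ω.Z)) inferInstance]
      =ᵐ[M.obsZ] fun ω => M.cate (ω.X, ω.A)

/-- The record of a trial: `X` and `Z` are lost unless `R_X = 1` and `R_Z = 1`, respectively. -/
def observe (ω : Trial 𝒰 𝒳 𝒵 𝒜) : Record 𝒳 𝒵 𝒜 where
  x := if ω.RX then some ω.X else none
  a := ω.A
  y := M.Y ω
  z := if ω.RZ then some ω.Z else none

/-- The observed dataset of `T` trials. -/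
def dataset {T : ℕ} (ω : Fin T → Trial 𝒰 𝒳 𝒵 𝒜) : Dataset 𝒳 𝒵 𝒜 T := fun t => M.observe (ω t)

/-- The law `μ₁` of `(Y, A, Z)` given `R_Z = 1`. -/
def μ₁ : Measure (ℝ × 𝒜 × 𝒵) := M.obsZ.map (fun ω => (M.Y ω, ω.A, ω.Z))

/-- The law `μ₂` of `(X, Y, A, Z)` given `(R_X, R_Z) = (1, 1)`. -/
def μ₂ : Measure (𝒳 × ℝ × 𝒜 × 𝒵) := M.obsXZ.map (fun ω => (ω.X, M.Y ω, ω.A, ω.Z))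

/-- The interventional process with context law `ptilde` and policy `π`; the outcome is
`((x, (u, z, ε)), a)`. -/
def interv (ptilde : Measure 𝒳) (π : Kernel 𝒳 𝒜) : Measure ((𝒳 × (𝒰 × 𝒵 × ℝ)) × 𝒜) :=
  (ptilde ⊗ₘ M.latent) ⊗ₘ π.comap (fun p : 𝒳 × (𝒰 × 𝒵 × ℝ) => p.1) measurable_fst

/-- The reward as a function of the outcome of the interventional process. -/
def intervY (p : (𝒳 × (𝒰 × 𝒵 × ℝ)) × 𝒜) : ℝ := M.f (p.2, p.1.1) + p.1.2.2.2

/-- The average reward `v^π = E_in [Y]`. -/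
def value (ptilde : Measure 𝒳) (π : Kernel 𝒳 𝒜) : ℝ := ∫ p, M.intervY p ∂(M.interv ptilde π)

/-- `v (g, π) = E_in [g (X, A)]`. -/
def valueOf (ptilde : Measure 𝒳) (g : 𝒳 × 𝒜 → ℝ) (π : Kernel 𝒳 𝒜) : ℝ :=
  ∫ p, g (p.1.1, p.2) ∂(M.interv ptilde π)

end CCBIV

/-! ### Empirical averages, local Rademacher complexity, minimax loss -/

section Generic

variable {W V : Type u} {T : ℕ}

/-- Number of available samples. -/
def sampleSize (d : Fin T → Option W) : ℕ := (Finset.univ.filter fun t => (d t).isSome).card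

/-- Average of `f` over the available samples. -/
def empMean (d : Fin T → Option W) (f : W → ℝ) : ℝ :=
  (∑ t, (d t).elim 0 f) / (sampleSize d : ℝ)

/-- Localized empirical Rademacher complexity
`E_ε [sup {n⁻¹ ∑ᵢ εᵢ f (wᵢ) : f ∈ F, ‖f‖_D ≤ r}]` over the available samples; the signs attached to
missing samples are averaged out. -/
def localRademacher (d : Fin T → Option W) (F : Set (W → ℝ)) (r : ℝ) : ℝ :=
  (∑ s : Fin T → Bool,
    sSup ((fun f : W → ℝ =>
        (∑ t, (if s t then (1 : ℝ) else -1) * (d t).elim 0 f) / (sampleSize d : ℝ)) ''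
      {f | f ∈ F ∧ √(empMean d fun w => f w ^ 2) ≤ r})) / 2 ^ T

/-- `δ` is a critical radius, on the sample `d`, of the class `F` of functions bounded by `c`. -/
def IsCriticalRadius (d : Fin T → Option W) (F : Set (W → ℝ)) (c δ : ℝ) : Prop :=
  0 < δ ∧ localRademacher d F δ ≤ δ ^ 2 / c

/-- The product class `{res · θ(inst) : res ∈ R, θ ∈ Θ}`. -/
def productClass (R : Set (W → ℝ)) (inst : W → V) (Θ : Set (V → ℝ)) : Set (W → ℝ) :=
  {q | ∃ r ∈ R, ∃ θ ∈ Θ, q = fun w => r w * θ (inst w)}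

/-- `η` bounds the critical radii of the product class (of functions bounded by `L_α L_θ`) and of
the test class (of functions bounded by `L_θ`) on the sample `d` with respect to the confidence
level `ξ`: up to the constant factor `C₀`, it dominates a common critical radius `δ` plus
`√(log (C₁ / ξ) / n)`.  (With no sample, `n` is read as `1`.) -/
def BoundsCriticalRadius (d : Fin T → Option W) (R : Set (W → ℝ)) (inst : W → V)
    (Θ : Set (V → ℝ)) (Lα Lθ C₀ C₁ ξ η : ℝ) : Prop :=
  ∃ δ, IsCriticalRadius d (productClass R inst Θ) (Lα * Lθ) δ ∧
    IsCriticalRadius d ((fun θ w => θ (inst w)) '' Θ) Lθ δ ∧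
    C₀ * (δ + √(Real.log (C₁ / ξ) / (max (sampleSize d) 1 : ℕ))) ≤ η

/-- The empirical minimax loss
`sup_{θ ∈ Θ} E_D [res · θ(inst)] - ½ ‖θ(inst)‖²_D`. -/
def empLoss (d : Fin T → Option W) (inst : W → V) (Θ : Set (V → ℝ)) (res : W → ℝ) : ℝ :=
  sSup ((fun θ : V → ℝ => empMean d (fun w => res w * θ (inst w))
    - 1 / 2 * empMean d (fun w => θ (inst w) ^ 2)) '' Θ)

/-- The class `F` contains a countable subset from which each of its members is obtained as a
pointwise limit of a sequence. -/
def PointwiseSeparable (F : Set (W → ℝ)) : Prop :=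
  ∃ F₀ ⊆ F, F₀.Countable ∧ ∀ f ∈ F, ∃ s : ℕ → W → ℝ, (∀ n, s n ∈ F₀) ∧
    ∀ w, Tendsto (fun n => s n w) atTop (𝓝 (f w))

variable [MeasurableSpace W] [MeasurableSpace V]

/-- The norm `‖f‖_{μ,2}` of a square-integrable function. -/
def l2norm (μ : Measure W) (f : W → ℝ) : ℝ := √(∫ w, f w ^ 2 ∂μ)

/-- The projected residual `E_μ [res | inst]`, as a function on the sample space. -/
def proj (μ : Measure W) (inst : W → V) (res : W → ℝ) : W → ℝ :=
  μ[res | MeasurableSpace.comap inst inferInstance]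

/-- The part of the event `𝓔` that concerns one of the moment equations. -/
def Concentrates (μ : Measure W) (d : Fin T → Option W) (R : Set (W → ℝ)) (inst : W → V)
    (Θ : Set (V → ℝ)) (Lα η : ℝ) : Prop :=
  ∀ θ ∈ Θ,
    (∀ r ∈ R, |empMean d (fun w => r w * θ (inst w)) - ∫ w, r w * θ (inst w) ∂μ|
      ≤ η * (Lα * l2norm μ (fun w => θ (inst w)) + η)) ∧
    |empMean d (fun w => θ (inst w) ^ 2) - ∫ w, θ (inst w) ^ 2 ∂μ|
      ≤ 1 / 2 * ((∫ w, θ (inst w) ^ 2 ∂μ) + η ^ 2)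

/-- Regularity of a test function class: non-empty, star-shaped about `0`, consisting of measurable
functions bounded by `L`, and pointwise separable. -/
structure TestClass (Θ : Set (V → ℝ)) (L : ℝ) : Prop where
  nonempty : Θ.Nonempty
  starShaped : StarConvex ℝ 0 Θ
  measurable : ∀ θ ∈ Θ, Measurable θ
  bounded : ∀ θ ∈ Θ, ∀ v, |θ v| ≤ L
  separable : PointwiseSeparable Θ

/-- Regularity of a hypothesis class: measurable functions bounded by `L`, pointwise separable. -/
structure HypothesisClass (F : Set (W → ℝ)) (L : ℝ) : Prop where
  measurable : ∀ f ∈ F, Measurable f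
  bounded : ∀ f ∈ F, ∀ w, |f w| ≤ L
  separable : PointwiseSeparable F

/-- Compatibility: `inf_{θ ∈ Θ} ‖θ - E_μ [res | inst]‖_{μ,2} ≤ ε` for every residual. -/
def Compatible (μ : Measure W) (R : Set (W → ℝ)) (inst : W → V) (Θ : Set (V → ℝ)) (ε : ℝ) : Prop :=
  ∀ r ∈ R, sInf ((fun θ : V → ℝ => l2norm μ (fun w => θ (inst w) - proj μ inst r w)) '' Θ) ≤ ε

end Generic

/-! ### The two moment equations of the model, and the CAP policy -/

section CAP

variable {𝒳 𝒵 𝒜 : Type u} {T : ℕ}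

/-- The subsample with `R_Z = 1`, in the form `(y, a, z)`. -/
def data₁ (d : Dataset 𝒳 𝒵 𝒜 T) : Fin T → Option (ℝ × 𝒜 × 𝒵) :=
  fun t => (d t).z.map fun z => ((d t).y, (d t).a, z)

/-- The subsample with `(R_X, R_Z) = (1, 1)`, in the form `(x, y, a, z)`. -/
def data₂ (d : Dataset 𝒳 𝒵 𝒜 T) : Fin T → Option (𝒳 × ℝ × 𝒜 × 𝒵) :=
  fun t => (d t).x.bind fun x => (d t).z.map fun z => (x, (d t).y, (d t).a, z)

/-- The variable `Z` conditioned on in the first equation. -/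
def inst₁ (w : ℝ × 𝒜 × 𝒵) : 𝒵 := w.2.2

/-- The variables `(A, X, Z)` conditioned on in the second equation. -/
def inst₂ (w : 𝒳 × ℝ × 𝒜 × 𝒵) : 𝒜 × 𝒳 × 𝒵 := (w.2.2.1, w.1, w.2.2.2)

/-- `α₁ (h, Y) = h₁ (Y, A, Z) - Y`. -/
def α₁ (h : (ℝ × 𝒜 × 𝒵 → ℝ) × (𝒳 × 𝒜 → ℝ)) (w : ℝ × 𝒜 × 𝒵) : ℝ := h.1 w - w.1

/-- `α₂ (h) = g (X, A) - h₁ (Y, A, Z)`. -/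
def α₂ (h : (ℝ × 𝒜 × 𝒵 → ℝ) × (𝒳 × 𝒜 → ℝ)) (w : 𝒳 × ℝ × 𝒜 × 𝒵) : ℝ :=
  h.2 (w.1, w.2.2.1) - h.1 w.2

/-- The empirical loss `𝓛_D (h) = 𝓛_{1,D} (h) + 𝓛_{2,D} (h)`. -/
def lossD (d : Dataset 𝒳 𝒵 𝒜 T) (Θ₁ : Set (𝒵 → ℝ)) (Θ₂ : Set (𝒜 × 𝒳 × 𝒵 → ℝ))
    (h : (ℝ × 𝒜 × 𝒵 → ℝ) × (𝒳 × 𝒜 → ℝ)) : ℝ :=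
  empLoss (data₁ d) inst₁ Θ₁ (α₁ h) + empLoss (data₂ d) inst₂ Θ₂ (α₂ h)

/-- The confidence set for `h`: `{h ∈ H : 𝓛_D (h) ≤ inf_H 𝓛_D + e}`. -/
def confH (d : Dataset 𝒳 𝒵 𝒜 T) (H : Set ((ℝ × 𝒜 × 𝒵 → ℝ) × (𝒳 × 𝒜 → ℝ)))
    (Θ₁ : Set (𝒵 → ℝ)) (Θ₂ : Set (𝒜 × 𝒳 × 𝒵 → ℝ)) (e : ℝ) :
    Set ((ℝ × 𝒜 × 𝒵 → ℝ) × (𝒳 × 𝒜 → ℝ)) :=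
  {h | h ∈ H ∧ lossD d Θ₁ Θ₂ h ≤ sInf (lossD d Θ₁ Θ₂ '' H) + e}

/-- The confidence set for the conditional average treatment effect. -/
def confG (d : Dataset 𝒳 𝒵 𝒜 T) (H : Set ((ℝ × 𝒜 × 𝒵 → ℝ) × (𝒳 × 𝒜 → ℝ)))
    (Θ₁ : Set (𝒵 → ℝ)) (Θ₂ : Set (𝒜 × 𝒳 × 𝒵 → ℝ)) (e : ℝ) : Set (𝒳 × 𝒜 → ℝ) :=
  Prod.snd '' confH d H Θ₁ Θ₂ e

variable {𝒰 : Type u} [MeasurableSpace 𝒰] [MeasurableSpace 𝒳] [MeasurableSpace 𝒵]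
  [MeasurableSpace 𝒜]

/-- `πhat` is a pessimistic policy on the confidence set `CI`:
`πhat ∈ argmax_{π ∈ P} inf_{g ∈ CI} v (g, π)`. -/
def IsPessimistic (M : CCBIV 𝒰 𝒳 𝒵 𝒜) (ptilde : Measure 𝒳) (P : Set (Kernel 𝒳 𝒜))
    (CI : Set (𝒳 × 𝒜 → ℝ)) (πhat : Kernel 𝒳 𝒜) : Prop :=
  πhat ∈ P ∧ ∀ π ∈ P, sInf ((fun g => M.valueOf ptilde g π) '' CI)
    ≤ sInf ((fun g => M.valueOf ptilde g πhat) '' CI)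

/-- `πstar` maximizes the average reward over `P`. -/
def IsOptimal (M : CCBIV 𝒰 𝒳 𝒵 𝒜) (ptilde : Measure 𝒳) (P : Set (Kernel 𝒳 𝒜))
    (πstar : Kernel 𝒳 𝒜) : Prop :=
  πstar ∈ P ∧ ∀ π ∈ P, M.value ptilde π ≤ M.value ptilde πstar

/-- Realizability with error `ε`: some `h = (h₁, g) ∈ H` has `‖𝒯 h‖_{μ,2} ≤ ε` and
`‖g - g*‖_{v,2} ≤ ε` for each `v (x, a) = ptilde (x) π (a | x)` with `π ∈ P`. -/
def Realizable (M : CCBIV 𝒰 𝒳 𝒵 𝒜) (ptilde : Measure 𝒳) (P : Set (Kernel 𝒳 𝒜))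
    (H : Set ((ℝ × 𝒜 × 𝒵 → ℝ) × (𝒳 × 𝒜 → ℝ))) (ε : ℝ) : Prop :=
  ∃ h ∈ H,
    √(l2norm M.μ₁ (proj M.μ₁ inst₁ (α₁ h)) ^ 2 + l2norm M.μ₂ (proj M.μ₂ inst₂ (α₂ h)) ^ 2) ≤ ε ∧
    ∀ π ∈ P, eLpNorm (fun p => h.2 p - M.cate p) 2 (ptilde ⊗ₘ π) ≤ ENNReal.ofReal ε

/-- The event `𝓔`, as a property of the dataset. -/
def GoodEvent (M : CCBIV 𝒰 𝒳 𝒵 𝒜) (d : Dataset 𝒳 𝒵 𝒜 T)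
    (H : Set ((ℝ × 𝒜 × 𝒵 → ℝ) × (𝒳 × 𝒜 → ℝ)))
    (Θ₁ : Set (𝒵 → ℝ)) (Θ₂ : Set (𝒜 × 𝒳 × 𝒵 → ℝ)) (Lα η₁ η₂ : ℝ) : Prop :=
  Concentrates M.μ₁ (data₁ d) (α₁ '' H) inst₁ Θ₁ Lα η₁ ∧
    Concentrates M.μ₂ (data₂ d) (α₂ '' H) inst₂ Θ₂ Lα η₂

/-- `b₁ (Z)` is a distribution-shift function for the policy `πstar`:
`E_ob [b₁ (Z) | A = a, X = x, R_Z = 1] = ptilde (x) πstar (a | x) / p_ob (x, a | R_Z = 1)`, where the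
right-hand side is the density of the first law of `(X, A)` with respect to the second. -/
def IsShift (M : CCBIV 𝒰 𝒳 𝒵 𝒜) (ptilde : Measure 𝒳) (πstar : Kernel 𝒳 𝒜) (b₁ : 𝒵 → ℝ) : Prop :=
  ptilde ⊗ₘ πstar ≪ M.obsZ.map (fun ω => (ω.X, ω.A)) ∧
  M.obsZ[fun ω => b₁ ω.Z |
      MeasurableSpace.comap (fun ω : Trial 𝒰 𝒳 𝒵 𝒜 => (ω.A, ω.X)) inferInstance]
    =ᵐ[M.obsZ] fun ω =>
      ((ptilde ⊗ₘ πstar).rnDeriv (M.obsZ.map (fun ω => (ω.X, ω.A))) (ω.X, ω.A)).toReal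

/-- `b₂ (a, x, z) = b₁ (z) p_ob (a, x, z | R_Z = 1) / p_ob (a, x, z | (R_X, R_Z) = (1, 1))`. -/
def b₂of (M : CCBIV 𝒰 𝒳 𝒵 𝒜) (b₁ : 𝒵 → ℝ) (p : 𝒜 × 𝒳 × 𝒵) : ℝ :=
  b₁ p.2.2 *
    ((M.obsZ.map (fun ω => (ω.A, ω.X, ω.Z))).rnDeriv
      (M.obsXZ.map (fun ω => (ω.A, ω.X, ω.Z))) p).toReal

end CAP

end

/-! The proof has a deterministic half, which bounds the regret on `𝓔`, and a probabilistic half,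
which shows that `𝓔` is likely.

Deterministic half. The residual `Y - g*(X, A)` is the centered noise `ε - E[ε | X]`. Given `X` it
is uncorrelated with every function of `Z`, and this survives conditioning on `R_Z = 1`, because
recording depends on `(Z, X)` only (`CCBIV.integral_sub_cate_mul_eq_zero`). Write `g - g* = (g - h₁)
+ (h₁ - Y) + (Y - g*)` and use `b₁(Z)` as an importance weight: the last summand vanishes, and the
error of `g` in evaluating `π*` becomes `E_{μ₁}[α₁ b₁] + E_{μ₂}[α₂ b₂]`, where `b₂` also undoes the
selection by `R_X` (`CCBIV.valueOf_sub_value_eq`). By Cauchy–Schwarz this is at most `∑ ‖𝒯_k h‖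
‖b_k‖`. On `𝓔` the empirical minimax loss is comparable to the squared projected residuals in both
directions (`empLoss_le_of_concentrates`, `l2norm_proj_le_of_concentrates`). Hence the realizing
hypothesis lies in the confidence set and every member of that set has small residuals. Pessimism
needs no more: all members evaluate `π*` well, and one member evaluates the chosen policy well
(`value_sub_value_le_of_isPessimistic`).

Probabilistic half. The difficulty is that the radius is read off the sample itself. The sample is
compared with an independent ghost sample. Swapping coordinates of the pair does not change its law,
so the pair can be frozen and only the random swap signs considered. Two convex Lipschitz functions
of these signs matter: the supremum of the increments between the two swapped samples, and the
Rademacher average of the first swapped sample. Talagrand's convex distance inequality concentrates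
the former from above and the latter from below, while symmetrization and contraction compare their
means. So the increments are controlled by the empirical Rademacher average of the first sample
(`card_swap_deviation_le`), which is what a critical radius bounds. The class is localized in the
pooled norm of both samples, which swaps preserve.

Chebyshev's inequality places the ghost moments near the population moments, star-shapedness allows
rescaling to the localized class, and a union bound over dyadic levels handles the random radius
(`measure_exists_deviates_le`). Finally, conditioning on which trials are recorded turns each
subsample of random size into a product sample (`measure_eventSample_deviates_le`). -/

noncomputable section

/-! ### Concentration of convex functions on the hypercube -/

/-- The sign `±1` encoded by a Boolean. -/
def boolSign (b : Bool) : ℝ := if b then 1 else -1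

/-- The vertex of the cube `[-1, 1]ⁿ` encoded by a Boolean vector. -/
def signVec {n : ℕ} (x : Fin n → Bool) : Fin n → ℝ := fun i => boolSign (x i)

lemma boolSign_not (b : Bool) : boolSign (!b) = -boolSign b := by
  cases b <;> simp [boolSign]

lemma boolSign_sq (b : Bool) : boolSign b ^ 2 = 1 := by
  cases b <;> simp [boolSign]

lemma abs_boolSign (b : Bool) : |boolSign b| = 1 := by
  cases b <;> simp [boolSign]

lemma signVec_cons {n : ℕ} (b : Bool) (x : Fin n → Bool) :
    signVec (Fin.cons b x : Fin (n + 1) → Bool) = Fin.cons (boolSign b) (signVec x) := by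
  funext i
  refine Fin.cases ?_ (fun j => ?_) i <;> simp [signVec]

/-- The exponent `t ^ 2 / 8 + (1 - t) * L` is minimal at `t = 4 L`, admissible while `L ≤ 1/4`.
Beyond that `t = 1` suffices, because `exp (1/8) ≤ 6/5 ≤ 2 - exp (-L)`. In the application `exp
(-L)` is the ratio of the sizes of two slices. -/
lemma exists_interpolation_exponent {L : ℝ} (hL : 0 ≤ L) :
    ∃ t : ℝ, 0 ≤ t ∧ t ≤ 1 ∧ Real.exp (t ^ 2 / 8 + (1 - t) * L) ≤ 2 - Real.exp (-L) := by
  rcases le_total L (1 / 4) with h | h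
  · refine ⟨4 * L, by linarith, by linarith, ?_⟩
    have h1 : Real.exp (-L) ≤ 1 - L + L ^ 2 := by
      have := Real.abs_exp_sub_one_sub_id_le (x := -L) (by rw [abs_le]; constructor <;> linarith)
      have := (abs_le.1 this).2
      nlinarith
    have h1' : Real.exp (-L) ≤ 1 - L + L ^ 2 / 2 := by
      have h2 := Real.quadratic_le_exp_of_nonneg hL
      rw [Real.exp_neg, inv_le_comm₀ (Real.exp_pos _) (by nlinarith)]
      refine le_trans ?_ h2
      rw [inv_le_iff_one_le_mul₀ (by nlinarith)]
      nlinarith [pow_nonneg hL 3, pow_nonneg hL 4]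
    have e : (4 * L) ^ 2 / 8 + (1 - 4 * L) * L = L - 2 * L ^ 2 := by ring
    rw [e]
    have h3 : Real.exp (L - 2 * L ^ 2) ≤ 1 + (L - 2 * L ^ 2) + (L - 2 * L ^ 2) ^ 2 := by
      have := Real.abs_exp_sub_one_sub_id_le (x := L - 2 * L ^ 2)
        (by rw [abs_le]; constructor <;> nlinarith)
      have := (abs_le.1 this).2
      linarith
    have h4 : (L - 2 * L ^ 2) ^ 2 ≤ L ^ 2 := by
      apply pow_le_pow_left₀ <;> nlinarith
    nlinarith
  · refine ⟨1, by norm_num, le_refl _, ?_⟩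
    have h1 : Real.exp (-L) ≤ 4 / 5 := by
      rw [Real.exp_neg, inv_le_comm₀ (Real.exp_pos _) (by norm_num)]
      have := Real.add_one_le_exp L
      linarith
    have h2 : Real.exp (1 / 8) ≤ 6 / 5 := by
      have := Real.abs_exp_sub_one_sub_id_le (x := 1 / 8) (by rw [abs_le]; norm_num)
      have := (abs_le.1 this).2
      linarith
    norm_num at h2 ⊢
    linarith

/-- A sum over the cube, split according to the first coordinate. -/
lemma sum_cube_succ {n : ℕ} (b : Bool) (F : (Fin (n + 1) → Bool) → ℝ) :
    ∑ x, F x = ∑ x : Fin n → Bool, F (Fin.cons b x) + ∑ x : Fin n → Bool, F (Fin.cons (!b) x) := by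
  rw [← (Fin.consEquiv (fun _ : Fin (n + 1) => Bool)).sum_comp, Fintype.sum_prod_type,
    Fintype.sum_bool]
  cases b
  · rw [add_comm]; rfl
  · rfl

lemma card_cube_succ {n : ℕ} (b : Bool) (A : Finset (Fin (n + 1) → Bool)) :
    A.card = (Finset.univ.filter fun x : Fin n → Bool => (Fin.cons b x : Fin (n + 1) → Bool) ∈ A).card
      + (Finset.univ.filter fun x : Fin n → Bool =>
          (Fin.cons (!b) x : Fin (n + 1) → Bool) ∈ A).card := by
  have h := sum_cube_succ b (fun x => if x ∈ A then (1 : ℝ) else 0)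
  simp only [Finset.sum_ite_mem, Finset.univ_inter, Finset.sum_const, nsmul_eq_mul, mul_one] at h
  rw [← Finset.sum_filter, ← Finset.sum_filter] at h
  simp only [Finset.sum_const, nsmul_eq_mul, mul_one] at h
  exact_mod_cast h

/-- The convex hull of a set of vertices of the cube. -/
def vertexHull {n : ℕ} (A : Finset (Fin n → Bool)) : Set (Fin n → ℝ) :=
  convexHull ℝ (signVec '' (A : Set (Fin n → Bool)))

lemma cons_mem_vertexHull {n : ℕ} (b : Bool) (A : Finset (Fin (n + 1) → Bool)) {m : Fin n → ℝ}
    (hm : m ∈ vertexHull (Finset.univ.filter fun x : Fin n → Bool =>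
      (Fin.cons b x : Fin (n + 1) → Bool) ∈ A)) :
    (Fin.cons (boolSign b) m : Fin (n + 1) → ℝ) ∈ vertexHull A := by
  have hc : Convex ℝ {m : Fin n → ℝ | (Fin.cons (boolSign b) m : Fin (n + 1) → ℝ) ∈ vertexHull A} := by
    intro p hp q hq s t hs ht hst
    have := (convex_convexHull ℝ (signVec '' (A : Set (Fin (n + 1) → Bool)))) hp hq hs ht hst
    have e : (Fin.cons (boolSign b) (s • p + t • q) : Fin (n + 1) → ℝ)
        = s • (Fin.cons (boolSign b) p : Fin (n + 1) → ℝ)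
          + t • (Fin.cons (boolSign b) q : Fin (n + 1) → ℝ) := by
      funext i
      refine Fin.cases ?_ (fun j => ?_) i
      · simp [← add_mul, hst]
      · simp
    simp only [Set.mem_ofPred_eq]
    rw [e]
    exact this
  refine convexHull_min ?_ hc hm
  rintro _ ⟨x, hx, rfl⟩
  simp only [Finset.coe_filter, Finset.mem_univ, true_and, Set.mem_ofPred_eq] at hx
  refine subset_convexHull ℝ _ ⟨_, hx, signVec_cons b x⟩

/-- Hölder's inequality with exponents `1/t` and `1/(1-t)`, proved by normalizing both sums to be at
most `1` and using convexity of `exp`. -/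
lemma sum_exp_interpolate_le {ι : Type*} [Fintype ι] {D₀ D₁ : ι → ℝ} {l₀ l₁ t : ℝ}
    (ht0 : 0 ≤ t) (ht1 : t ≤ 1) (h₀ : ∑ x, Real.exp (D₀ x) ≤ Real.exp l₀)
    (h₁ : ∑ x, Real.exp (D₁ x) ≤ Real.exp l₁) :
    ∑ x, Real.exp (t * D₀ x + (1 - t) * D₁ x) ≤ Real.exp (t * l₀ + (1 - t) * l₁) := by
  have key : ∀ x, Real.exp (t * D₀ x + (1 - t) * D₁ x) ≤ Real.exp (t * l₀ + (1 - t) * l₁) *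
      (t * (Real.exp (D₀ x) * Real.exp (-l₀)) + (1 - t) * (Real.exp (D₁ x) * Real.exp (-l₁))) := by
    intro x
    have := convexOn_exp.2 (Set.mem_univ (D₀ x - l₀)) (Set.mem_univ (D₁ x - l₁)) ht0
      (by linarith : 0 ≤ 1 - t) (by ring)
    simp only [smul_eq_mul] at this
    rw [← Real.exp_add, ← Real.exp_add, ← sub_eq_add_neg, ← sub_eq_add_neg]
    calc Real.exp (t * D₀ x + (1 - t) * D₁ x)
        = Real.exp (t * l₀ + (1 - t) * l₁) *
            Real.exp (t * (D₀ x - l₀) + (1 - t) * (D₁ x - l₁)) := by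
          rw [← Real.exp_add]; congr 1; ring
      _ ≤ _ := by gcongr
  refine (Finset.sum_le_sum fun x _ => key x).trans ?_
  rw [← Finset.mul_sum, Finset.sum_add_distrib, ← Finset.mul_sum, ← Finset.mul_sum,
    ← Finset.sum_mul, ← Finset.sum_mul]
  have a₀ : (∑ x, Real.exp (D₀ x)) * Real.exp (-l₀) ≤ 1 := by
    rw [Real.exp_neg, ← div_eq_mul_inv, div_le_one (Real.exp_pos _)]; exact h₀
  have a₁ : (∑ x, Real.exp (D₁ x)) * Real.exp (-l₁) ≤ 1 := by
    rw [Real.exp_neg, ← div_eq_mul_inv, div_le_one (Real.exp_pos _)]; exact h₁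
  have : t * ((∑ x, Real.exp (D₀ x)) * Real.exp (-l₀))
      + (1 - t) * ((∑ x, Real.exp (D₁ x)) * Real.exp (-l₁)) ≤ 1 := by nlinarith
  calc _ ≤ Real.exp (t * l₀ + (1 - t) * l₁) * 1 := by gcongr
    _ = _ := mul_one _

/-- The first coordinate of the mixture misses its target by `2t`, whence `4 t ^ 2 / 32 = t ^ 2 /
8`; convexity of the square handles the remaining coordinates. -/
lemma sum_sq_interpolate_le {n : ℕ} (b : Bool) (x : Fin n → Bool) (m₀ m₁ : Fin n → ℝ) {t : ℝ}
    (ht0 : 0 ≤ t) (ht1 : t ≤ 1) :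
    (∑ i, (signVec (Fin.cons (!b) x : Fin (n + 1) → Bool) i -
      (t • (Fin.cons (boolSign b) m₀ : Fin (n + 1) → ℝ)
        + (1 - t) • (Fin.cons (boolSign (!b)) m₁ : Fin (n + 1) → ℝ)) i) ^ 2) / 32
      ≤ t ^ 2 / 8 + (t * ((∑ i, (signVec x i - m₀ i) ^ 2) / 32)
        + (1 - t) * ((∑ i, (signVec x i - m₁ i) ^ 2) / 32)) := by
  rw [signVec_cons, Fin.sum_univ_succ]
  simp only [Fin.cons_zero, Fin.cons_succ, Pi.add_apply, Pi.smul_apply, smul_eq_mul, boolSign_not]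
  have h1 : (-boolSign b - (t * boolSign b + (1 - t) * -boolSign b)) ^ 2 = 4 * t ^ 2 := by
    have := boolSign_sq b
    linear_combination (4 * t ^ 2) * this
  have h2 : ∑ i, (signVec x i - (t * m₀ i + (1 - t) * m₁ i)) ^ 2
      ≤ t * ∑ i, (signVec x i - m₀ i) ^ 2 + (1 - t) * ∑ i, (signVec x i - m₁ i) ^ 2 := by
    rw [Finset.mul_sum, Finset.mul_sum, ← Finset.sum_add_distrib]
    refine Finset.sum_le_sum fun i _ => ?_
    have : t * (signVec x i - m₀ i) ^ 2 + (1 - t) * (signVec x i - m₁ i) ^ 2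
        - (signVec x i - (t * m₀ i + (1 - t) * m₁ i)) ^ 2 = t * (1 - t) * (m₀ i - m₁ i) ^ 2 := by
      ring
    have : 0 ≤ t * (1 - t) * (m₀ i - m₁ i) ^ 2 := by
      have : 0 ≤ 1 - t := by linarith
      positivity
    linarith
  rw [h1]
  linarith

/-- Talagrand's convex distance inequality on the hypercube. -/
theorem talagrand_convex_distance : ∀ {n : ℕ} (A : Finset (Fin n → Bool)), A.Nonempty →
    ∃ m : (Fin n → Bool) → (Fin n → ℝ), (∀ x, m x ∈ vertexHull A) ∧
      (A.card : ℝ) * ∑ x, Real.exp ((∑ i, (signVec x i - m x i) ^ 2) / 32) ≤ 4 ^ n := by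
  intro n
  induction n with
  | zero =>
    intro A hA
    obtain ⟨a, ha⟩ := hA
    refine ⟨signVec, fun x => subset_convexHull ℝ _ ⟨x, ?_, rfl⟩, ?_⟩
    · rw [Subsingleton.elim x a]; exact ha
    · have : A.card ≤ 1 := (Finset.card_le_univ A).trans (by simp)
      simpa using this
  | succ n ih =>
    intro A hA
    set sl : Bool → Finset (Fin n → Bool) := fun b =>
      Finset.univ.filter fun x : Fin n → Bool => (Fin.cons b x : Fin (n + 1) → Bool) ∈ A with hsl
    -- Induction on the dimension, with `b` the side carrying the larger slice of `A`. Points on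
    -- that side are approximated inside their own slice. Points on the other side may mix
    -- approximants from both slices.
    obtain ⟨b, hb⟩ : ∃ b, (sl (!b)).card ≤ (sl b).card := by
      rcases le_total (sl true).card (sl false).card with h | h
      · exact ⟨false, h⟩
      · exact ⟨true, h⟩
    have hcard : A.card = (sl b).card + (sl (!b)).card := card_cube_succ b A
    have hpos : 0 < (sl b).card := by
      have := hA.card_pos
      omega
    obtain ⟨m₀, hm₀, hs₀⟩ := ih (sl b) (Finset.card_pos.1 hpos)
    set p : ℝ := ((sl b).card : ℝ) with hp
    set q : ℝ := ((sl (!b)).card : ℝ) with hq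
    have hp0 : 0 < p := by rw [hp]; exact_mod_cast hpos
    have hq0 : 0 ≤ q := Nat.cast_nonneg _
    have hqp : q ≤ p := by rw [hp, hq]; exact_mod_cast hb
    have hcardR : (A.card : ℝ) = p + q := by rw [hcard]; push_cast; rfl
    set S₀ := ∑ x, Real.exp ((∑ i, (signVec x i - m₀ x i) ^ 2) / 32) with hS₀
    have h4 : (0 : ℝ) < 4 ^ n := by positivity
    obtain ⟨m', hm', hs'⟩ : ∃ m' : (Fin n → Bool) → (Fin (n + 1) → ℝ), (∀ x, m' x ∈ vertexHull A) ∧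
        p * ∑ x, Real.exp ((∑ i, (signVec (Fin.cons (!b) x : Fin (n + 1) → Bool) i - m' x i) ^ 2) / 32)
          ≤ (2 - q / p) * 4 ^ n := by
      rcases Nat.eq_zero_or_pos (sl (!b)).card with h0 | h0
      -- With an empty opposite slice only the large one is available (`t = 1`); the factor `exp
      -- (1/8)` stays below `2 = 2 - q / p`.
      · refine ⟨fun x => Fin.cons (boolSign b) (m₀ x), fun x => cons_mem_vertexHull b A (hm₀ x), ?_⟩
        have hq' : q = 0 := by rw [hq, h0]; simp
        rw [hq', zero_div, sub_zero]
        have : ∀ x, Real.exp ((∑ i, (signVec (Fin.cons (!b) x : Fin (n + 1) → Bool) i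
            - (Fin.cons (boolSign b) (m₀ x) : Fin (n + 1) → ℝ) i) ^ 2) / 32)
            ≤ 2 * Real.exp ((∑ i, (signVec x i - m₀ x i) ^ 2) / 32) := by
          intro x
          have h := sum_sq_interpolate_le b x (m₀ x) (m₀ x) (t := 1) zero_le_one le_rfl
          simp only [one_smul, sub_self, zero_smul, add_zero, one_mul, zero_mul] at h
          refine (Real.exp_le_exp.2 h).trans ?_
          rw [Real.exp_add]
          gcongr
          have := Real.abs_exp_sub_one_sub_id_le (x := 1 / 8) (by rw [abs_le]; norm_num)
          have := (abs_le.1 this).2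
          norm_num at this ⊢
          linarith
        calc _ ≤ p * ∑ x, 2 * Real.exp ((∑ i, (signVec x i - m₀ x i) ^ 2) / 32) := by
              gcongr with x; exact this x
          _ = 2 * (p * S₀) := by rw [← Finset.mul_sum]; ring
          _ ≤ _ := by linarith
      · obtain ⟨m₁, hm₁, hs₁⟩ := ih (sl (!b)) (Finset.card_pos.1 h0)
        have hq1 : 0 < q := by rw [hq]; exact_mod_cast h0
        set l₀ := Real.log (4 ^ n / p)
        set l₁ := Real.log (4 ^ n / q)
        have e₀ : Real.exp l₀ = 4 ^ n / p := Real.exp_log (by positivity)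
        have e₁ : Real.exp l₁ = 4 ^ n / q := Real.exp_log (by positivity)
        have hL : 0 ≤ l₁ - l₀ := by
          rw [sub_nonneg]
          apply Real.log_le_log (by positivity)
          gcongr
        obtain ⟨t, ht0, ht1, ht⟩ := exists_interpolation_exponent hL
        refine ⟨fun x => t • (Fin.cons (boolSign b) (m₀ x) : Fin (n + 1) → ℝ)
          + (1 - t) • (Fin.cons (boolSign (!b)) (m₁ x) : Fin (n + 1) → ℝ), fun x =>
            convex_convexHull ℝ _ (cons_mem_vertexHull b A (hm₀ x))
              (cons_mem_vertexHull (!b) A (hm₁ x)) ht0 (by linarith) (by ring), ?_⟩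
        have hsum := sum_exp_interpolate_le (t := t)
          (D₀ := fun x => (∑ i, (signVec x i - m₀ x i) ^ 2) / 32)
          (D₁ := fun x => (∑ i, (signVec x i - m₁ x i) ^ 2) / 32) (l₀ := l₀) (l₁ := l₁) ht0 ht1
          (by rw [e₀, le_div_iff₀ hp0, mul_comm]; exact hs₀)
          (by rw [e₁, le_div_iff₀ hq1, mul_comm]; exact hs₁)
        have hr : Real.exp (-(l₁ - l₀)) = q / p := by
          rw [neg_sub, Real.exp_sub, e₀, e₁]; field_simp
        rw [hr] at ht
        calc _ ≤ p * ∑ x, Real.exp (t ^ 2 / 8 + (t * ((∑ i, (signVec x i - m₀ x i) ^ 2) / 32)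
                + (1 - t) * ((∑ i, (signVec x i - m₁ x i) ^ 2) / 32))) := by
              gcongr with x
              exact sum_sq_interpolate_le b x (m₀ x) (m₁ x) ht0 ht1
          _ = p * (Real.exp (t ^ 2 / 8) * ∑ x, Real.exp (t * ((∑ i, (signVec x i - m₀ x i) ^ 2) / 32)
                + (1 - t) * ((∑ i, (signVec x i - m₁ x i) ^ 2) / 32))) := by
              congr 1; rw [Finset.mul_sum]; simp only [Real.exp_add (t ^ 2 / 8)]
          _ ≤ p * (Real.exp (t ^ 2 / 8) * Real.exp (t * l₀ + (1 - t) * l₁)) := by gcongr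
          _ = p * (Real.exp (t ^ 2 / 8 + (1 - t) * (l₁ - l₀)) * Real.exp l₀) := by
              rw [← Real.exp_add, ← Real.exp_add]; congr 2; ring
          _ ≤ p * ((2 - q / p) * Real.exp l₀) := by gcongr
          _ = (2 - q / p) * 4 ^ n := by rw [e₀]; field_simp
    refine ⟨fun y => if y 0 = b then Fin.cons (boolSign b) (m₀ (Fin.tail y)) else m' (Fin.tail y),
      fun y => ?_, ?_⟩
    · dsimp only
      split_ifs
      · exact cons_mem_vertexHull b A (hm₀ _)
      · exact hm' _
    · rw [sum_cube_succ b]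
      have hne : ¬ ((!b) = b) := by cases b <;> simp
      simp only [Fin.cons_zero, if_true, Fin.tail_cons, hne, if_false]
      have e : ∀ x : Fin n → Bool, ∑ i, (signVec (Fin.cons b x : Fin (n + 1) → Bool) i
          - (Fin.cons (boolSign b) (m₀ x) : Fin (n + 1) → ℝ) i) ^ 2
          = ∑ i, (signVec x i - m₀ x i) ^ 2 := by
        intro x
        rw [signVec_cons, Fin.sum_univ_succ]
        simp
      simp only [e]
      set S' := ∑ x, Real.exp ((∑ i, (signVec (Fin.cons (!b) x : Fin (n + 1) → Bool) i
        - m' x i) ^ 2) / 32)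
      rw [hcardR]
      -- The two sides contribute `1` and `2 - q / p`. The induction closes because `(1 + x)(3 - x)
      -- = 4 - (1 - x) ^ 2 ≤ 4` at `x = q / p`.
      have h5 : p * (S₀ + S') ≤ (3 - q / p) * 4 ^ n := by linarith
      have h6 : (p + q) * (S₀ + S') = (1 + q / p) * (p * (S₀ + S')) := by field_simp
      rw [h6, pow_succ]
      have hr0 : 0 ≤ q / p := by positivity
      calc (1 + q / p) * (p * (S₀ + S')) ≤ (1 + q / p) * ((3 - q / p) * 4 ^ n) := by gcongr
        _ = (4 - (1 - q / p) ^ 2) * 4 ^ n := by ring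
        _ ≤ 4 * 4 ^ n := by gcongr; nlinarith [sq_nonneg (1 - q / p)]
        _ = _ := by ring

/-- If `F ≤ M` on a set of vertices, then a convex Lipschitz `F` exceeds `M` substantially at few
vertices only. -/
lemma ConvexOn.card_mul_card_lt_le {n : ℕ} {F : (Fin n → ℝ) → ℝ} (hc : ConvexOn ℝ Set.univ F) {K : ℝ}
    (hK : 0 ≤ K) (hL : ∀ x y, F x ≤ F y + K * √(∑ i, (x i - y i) ^ 2))
    (A : Finset (Fin n → Bool)) {M t : ℝ} (ht : 0 ≤ t) (hM : ∀ x ∈ A, F (signVec x) ≤ M) :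
    (A.card : ℝ) * (Finset.univ.filter fun x => M + K * √(32 * t) < F (signVec x)).card
      ≤ Real.exp (-t) * 4 ^ n := by
  rcases A.eq_empty_or_nonempty with rfl | hA
  · simp; positivity
  obtain ⟨m, hm, hs⟩ := talagrand_convex_distance A hA
  have hFm : ∀ x, F (m x) ≤ M := fun x => by
    have hcv := hc.convex_le M
    have : vertexHull A ⊆ {x | x ∈ Set.univ ∧ F x ≤ M} := by
      refine convexHull_min ?_ hcv
      rintro _ ⟨y, hy, rfl⟩
      exact ⟨Set.mem_univ _, hM y hy⟩
    exact (this (hm x)).2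
  have h1 : ((Finset.univ.filter fun x => M + K * √(32 * t) < F (signVec x)).card : ℝ) * Real.exp t
      ≤ ∑ x, Real.exp ((∑ i, (signVec x i - m x i) ^ 2) / 32) := by
    rw [← nsmul_eq_mul]
    refine (Finset.card_nsmul_le_sum _ _ _ fun x hx => ?_).trans
      (Finset.sum_le_sum_of_subset_of_nonneg (Finset.filter_subset _ _)
        fun x _ _ => (Real.exp_pos _).le)
    have hx' := (Finset.mem_filter.1 hx).2
    have h2 := hL (signVec x) (m x)
    -- Convexity extends `F ≤ M` from `A` to its hull, so exceeding `M` this much forces distance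
    -- greater than `√(32 t)`; Markov's inequality for the exponential moment finishes.
    have h3 : K * √(32 * t) < K * √(∑ i, (signVec x i - m x i) ^ 2) := by linarith [hFm x]
    have h4 := lt_of_mul_lt_mul_left h3 hK
    have h5 := (Real.sqrt_lt_sqrt_iff (by positivity)).1 h4
    apply Real.exp_le_exp.2
    linarith
  rw [Real.exp_neg, ← div_eq_inv_mul, le_div_iff₀ (Real.exp_pos _), mul_assoc]
  exact (mul_le_mul_of_nonneg_left h1 (Nat.cast_nonneg _)).trans hs

/-- The average over the vertices of a convex Lipschitz function is controlled by any quantile. -/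
lemma ConvexOn.sum_signVec_le {n : ℕ} {F : (Fin n → ℝ) → ℝ} (hc : ConvexOn ℝ Set.univ F) {K : ℝ}
    (hK : 0 ≤ K) (hL : ∀ x y, F x ≤ F y + K * √(∑ i, (x i - y i) ^ 2))
    (A : Finset (Fin n → Bool)) {M : ℝ} (hA : (2 : ℝ) ^ n ≤ 2 * A.card)
    (hM : ∀ x ∈ A, F (signVec x) ≤ M) :
    ∑ x, F (signVec x) ≤ (M + 6 * K) * 2 ^ n := by
  have hcard : (0 : ℝ) < A.card := by
    have : (0 : ℝ) < 2 ^ n := by positivity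
    linarith
  obtain ⟨m, hm, hs⟩ := talagrand_convex_distance A (Finset.card_pos.1 (by exact_mod_cast hcard))
  have hFm : ∀ x, F (m x) ≤ M := fun x => by
    have hcv := hc.convex_le M
    have : vertexHull A ⊆ {x | x ∈ Set.univ ∧ F x ≤ M} := by
      refine convexHull_min ?_ hcv
      rintro _ ⟨y, hy, rfl⟩
      exact ⟨Set.mem_univ _, hM y hy⟩
    exact (this (hm x)).2
  have h1 : ∀ x, F (signVec x) ≤ M
      + K * (3 * Real.exp ((∑ i, (signVec x i - m x i) ^ 2) / 32)) := by
    intro x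
    have hD : 0 ≤ ∑ i, (signVec x i - m x i) ^ 2 := Finset.sum_nonneg fun i _ => sq_nonneg _
    -- A linear distance is dominated by the exponential moment. The minimum over `y` of `3 (1 + y ^
    -- 2 / 32) - y` is attained at `y = 16/3` and is positive.
    have h2 : √(∑ i, (signVec x i - m x i) ^ 2)
        ≤ 3 * Real.exp ((∑ i, (signVec x i - m x i) ^ 2) / 32) := by
      have := Real.add_one_le_exp ((∑ i, (signVec x i - m x i) ^ 2) / 32)
      have h3 := Real.sq_sqrt hD
      nlinarith [sq_nonneg (√(∑ i, (signVec x i - m x i) ^ 2) - 16 / 3)]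
    linarith [hL (signVec x) (m x), hFm x, mul_le_mul_of_nonneg_left h2 hK]
  have h2 : ∑ x, Real.exp ((∑ i, (signVec x i - m x i) ^ 2) / 32) ≤ 2 * 2 ^ n := by
    have h3 : (4 : ℝ) ^ n = 2 ^ n * 2 ^ n := by rw [← mul_pow]; norm_num
    rw [h3] at hs
    have h4 : (A.card : ℝ) * ∑ x, Real.exp ((∑ i, (signVec x i - m x i) ^ 2) / 32)
        ≤ A.card * (2 * 2 ^ n) := by
      nlinarith [show (0 : ℝ) < 2 ^ n by positivity]
    exact le_of_mul_le_mul_left h4 hcard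
  calc ∑ x, F (signVec x)
      ≤ ∑ x : Fin n → Bool, (M + K * (3 * Real.exp ((∑ i, (signVec x i - m x i) ^ 2) / 32))) :=
        Finset.sum_le_sum fun x _ => h1 x
    _ = M * 2 ^ n + K * (3 * ∑ x, Real.exp ((∑ i, (signVec x i - m x i) ^ 2) / 32)) := by
        rw [Finset.sum_add_distrib, ← Finset.mul_sum, ← Finset.mul_sum]
        simp [mul_comm]
    _ ≤ M * 2 ^ n + K * (3 * (2 * 2 ^ n)) := by gcongr
    _ = _ := by ring

/-- Upper deviations of a nonnegative convex Lipschitz function on the hypercube. -/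
theorem ConvexOn.card_upper_deviation_le {n : ℕ} {F : (Fin n → ℝ) → ℝ}
    (hc : ConvexOn ℝ Set.univ F) {K : ℝ} (hK : 0 ≤ K)
    (hL : ∀ x y, F x ≤ F y + K * √(∑ i, (x i - y i) ^ 2)) (h0 : ∀ x, 0 ≤ F x) {t : ℝ} (ht : 0 ≤ t) :
    ((Finset.univ.filter fun x : Fin n → Bool =>
        2 * ((∑ y, F (signVec y)) / 2 ^ n) + K * √(32 * t) < F (signVec x)).card : ℝ)
      ≤ 2 * Real.exp (-t) * 2 ^ n := by
  set M := (∑ y : Fin n → Bool, F (signVec y)) / 2 ^ n with hM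
  have h2 : (0 : ℝ) < 2 ^ n := by positivity
  -- By Markov's inequality at least half of the vertices lie below twice the mean, so this level
  -- plays the role of a median.
  set A := Finset.univ.filter fun x : Fin n → Bool => F (signVec x) ≤ 2 * M with hA
  have hM0 : 0 ≤ M := div_nonneg (Finset.sum_nonneg fun x _ => h0 _) h2.le
  have hcA : (2 : ℝ) ^ n ≤ 2 * A.card := by
    have hcompl : (A.card : ℝ) + (Finset.univ.filter fun x : Fin n → Bool =>
        ¬ F (signVec x) ≤ 2 * M).card = 2 ^ n := by
      have := Finset.card_filter_add_card_filter_not (s := (Finset.univ : Finset (Fin n → Bool)))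
        (fun x => F (signVec x) ≤ 2 * M)
      rw [Finset.card_univ] at this
      simp only [Fintype.card_pi, Fintype.card_bool, Finset.prod_const, Finset.card_univ,
        Fintype.card_fin] at this
      exact_mod_cast this
    set B := Finset.univ.filter fun x : Fin n → Bool => ¬ F (signVec x) ≤ 2 * M with hB
    have h3 : (B.card : ℝ) * (2 * M) ≤ M * 2 ^ n := by
      rw [← nsmul_eq_mul]
      refine (Finset.card_nsmul_le_sum B (fun x => F (signVec x)) _ fun x hx => ?_).trans ?_
      · exact (not_le.1 (Finset.mem_filter.1 hx).2).le
      · rw [hM, div_mul_cancel₀ _ h2.ne']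
        exact Finset.sum_le_sum_of_subset_of_nonneg (Finset.filter_subset _ _) fun x _ _ => h0 _
    rcases hM0.eq_or_lt with h | h
    · have hz : ∑ y : Fin n → Bool, F (signVec y) = 0 := by
        have := h.symm
        rw [hM, div_eq_zero_iff] at this
        exact this.resolve_right h2.ne'
      have hB0 : B = ∅ := by
        rw [hB, Finset.filter_eq_empty_iff]
        intro x _
        rw [not_not, (Finset.sum_eq_zero_iff_of_nonneg fun x _ => h0 _).1 hz x (Finset.mem_univ x),
          ← h, mul_zero]
      rw [hB0] at hcompl
      simp at hcompl
      linarith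
    · have : (B.card : ℝ) * 2 ≤ 2 ^ n := by
        refine le_of_mul_le_mul_right ?_ h
        linarith
      linarith
  have h3 := hc.card_mul_card_lt_le hK hL A ht (M := 2 * M) fun x hx => (Finset.mem_filter.1 hx).2
  set D := ((Finset.univ.filter fun x : Fin n → Bool =>
    2 * M + K * √(32 * t) < F (signVec x)).card : ℝ)
  have h4 : (4 : ℝ) ^ n = 2 ^ n * 2 ^ n := by rw [← mul_pow]; norm_num
  have h5 : 2 ^ n * D ≤ 2 * (A.card * D) := by
    have : 0 ≤ D := Nat.cast_nonneg _
    nlinarith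
  refine le_of_mul_le_mul_left ?_ h2
  rw [h4] at h3
  linarith

/-- Lower deviations of a convex Lipschitz function on the hypercube. -/
theorem ConvexOn.card_lower_deviation_le {n : ℕ} {F : (Fin n → ℝ) → ℝ}
    (hc : ConvexOn ℝ Set.univ F) {K : ℝ} (hK : 0 ≤ K)
    (hL : ∀ x y, F x ≤ F y + K * √(∑ i, (x i - y i) ^ 2)) {t : ℝ} (ht : 0 ≤ t) :
    ((Finset.univ.filter fun x : Fin n → Bool =>
        F (signVec x) + K * √(32 * t) + 6 * K < (∑ y, F (signVec y)) / 2 ^ n).card : ℝ)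
      ≤ 2 * Real.exp (-t) * 2 ^ n := by
  have h2 : (0 : ℝ) < 2 ^ n := by positivity
  set m := (∑ y : Fin n → Bool, F (signVec y)) / 2 ^ n with hm
  set A := Finset.univ.filter fun x : Fin n → Bool =>
    F (signVec x) + K * √(32 * t) + 6 * K < m with hA
  rcases A.eq_empty_or_nonempty with h | hAne
  · rw [h]; simp; positivity
  -- the maximum of `F` over `A` and a slightly larger level
  obtain ⟨a, haA, ha⟩ := A.exists_max_image (fun x => F (signVec x)) hAne
  have ham : F (signVec a) + K * √(32 * t) + 6 * K < m := (Finset.mem_filter.1 haA).2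
  have h3 := hc.card_mul_card_lt_le hK hL A ht (M := F (signVec a)) ha
  set B := Finset.univ.filter fun x : Fin n → Bool => F (signVec a) + K * √(32 * t) < F (signVec x)
    with hB
  -- If `B` had less than half of the vertices, its complement would contain at least half and `F`
  -- would be at most `F (signVec a) + K √(32 t)` there. Then `ConvexOn.sum_signVec_le` would put
  -- the mean below `m`.
  have hcB : (2 : ℝ) ^ n ≤ 2 * B.card := by
    by_contra! hlt
    set B' := Finset.univ.filter fun x : Fin n → Bool =>
      ¬ (F (signVec a) + K * √(32 * t) < F (signVec x)) with hB'
    have hcompl : (B.card : ℝ) + B'.card = 2 ^ n := by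
      have := Finset.card_filter_add_card_filter_not (s := (Finset.univ : Finset (Fin n → Bool)))
        (fun x => F (signVec a) + K * √(32 * t) < F (signVec x))
      rw [Finset.card_univ] at this
      simp only [Fintype.card_pi, Fintype.card_bool, Finset.prod_const, Finset.card_univ,
        Fintype.card_fin] at this
      exact_mod_cast this
    have h4 := hc.sum_signVec_le hK hL B' (M := F (signVec a) + K * √(32 * t)) (by linarith)
      fun x hx => not_lt.1 (Finset.mem_filter.1 hx).2
    rw [← div_le_iff₀ h2, ← hm] at h4
    linarith
  have h4 : (4 : ℝ) ^ n = 2 ^ n * 2 ^ n := by rw [← mul_pow]; norm_num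
  have h5 : (A.card : ℝ) * 2 ^ n ≤ 2 * (A.card * B.card) := by
    have : (0 : ℝ) ≤ A.card := Nat.cast_nonneg _
    nlinarith
  refine le_of_mul_le_mul_left ?_ h2
  rw [h4] at h3
  linarith

end

noncomputable section

/-! ### Suprema of affine functions -/

section SupAffine

variable {ι : Type*} {n : ℕ} {J : Set ι} {a : ι → ℝ} {b : ι → Fin n → ℝ}

lemma convexOn_sSup_affine (hJ : J.Nonempty)
    (hb : ∀ x : Fin n → ℝ, BddAbove ((fun j => a j + ∑ i, x i * b j i) '' J)) :
    ConvexOn ℝ Set.univ (fun x : Fin n → ℝ => sSup ((fun j => a j + ∑ i, x i * b j i) '' J)) := by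
  refine ⟨convex_univ, fun x _ y _ s t hs ht hst => ?_⟩
  refine csSup_le (hJ.image _) ?_
  rintro _ ⟨j, hj, rfl⟩
  have h1 := le_csSup (hb x) ⟨j, hj, rfl⟩
  have h2 := le_csSup (hb y) ⟨j, hj, rfl⟩
  simp only [smul_eq_mul, Pi.add_apply, Pi.smul_apply] at *
  have e : a j + ∑ i, (s * x i + t * y i) * b j i
      = s * (a j + ∑ i, x i * b j i) + t * (a j + ∑ i, y i * b j i) := by
    rw [mul_add, mul_add, Finset.mul_sum, Finset.mul_sum]
    have : a j = s * a j + t * a j := by rw [← add_mul, hst, one_mul]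
    rw [add_add_add_comm, ← this, ← Finset.sum_add_distrib]
    congr 1
    exact Finset.sum_congr rfl fun i _ => by ring
  rw [e]
  gcongr

lemma sSup_affine_le_add (hJ : J.Nonempty)
    (hb : ∀ x : Fin n → ℝ, BddAbove ((fun j => a j + ∑ i, x i * b j i) '' J)) {K : ℝ} (hK : 0 ≤ K)
    (hbK : ∀ j ∈ J, ∑ i, b j i ^ 2 ≤ K ^ 2) (x y : Fin n → ℝ) :
    sSup ((fun j => a j + ∑ i, x i * b j i) '' J)
      ≤ sSup ((fun j => a j + ∑ i, y i * b j i) '' J) + K * √(∑ i, (x i - y i) ^ 2) := by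
  refine csSup_le (hJ.image _) ?_
  rintro _ ⟨j, hj, rfl⟩
  have h2 := le_csSup (hb y) ⟨j, hj, rfl⟩
  have h3 : ∑ i, (x i - y i) * b j i ≤ √(∑ i, (x i - y i) ^ 2) * √(∑ i, b j i ^ 2) :=
    Real.sum_mul_le_sqrt_mul_sqrt _ _ _
  have h4 : √(∑ i, b j i ^ 2) ≤ K := Real.sqrt_le_iff.2 ⟨hK, hbK j hj⟩
  have h5 := mul_le_mul_of_nonneg_left h4 (Real.sqrt_nonneg (∑ i, (x i - y i) ^ 2))
  have h6 : ∑ i, (x i - y i) * b j i = ∑ i, x i * b j i - ∑ i, y i * b j i := by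
    rw [← Finset.sum_sub_distrib]
    exact Finset.sum_congr rfl fun i _ => by ring
  simp only at h2 ⊢
  linarith

end SupAffine

/-! ### Rademacher averages of subsets of `ℝᵀ` -/

/-- The supremum over `K` of `u ↦ ∑ᵢ εᵢ uᵢ`. -/
def signSup {T : ℕ} (K : Set (Fin T → ℝ)) (s : Fin T → Bool) : ℝ :=
  sSup ((fun u : Fin T → ℝ => ∑ i, boolSign (s i) * u i) '' K)

/-- The Rademacher average `E_ε sup_{u ∈ K} ∑ᵢ εᵢ uᵢ`. -/
def radAvg {T : ℕ} (K : Set (Fin T → ℝ)) : ℝ := (∑ s, signSup K s) / 2 ^ T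

@[simp] lemma boolSign_true : boolSign true = 1 := rfl

@[simp] lemma boolSign_false : boolSign false = -1 := rfl

lemma abs_sum_sign_mul_le {T : ℕ} (s : Fin T → Bool) {u : Fin T → ℝ} {c : ℝ} (h : ∀ i, |u i| ≤ c) :
    |∑ i, boolSign (s i) * u i| ≤ T * c := by
  refine (Finset.abs_sum_le_sum_abs _ _).trans ?_
  refine (Finset.sum_le_card_nsmul _ _ c fun i _ => ?_).trans (by simp)
  rw [abs_mul, abs_boolSign, one_mul]
  exact h i

lemma bddAbove_signSup {T : ℕ} {K : Set (Fin T → ℝ)} {c : ℝ} (hK : ∀ u ∈ K, ∀ i, |u i| ≤ c)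
    (s : Fin T → Bool) : BddAbove ((fun u : Fin T → ℝ => ∑ i, boolSign (s i) * u i) '' K) := by
  refine ⟨T * c, ?_⟩
  rintro _ ⟨u, hu, rfl⟩
  exact (le_abs_self _).trans (abs_sum_sign_mul_le s (hK u hu))

lemma le_signSup {T : ℕ} {K : Set (Fin T → ℝ)} {c : ℝ} (hK : ∀ u ∈ K, ∀ i, |u i| ≤ c)
    (s : Fin T → Bool) {u : Fin T → ℝ} (hu : u ∈ K) : ∑ i, boolSign (s i) * u i ≤ signSup K s :=
  le_csSup (bddAbove_signSup hK s) ⟨u, hu, rfl⟩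

lemma signSup_nonneg {T : ℕ} {K : Set (Fin T → ℝ)} {c : ℝ} (hK : ∀ u ∈ K, ∀ i, |u i| ≤ c)
    (h0 : 0 ∈ K) (s : Fin T → Bool) : 0 ≤ signSup K s := by
  simpa using le_signSup hK s h0

lemma sum_boolVec_comp_not {T : ℕ} (F : (Fin T → Bool) → ℝ) :
    ∑ s : Fin T → Bool, F (fun i => !(s i)) = ∑ s, F s :=
  Function.Bijective.sum_comp (e := fun (s : Fin T → Bool) i => !(s i))
    (Function.Involutive.bijective fun s => by simp) F

lemma boolSign_beq (a b : Bool) : boolSign (a == b) = boolSign a * boolSign b := by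
  cases a <;> cases b <;> simp [boolSign]

lemma sum_boolVec_comp_beq {T : ℕ} (s : Fin T → Bool) (F : (Fin T → Bool) → ℝ) :
    ∑ x : Fin T → Bool, F (fun i => s i == x i) = ∑ x, F x :=
  Function.Bijective.sum_comp (e := fun (x : Fin T → Bool) i => s i == x i)
    (Function.Involutive.bijective fun x => by
      funext i
      change (s i == (s i == x i)) = x i
      cases s i <;> cases x i <;> rfl) F

/-- The one-coordinate case of contraction. For near-maximizers `u`, `v` on the left only `φ u - φ
v` matters, and it is at most `±(ψ u - ψ v)`; if the sign is negative, `u` and `v` exchange roles on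
the right. -/
lemma add_sSup_le_of_contraction {ι : Type*} {K : Set ι} (hK : K.Nonempty) {g φ ψ : ι → ℝ}
    (h1 : BddAbove ((fun u => g u + ψ u) '' K)) (h2 : BddAbove ((fun u => g u - ψ u) '' K))
    (hc : ∀ u ∈ K, ∀ v ∈ K, |φ u - φ v| ≤ |ψ u - ψ v|) :
    sSup ((fun u => g u + φ u) '' K) + sSup ((fun u => g u - φ u) '' K)
      ≤ sSup ((fun u => g u + ψ u) '' K) + sSup ((fun u => g u - ψ u) '' K) := by
  set Y := sSup ((fun u => g u + ψ u) '' K) + sSup ((fun u => g u - ψ u) '' K) with hY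
  rw [← le_sub_iff_add_le]
  refine csSup_le (hK.image _) ?_
  rintro _ ⟨u, hu, rfl⟩
  rw [le_sub_comm]
  refine csSup_le (hK.image _) ?_
  rintro _ ⟨v, hv, rfl⟩
  have a1 := le_csSup h1 ⟨u, hu, rfl⟩
  have a2 := le_csSup h2 ⟨v, hv, rfl⟩
  have a3 := le_csSup h1 ⟨v, hv, rfl⟩
  have a4 := le_csSup h2 ⟨u, hu, rfl⟩
  simp only at a1 a2 a3 a4 ⊢
  have a5 := (le_abs_self _).trans (hc u hu v hv)
  rcases abs_cases (ψ u - ψ v) with ⟨h, _⟩ | ⟨h, _⟩ <;> rw [h] at a5 <;> linarith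

/-- The contraction principle for Rademacher averages. -/
theorem radAvg_comp_le {T : ℕ} {K : Set (Fin T → ℝ)} (hne : K.Nonempty) {c l : ℝ} (hl : 0 ≤ l)
    (hK : ∀ u ∈ K, ∀ i, |u i| ≤ c) {φ : ℝ → ℝ}
    (hφ : ∀ x y, |x| ≤ c → |y| ≤ c → |φ x - φ y| ≤ l * |x - y|) :
    radAvg ((fun u i => φ (u i)) '' K) ≤ l * radAvg K := by
  classical
  -- The coordinates in `I` already carry the linear map `l * u` instead of `φ u`; they are
  -- exchanged one at a time.
  set mix : Finset (Fin T) → (Fin T → ℝ) → Fin T → ℝ := fun I u i =>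
    if i ∈ I then l * u i else φ (u i) with hmix
  have hbd : ∀ I, ∃ C, ∀ u ∈ K, ∀ i, |mix I u i| ≤ C := by
    intro I
    obtain ⟨u₀, hu₀⟩ := hne
    refine ⟨∑ i, |φ (u₀ i)| + l * (2 * c), fun u hu i => ?_⟩
    have hc0 : 0 ≤ c := (abs_nonneg _).trans (hK u hu i)
    have hs : 0 ≤ ∑ i, |φ (u₀ i)| := Finset.sum_nonneg fun i _ => abs_nonneg _
    simp only [hmix]
    split_ifs
    · rw [abs_mul, abs_of_nonneg hl]
      nlinarith [hK u hu i, mul_le_mul_of_nonneg_left (hK u hu i) hl, mul_nonneg hl hc0]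
    · have h1 := hφ (u i) (u₀ i) (hK u hu i) (hK u₀ hu₀ i)
      have h2 : |u i - u₀ i| ≤ 2 * c := (abs_sub _ _).trans (by linarith [hK u hu i, hK u₀ hu₀ i])
      have h3 : |φ (u₀ i)| ≤ ∑ i, |φ (u₀ i)| :=
        Finset.single_le_sum (f := fun i => |φ (u₀ i)|) (fun i _ => abs_nonneg _) (Finset.mem_univ i)
      have h4 : |φ (u i)| ≤ |φ (u i) - φ (u₀ i)| + |φ (u₀ i)| := by
        simpa using abs_add_le (φ (u i) - φ (u₀ i)) (φ (u₀ i))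
      linarith [mul_le_mul_of_nonneg_left h2 hl]
  have hbdI : ∀ (I : Finset (Fin T)) (s : Fin T → Bool), BddAbove ((fun u : Fin T → ℝ => ∑ i, boolSign (s i) * mix I u i) '' K) := by
    intro I s
    obtain ⟨C, hC⟩ := hbd I
    refine ⟨T * C, ?_⟩
    rintro _ ⟨u, hu, rfl⟩
    exact (le_abs_self _).trans (abs_sum_sign_mul_le s (hC u hu))
  set X : Finset (Fin T) → (Fin T → Bool) → ℝ := fun I s =>
    sSup ((fun u : Fin T → ℝ => ∑ i, boolSign (s i) * mix I u i) '' K) with hX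
  have step : ∀ I : Finset (Fin T), ∑ s, X ∅ s ≤ ∑ s, X I s := by
    intro I
    induction I using Finset.induction_on with
    | empty => exact le_rfl
    | insert j I hj ih =>
      refine ih.trans ?_
      -- Sign vectors are paired by flipping the `j`-th sign, so each pair is an instance of the
      -- one-coordinate comparison.
      set fl : (Fin T → Bool) → (Fin T → Bool) := fun s => Function.update s j (!(s j)) with hfl
      have hinv : Function.Involutive fl := fun s => by simp [hfl]
      have hsum : ∀ F : (Fin T → Bool) → ℝ, 2 * ∑ s, F s = ∑ s, (F s + F (fl s)) := by
        intro F
        rw [Finset.sum_add_distrib, hinv.bijective.sum_comp F, two_mul]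
      have key : ∑ s, (X I s + X I (fl s)) ≤ ∑ s, (X (insert j I) s + X (insert j I) (fl s)) := by
        refine Finset.sum_le_sum fun s _ => ?_
        set g : (Fin T → ℝ) → ℝ := fun u =>
          ∑ i ∈ Finset.univ.erase j, boolSign (s i) * mix I u i with hg
        have e1 : ∀ u, ∑ i, boolSign (s i) * mix I u i = g u + boolSign (s j) * φ (u j) := by
          intro u
          rw [← Finset.sum_erase_add _ _ (Finset.mem_univ j)]
          simp [hg, hmix, hj]
        have e2 : ∀ u, ∑ i, boolSign (fl s i) * mix I u i = g u - boolSign (s j) * φ (u j) := by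
          intro u
          rw [← Finset.sum_erase_add _ _ (Finset.mem_univ j), sub_eq_add_neg]
          congr 1
          · refine Finset.sum_congr rfl fun i hi => ?_
            simp [hfl, Finset.ne_of_mem_erase hi]
          · simp [hfl, hmix, hj, boolSign_not]
        have hoff : ∀ u, ∀ i ∈ Finset.univ.erase j, mix (insert j I) u i = mix I u i := by
          intro u i hi
          simp [hmix, Finset.ne_of_mem_erase hi]
        have e3 : ∀ u, ∑ i, boolSign (s i) * mix (insert j I) u i
            = g u + boolSign (s j) * (l * u j) := by
          intro u
          rw [← Finset.sum_erase_add _ _ (Finset.mem_univ j)]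
          congr 1
          · exact Finset.sum_congr rfl fun i hi => by rw [hoff u i hi]
          · simp [hmix]
        have e4 : ∀ u, ∑ i, boolSign (fl s i) * mix (insert j I) u i
            = g u - boolSign (s j) * (l * u j) := by
          intro u
          rw [← Finset.sum_erase_add _ _ (Finset.mem_univ j), sub_eq_add_neg]
          congr 1
          · refine Finset.sum_congr rfl fun i hi => ?_
            rw [hoff u i hi]
            simp [hfl, Finset.ne_of_mem_erase hi]
          · simp [hfl, hmix, boolSign_not]
        have b3 := hbdI (insert j I) s
        have b4 := hbdI (insert j I) (fl s)
        simp only [e3, e4] at b3 b4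
        simp only [hX, e1, e2, e3, e4]
        refine add_sSup_le_of_contraction hne b3 b4 fun u hu v hv => ?_
        rw [← mul_sub, ← mul_sub, ← mul_sub, abs_mul, abs_mul, abs_mul, abs_of_nonneg hl]
        gcongr
        exact hφ _ _ (hK u hu j) (hK v hv j)
      rw [← hsum, ← hsum] at key
      linarith
  have h0 : ∀ s, signSup ((fun u i => φ (u i)) '' K) s = X ∅ s := by
    intro s
    simp only [signSup, hX, hmix, Set.image_image, Finset.notMem_empty, if_false]
  have h1 : ∀ s, X Finset.univ s = l * signSup K s := by
    intro s
    simp only [signSup, hX, hmix, Finset.mem_univ, if_true]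
    rw [← smul_eq_mul, ← Real.sSup_smul_of_nonneg hl]
    congr 1
    rw [← Set.image_smul, Set.image_image]
    refine Set.image_congr fun u _ => ?_
    rw [smul_eq_mul, Finset.mul_sum]
    exact Finset.sum_congr rfl fun i _ => by ring
  have := step Finset.univ
  simp only [h1, ← Finset.mul_sum] at this
  simp only [radAvg, h0]
  rw [← mul_div_assoc]
  gcongr

/-! ### Random swaps between two samples -/

/-- The mixed vector that takes the coordinates of `p.1` where `ε` is `true` and of `p.2`
elsewhere. -/
def swapSel {T : ℕ} {E : Type*} (ε : Fin T → Bool) (p : (Fin T → E) × (Fin T → E)) : Fin T → E :=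
  fun i => if ε i then p.1 i else p.2 i

lemma boolSign_mul_sub_eq {T : ℕ} (ε : Fin T → Bool) (φ : ℝ → ℝ) (p : (Fin T → ℝ) × (Fin T → ℝ))
    (i : Fin T) : boolSign (ε i) * (φ (p.1 i) - φ (p.2 i))
      = φ (swapSel ε p i) - φ (swapSel (fun i => !(ε i)) p i) := by
  cases h : ε i <;> simp [swapSel, boolSign, h]

section Pool

variable {T : ℕ} {K : Set ((Fin T → ℝ) × (Fin T → ℝ))} {c l Q : ℝ} {φ : ℝ → ℝ}

lemma abs_swapSel_le (hK : ∀ p ∈ K, ∀ i, |p.1 i| ≤ c ∧ |p.2 i| ≤ c) (ε : Fin T → Bool) :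
    ∀ u ∈ swapSel ε '' K, ∀ i, |u i| ≤ c := by
  rintro _ ⟨p, hp, rfl⟩ i
  unfold swapSel
  split_ifs
  exacts [(hK p hp i).1, (hK p hp i).2]

/-- The swap process `sup |∑ᵢ xᵢ (φ (uᵢ) - φ (vᵢ))|`. -/
def swapProcess (K : Set ((Fin T → ℝ) × (Fin T → ℝ))) (φ : ℝ → ℝ) (x : Fin T → ℝ) : ℝ :=
  sSup ((fun j : ((Fin T → ℝ) × (Fin T → ℝ)) × Bool =>
    0 + ∑ i, x i * (boolSign j.2 * (φ (j.1.1 i) - φ (j.1.2 i)))) '' (K ×ˢ Set.univ))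

lemma abs_sub_le_of_bounded (hl : 0 ≤ l) (hφ : ∀ x y, |x| ≤ c → |y| ≤ c → |φ x - φ y| ≤ l * |x - y|)
    (hK : ∀ p ∈ K, ∀ i, |p.1 i| ≤ c ∧ |p.2 i| ≤ c) {p : (Fin T → ℝ) × (Fin T → ℝ)} (hp : p ∈ K)
    (i : Fin T) : |φ (p.1 i) - φ (p.2 i)| ≤ l * (2 * c) := by
  refine (hφ _ _ (hK p hp i).1 (hK p hp i).2).trans ?_
  gcongr
  exact (abs_sub _ _).trans (by linarith [(hK p hp i).1, (hK p hp i).2])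

lemma bddAbove_swapProcess (hl : 0 ≤ l)
    (hφ : ∀ x y, |x| ≤ c → |y| ≤ c → |φ x - φ y| ≤ l * |x - y|)
    (hK : ∀ p ∈ K, ∀ i, |p.1 i| ≤ c ∧ |p.2 i| ≤ c) (x : Fin T → ℝ) :
    BddAbove ((fun j : ((Fin T → ℝ) × (Fin T → ℝ)) × Bool =>
      0 + ∑ i, x i * (boolSign j.2 * (φ (j.1.1 i) - φ (j.1.2 i)))) '' (K ×ˢ Set.univ)) := by
  refine ⟨∑ i, |x i| * (l * (2 * c)), ?_⟩
  rintro _ ⟨⟨p, b⟩, ⟨hp, _⟩, rfl⟩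
  simp only [zero_add]
  refine Finset.sum_le_sum fun i _ => (le_abs_self _).trans ?_
  rw [abs_mul, abs_mul, abs_boolSign, one_mul]
  gcongr
  exact abs_sub_le_of_bounded hl hφ hK hp i

lemma abs_sum_le_swapProcess (hl : 0 ≤ l)
    (hφ : ∀ x y, |x| ≤ c → |y| ≤ c → |φ x - φ y| ≤ l * |x - y|)
    (hK : ∀ p ∈ K, ∀ i, |p.1 i| ≤ c ∧ |p.2 i| ≤ c) (x : Fin T → ℝ)
    {p : (Fin T → ℝ) × (Fin T → ℝ)} (hp : p ∈ K) :
    |∑ i, x i * (φ (p.1 i) - φ (p.2 i))| ≤ swapProcess K φ x := by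
  have h1 := le_csSup (bddAbove_swapProcess hl hφ hK x) ⟨(p, true), ⟨hp, trivial⟩, rfl⟩
  have h2 := le_csSup (bddAbove_swapProcess hl hφ hK x) ⟨(p, false), ⟨hp, trivial⟩, rfl⟩
  simp only [boolSign_true, boolSign_false, zero_add, one_mul, neg_mul, mul_neg,
    Finset.sum_neg_distrib] at h1 h2
  simp only [swapProcess, zero_add]
  exact abs_le.2 ⟨neg_le.1 h2, h1⟩

/-- Symmetrization against the mixed sample. The swap signs may be multiplied by independent signs
`s` without changing their law. The signed increment is then a difference of Rademacher sums over
the mixed sample and its complement, and contraction removes `φ`. -/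
lemma sum_swapProcess_le (hl : 0 ≤ l) (h0 : 0 ∈ K) (hφ0 : φ 0 = 0)
    (hφ : ∀ x y, |x| ≤ c → |y| ≤ c → |φ x - φ y| ≤ l * |x - y|)
    (hK : ∀ p ∈ K, ∀ i, |p.1 i| ≤ c ∧ |p.2 i| ≤ c) :
    ∑ ε : Fin T → Bool, swapProcess K φ (signVec ε)
      ≤ 4 * l * ∑ ε : Fin T → Bool, radAvg (swapSel ε '' K) := by
  have h2 : (0 : ℝ) < 2 ^ T := by positivity
  set φK : (Fin T → Bool) → Set (Fin T → ℝ) := fun ε => (fun u i => φ (u i)) '' (swapSel ε '' K)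
    with hφK
  have hbd : ∀ ε, ∃ C, ∀ u ∈ φK ε, ∀ i, |u i| ≤ C := by
    intro ε
    refine ⟨l * c, ?_⟩
    rintro _ ⟨u, hu, rfl⟩ i
    have h := abs_swapSel_le hK ε u hu i
    have hc : 0 ≤ c := (abs_nonneg _).trans h
    have := hφ (u i) 0 h (by simpa using hc)
    rw [hφ0, sub_zero, sub_zero] at this
    exact this.trans (by gcongr)
  have h0mem : ∀ ε, (0 : Fin T → ℝ) ∈ φK ε := by
    intro ε
    refine ⟨0, ⟨0, h0, ?_⟩, ?_⟩
    · funext i; simp [swapSel]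
    · funext i; simp [hφ0]
  set A : (Fin T → Bool) → (Fin T → Bool) → ℝ := fun s ε => signSup (φK ε) s with hA
  have hA0 : ∀ s ε, 0 ≤ A s ε := fun s ε => by
    obtain ⟨C, hC⟩ := hbd ε
    exact signSup_nonneg hC (h0mem ε) s
  have hAle : ∀ s ε, ∀ p ∈ K, ∑ i, boolSign (s i) * φ (swapSel ε p i) ≤ A s ε := fun s ε p hp => by
    obtain ⟨C, hC⟩ := hbd ε
    exact le_signSup hC s ⟨_, ⟨p, hp, rfl⟩, rfl⟩
  -- Here `==` is multiplication of signs. The four summands cover the two mixed samples and the two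
  -- orientations of the absolute value. They are nonnegative because `0 ∈ K`, so unneeded ones can
  -- be kept, and each has the same sum over all signs.
  have hptw : ∀ s ε : Fin T → Bool, swapProcess K φ (signVec fun i => s i == ε i)
      ≤ A s ε + A (fun i => !(s i)) ε + A s (fun i => !(ε i))
        + A (fun i => !(s i)) (fun i => !(ε i)) := by
    intro s ε
    refine csSup_le (Set.Nonempty.image _ ⟨(0, true), h0, trivial⟩) ?_
    rintro _ ⟨⟨p, b⟩, ⟨hp, _⟩, rfl⟩
    have e : ∑ i, signVec (fun i => s i == ε i) i * (boolSign b * (φ (p.1 i) - φ (p.2 i)))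
        = boolSign b * (∑ i, boolSign (s i) * φ (swapSel ε p i)
          - ∑ i, boolSign (s i) * φ (swapSel (fun i => !(ε i)) p i)) := by
      rw [← Finset.sum_sub_distrib, Finset.mul_sum]
      refine Finset.sum_congr rfl fun i _ => ?_
      rw [← mul_sub, ← boolSign_mul_sub_eq ε φ p i]
      simp only [signVec, boolSign_beq]
      ring
    simp only [zero_add]
    rw [e]
    have a1 := hAle s ε p hp
    have a2 := hAle s (fun i => !(ε i)) p hp
    have a3 := hAle (fun i => !(s i)) ε p hp
    have a4 := hAle (fun i => !(s i)) (fun i => !(ε i)) p hp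
    simp only [boolSign_not, neg_mul, Finset.sum_neg_distrib] at a3 a4
    have b1 := hA0 s ε
    have b2 := hA0 s (fun i => !(ε i))
    have b3 := hA0 (fun i => !(s i)) ε
    have b4 := hA0 (fun i => !(s i)) (fun i => !(ε i))
    cases b <;> simp only [boolSign_true, boolSign_false] <;> linarith
  have hsum : 2 ^ T * ∑ ε : Fin T → Bool, swapProcess K φ (signVec ε)
      ≤ 4 * ∑ ε : Fin T → Bool, ∑ s, A s ε := by
    have e1 : 2 ^ T * ∑ ε : Fin T → Bool, swapProcess K φ (signVec ε)
        = ∑ s : Fin T → Bool, ∑ ε : Fin T → Bool, swapProcess K φ (signVec fun i => s i == ε i) := by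
      have : ∀ s : Fin T → Bool, ∑ ε : Fin T → Bool, swapProcess K φ (signVec fun i => s i == ε i)
          = ∑ ε : Fin T → Bool, swapProcess K φ (signVec ε) := fun s =>
        sum_boolVec_comp_beq s fun x => swapProcess K φ (signVec x)
      simp [this]
    rw [e1]
    refine (Finset.sum_le_sum fun s _ => Finset.sum_le_sum fun ε _ => hptw s ε).trans ?_
    simp only [Finset.sum_add_distrib]
    have n1 : ∑ s : Fin T → Bool, ∑ ε, A (fun i => !(s i)) ε = ∑ s, ∑ ε, A s ε :=
      sum_boolVec_comp_not fun s => ∑ ε, A s ε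
    have n2 : ∀ s, ∑ ε : Fin T → Bool, A s (fun i => !(ε i)) = ∑ ε, A s ε := fun s =>
      sum_boolVec_comp_not fun ε => A s ε
    simp only [n2]
    rw [n1, Finset.sum_comm]
    linarith
  have hctr : ∀ ε : Fin T → Bool, ∑ s, A s ε ≤ 2 ^ T * (l * radAvg (swapSel ε '' K)) := by
    intro ε
    have := radAvg_comp_le (K := swapSel ε '' K) ⟨_, ⟨0, h0, rfl⟩⟩ hl (abs_swapSel_le hK ε) hφ
    rw [radAvg, div_le_iff₀ h2] at this
    rw [mul_comm (2 ^ T)]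
    exact this
  refine le_of_mul_le_mul_left (hsum.trans ?_) h2
  calc 4 * ∑ ε : Fin T → Bool, ∑ s, A s ε
      ≤ 4 * ∑ ε : Fin T → Bool, 2 ^ T * (l * radAvg (swapSel ε '' K)) := by
        gcongr with ε; exact hctr ε
    _ = _ := by rw [← Finset.mul_sum, ← Finset.mul_sum]; ring

/-- The Rademacher average of the mixed sample, extended from the vertices to the cube. -/
def mixedAvg (K : Set ((Fin T → ℝ) × (Fin T → ℝ))) (x : Fin T → ℝ) : ℝ :=
  (∑ s : Fin T → Bool, sSup ((fun p : (Fin T → ℝ) × (Fin T → ℝ) =>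
    ∑ i, boolSign (s i) * ((p.1 i + p.2 i) / 2)
      + ∑ i, x i * (boolSign (s i) * ((p.1 i - p.2 i) / 2))) '' K)) / 2 ^ T

/-- Selecting one of two numbers is half their sum plus the sign times half their difference. This
affine form is what makes the Rademacher average convex in the swap signs. -/
lemma mixedAvg_signVec (K : Set ((Fin T → ℝ) × (Fin T → ℝ))) (ε : Fin T → Bool) :
    mixedAvg K (signVec ε) = radAvg (swapSel ε '' K) := by
  simp only [mixedAvg, radAvg, signSup, Set.image_image]
  congr 1
  refine Finset.sum_congr rfl fun s _ => ?_
  congr 1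
  refine Set.image_congr fun p _ => ?_
  rw [← Finset.sum_add_distrib]
  refine Finset.sum_congr rfl fun i _ => ?_
  cases h : ε i
  · simp only [signVec, swapSel, h, boolSign_false, Bool.false_eq_true, if_false]; ring
  · simp only [signVec, swapSel, h, boolSign_true, if_true]; ring

lemma bddAbove_mixedAvg (hK : ∀ p ∈ K, ∀ i, |p.1 i| ≤ c ∧ |p.2 i| ≤ c) (s : Fin T → Bool)
    (x : Fin T → ℝ) : BddAbove ((fun p : (Fin T → ℝ) × (Fin T → ℝ) =>
      ∑ i, boolSign (s i) * ((p.1 i + p.2 i) / 2)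
        + ∑ i, x i * (boolSign (s i) * ((p.1 i - p.2 i) / 2))) '' K) := by
  refine ⟨∑ _i : Fin T, c + ∑ i, |x i| * c, ?_⟩
  rintro _ ⟨p, hp, rfl⟩
  refine add_le_add (Finset.sum_le_sum fun i _ => ?_) (Finset.sum_le_sum fun i _ => ?_)
  · refine (le_abs_self _).trans ?_
    rw [abs_mul, abs_boolSign, one_mul, abs_div, abs_two, div_le_iff₀ two_pos]
    exact (abs_add_le _ _).trans (by linarith [(hK p hp i).1, (hK p hp i).2])
  · refine (le_abs_self _).trans ?_
    rw [abs_mul, abs_mul, abs_boolSign, one_mul, abs_div, abs_two]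
    gcongr
    rw [div_le_iff₀ two_pos]
    exact (abs_sub _ _).trans (by linarith [(hK p hp i).1, (hK p hp i).2])

lemma convexOn_mixedAvg (h0 : K.Nonempty) (hK : ∀ p ∈ K, ∀ i, |p.1 i| ≤ c ∧ |p.2 i| ≤ c) :
    ConvexOn ℝ Set.univ (mixedAvg K) := by
  refine ⟨convex_univ, fun x _ y _ s t hs ht hst => ?_⟩
  simp only [mixedAvg, smul_eq_mul]
  rw [mul_div_assoc', mul_div_assoc', ← add_div]
  gcongr
  rw [Finset.mul_sum, Finset.mul_sum, ← Finset.sum_add_distrib]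
  refine Finset.sum_le_sum fun σ _ => ?_
  exact (convexOn_sSup_affine (a := fun p : (Fin T → ℝ) × (Fin T → ℝ) =>
    ∑ i, boolSign (σ i) * ((p.1 i + p.2 i) / 2))
      (b := fun p i => boolSign (σ i) * ((p.1 i - p.2 i) / 2)) h0 (bddAbove_mixedAvg hK σ)).2
      (Set.mem_univ x) (Set.mem_univ y) hs ht hst

lemma sum_sub_sq_le (hQ : ∀ p ∈ K, ∑ i, (p.1 i ^ 2 + p.2 i ^ 2) ≤ 2 * Q ^ 2)
    {p : (Fin T → ℝ) × (Fin T → ℝ)} (hp : p ∈ K) : ∑ i, (p.1 i - p.2 i) ^ 2 ≤ 4 * Q ^ 2 := by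
  calc ∑ i, (p.1 i - p.2 i) ^ 2 ≤ ∑ i, 2 * (p.1 i ^ 2 + p.2 i ^ 2) :=
        Finset.sum_le_sum fun i _ => by nlinarith [sq_nonneg (p.1 i + p.2 i)]
    _ = 2 * ∑ i, (p.1 i ^ 2 + p.2 i ^ 2) := by rw [Finset.mul_sum]
    _ ≤ _ := by linarith [hQ p hp]

/-- The coefficients of `x` are half differences of the two samples. Their squared norm is at most
`Q ^ 2` by the pooled localization. -/
lemma mixedAvg_le_add (h0 : K.Nonempty) (hK : ∀ p ∈ K, ∀ i, |p.1 i| ≤ c ∧ |p.2 i| ≤ c) (hQ0 : 0 ≤ Q)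
    (hQ : ∀ p ∈ K, ∑ i, (p.1 i ^ 2 + p.2 i ^ 2) ≤ 2 * Q ^ 2) (x y : Fin T → ℝ) :
    mixedAvg K x ≤ mixedAvg K y + Q * √(∑ i, (x i - y i) ^ 2) := by
  have h2 : (0 : ℝ) < 2 ^ T := by positivity
  have e : mixedAvg K y + Q * √(∑ i, (x i - y i) ^ 2) = (∑ s : Fin T → Bool,
      (sSup ((fun p : (Fin T → ℝ) × (Fin T → ℝ) =>
        ∑ i, boolSign (s i) * ((p.1 i + p.2 i) / 2)
          + ∑ i, y i * (boolSign (s i) * ((p.1 i - p.2 i) / 2))) '' K)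
        + Q * √(∑ i, (x i - y i) ^ 2))) / 2 ^ T := by
    rw [Finset.sum_add_distrib, add_div, mixedAvg]
    simp
  rw [e, mixedAvg]
  gcongr with s
  refine sSup_affine_le_add h0 (bddAbove_mixedAvg hK s) hQ0 (fun p hp => ?_) x y
  have := sum_sub_sq_le hQ hp
  have e : ∑ i, (boolSign (s i) * ((p.1 i - p.2 i) / 2)) ^ 2 = (∑ i, (p.1 i - p.2 i) ^ 2) / 4 := by
    rw [Finset.sum_div]
    refine Finset.sum_congr rfl fun i _ => ?_
    rw [mul_pow, boolSign_sq]; ring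
  rw [e]
  linarith

open Classical in
/-- For most swaps, the increments between the two swapped samples are bounded, uniformly over the
class, by the Rademacher average of the first swapped sample. -/
theorem card_swap_deviation_le (hl : 0 ≤ l) (h0 : 0 ∈ K) (hφ0 : φ 0 = 0)
    (hφ : ∀ x y, |x| ≤ c → |y| ≤ c → |φ x - φ y| ≤ l * |x - y|)
    (hK : ∀ p ∈ K, ∀ i, |p.1 i| ≤ c ∧ |p.2 i| ≤ c) (hQ0 : 0 ≤ Q)
    (hQ : ∀ p ∈ K, ∑ i, (p.1 i ^ 2 + p.2 i ^ 2) ≤ 2 * Q ^ 2) {t : ℝ} (ht : 1 ≤ t) :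
    ((Finset.univ.filter fun ε : Fin T → Bool => ∃ p ∈ K,
        l * (8 * radAvg (swapSel ε '' K) + 108 * Q * √t)
          < |∑ i, boolSign (ε i) * (φ (p.1 i) - φ (p.2 i))|).card : ℝ)
      ≤ 4 * Real.exp (-t) * 2 ^ T := by
  have h2 : (0 : ℝ) < 2 ^ T := by positivity
  have hne : K.Nonempty := ⟨0, h0⟩
  have hne' : (K ×ˢ (Set.univ : Set Bool)).Nonempty := ⟨(0, true), h0, trivial⟩
  have hG := ConvexOn.card_upper_deviation_le (F := swapProcess K φ) (K := 2 * l * Q)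
    (convexOn_sSup_affine hne' (bddAbove_swapProcess hl hφ hK)) (by positivity)
    (sSup_affine_le_add hne' (bddAbove_swapProcess hl hφ hK) (by positivity) (by
      rintro ⟨p, b⟩ ⟨hp, _⟩
      calc ∑ i, (boolSign b * (φ (p.1 i) - φ (p.2 i))) ^ 2
          ≤ ∑ i, l ^ 2 * (p.1 i - p.2 i) ^ 2 := by
            refine Finset.sum_le_sum fun i _ => ?_
            rw [mul_pow, boolSign_sq, one_mul, ← mul_pow]
            refine sq_le_sq.2 ?_
            rw [abs_mul, abs_of_nonneg hl]
            exact hφ _ _ (hK p hp i).1 (hK p hp i).2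
        _ = l ^ 2 * ∑ i, (p.1 i - p.2 i) ^ 2 := by rw [Finset.mul_sum]
        _ ≤ l ^ 2 * (4 * Q ^ 2) := by gcongr; exact sum_sub_sq_le hQ hp
        _ = _ := by ring))
    (fun x => (abs_nonneg _).trans (abs_sum_le_swapProcess hl hφ hK x h0)) (t := t) (by linarith)
  have hW := ConvexOn.card_lower_deviation_le (convexOn_mixedAvg hne hK) hQ0
    (mixedAvg_le_add hne hK hQ0 hQ) (t := t) (by linarith)
  have hE := sum_swapProcess_le hl h0 hφ0 hφ hK
  simp only [mixedAvg_signVec] at hW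
  set EG := (∑ y : Fin T → Bool, swapProcess K φ (signVec y)) / 2 ^ T with hEG
  set EW := (∑ y : Fin T → Bool, radAvg (swapSel y '' K)) / 2 ^ T with hEW
  have hE' : EG ≤ 4 * l * EW := by
    rw [hEG, hEW, ← mul_div_assoc]
    gcongr
  -- Off both exceptional sets the increment is at most `8 l (W + Q √(32 t) + 6 Q) + 2 l Q √(32 t)`,
  -- with `W` the mixed Rademacher average. Since `√(32 t) ≤ 6 √t` and `1 ≤ √t`, the terms in `Q`
  -- add up to `(10 * 6 + 48) l Q √t = 108 l Q √t`.
  have hs1 : 1 ≤ √t := Real.one_le_sqrt.2 ht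
  have hs2 : √(32 * t) ≤ 6 * √t := by
    rw [Real.sqrt_le_left (by positivity), mul_pow, Real.sq_sqrt (by linarith)]
    linarith
  set G := Finset.univ.filter fun x : Fin T → Bool =>
    2 * EG + 2 * l * Q * √(32 * t) < swapProcess K φ (signVec x) with hGdef
  set W := Finset.univ.filter fun x : Fin T → Bool =>
    radAvg (swapSel x '' K) + Q * √(32 * t) + 6 * Q < EW with hWdef
  have hsub : (Finset.univ.filter fun ε : Fin T → Bool => ∃ p ∈ K,
        l * (8 * radAvg (swapSel ε '' K) + 108 * Q * √t)
          < |∑ i, boolSign (ε i) * (φ (p.1 i) - φ (p.2 i))|) ⊆ G ∪ W := by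
    intro ε hε
    obtain ⟨p, hp, hlt⟩ := (Finset.mem_filter.1 hε).2
    by_contra hcon
    rw [Finset.mem_union, not_or] at hcon
    have g1 : swapProcess K φ (signVec ε) ≤ 2 * EG + 2 * l * Q * √(32 * t) := by
      by_contra! h
      exact hcon.1 (Finset.mem_filter.2 ⟨Finset.mem_univ _, h⟩)
    have g2 : EW ≤ radAvg (swapSel ε '' K) + Q * √(32 * t) + 6 * Q := by
      by_contra! h
      exact hcon.2 (Finset.mem_filter.2 ⟨Finset.mem_univ _, h⟩)
    have g3 := abs_sum_le_swapProcess hl hφ hK (signVec ε) hp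
    have g4 : l * EW ≤ l * (radAvg (swapSel ε '' K) + Q * √(32 * t) + 6 * Q) := by gcongr
    have g5 : l * Q * √(32 * t) ≤ l * Q * (6 * √t) := by gcongr
    have g6 : l * Q * 1 ≤ l * Q * √t := by gcongr
    simp only [signVec] at g3
    nlinarith
  calc _ ≤ ((G ∪ W).card : ℝ) := by exact_mod_cast Finset.card_le_card hsub
    _ ≤ G.card + W.card := by exact_mod_cast Finset.card_union_le _ _
    _ ≤ _ := by linarith

end Pool

end

noncomputable section

/-! ### Symmetrization with a ghost sample -/

section Symmetrization

variable {T : ℕ} {J Ω : Type*}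

/-- The evaluations of a class of functions on a pair of samples, localized in the pooled norm. -/
def poolSet (e : J → Fin T → Ω → ℝ) (Q : ℝ) (q : (Fin T → Ω) × (Fin T → Ω)) :
    Set ((Fin T → ℝ) × (Fin T → ℝ)) :=
  {p | ∃ j, p = (fun t => e j t (q.1 t), fun t => e j t (q.2 t)) ∧
    ∑ i, (p.1 i ^ 2 + p.2 i ^ 2) ≤ 2 * Q ^ 2}

/-- The increments between the two samples are not controlled by the Rademacher average of the
first. -/
def PoolBad (e : J → Fin T → Ω → ℝ) (φ : ℝ → ℝ) (l Q t : ℝ) (q : (Fin T → Ω) × (Fin T → Ω)) : Prop :=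
  ∃ p ∈ poolSet e Q q, l * (8 * radAvg (Prod.fst '' poolSet e Q q) + 108 * Q * √t)
    < |∑ i, (φ (p.1 i) - φ (p.2 i))|

/-- Swapping two samples according to `ε`. -/
def swapPair (ε : Fin T → Bool) {E : Type*} (q : (Fin T → E) × (Fin T → E)) :
    (Fin T → E) × (Fin T → E) := (swapSel ε q, swapSel (fun i => !(ε i)) q)

/-- The pooled sum of squares is symmetric in the two samples at every trial, hence invariant under
swaps. A localization in the norm of the first sample alone would change with `ε`. -/
lemma poolSet_swapPair (e : J → Fin T → Ω → ℝ) (Q : ℝ) (ε : Fin T → Bool)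
    (q : (Fin T → Ω) × (Fin T → Ω)) :
    poolSet e Q (swapPair ε q) = swapPair ε '' poolSet e Q q := by
  have key : ∀ j, ((fun t => e j t ((swapPair ε q).1 t), fun t => e j t ((swapPair ε q).2 t)) :
      (Fin T → ℝ) × (Fin T → ℝ))
      = swapPair ε (fun t => e j t (q.1 t), fun t => e j t (q.2 t)) := by
    intro j
    refine Prod.ext ?_ ?_ <;> funext t <;> simp only [swapPair, swapSel] <;> split_ifs <;> rfl
  have hsum : ∀ p : (Fin T → ℝ) × (Fin T → ℝ), ∑ i, ((swapPair ε p).1 i ^ 2 + (swapPair ε p).2 i ^ 2)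
      = ∑ i, (p.1 i ^ 2 + p.2 i ^ 2) := by
    intro p
    refine Finset.sum_congr rfl fun i _ => ?_
    cases h : ε i <;> simp [swapPair, swapSel, h, add_comm]
  ext p
  constructor
  · rintro ⟨j, rfl, hj⟩
    refine ⟨_, ⟨j, rfl, ?_⟩, (key j).symm⟩
    rw [key j, hsum] at hj
    exact hj
  · rintro ⟨_, ⟨j, rfl, hj⟩, rfl⟩
    refine ⟨j, (key j).symm, ?_⟩
    rw [hsum]
    exact hj

lemma poolBad_swapPair_iff (e : J → Fin T → Ω → ℝ) (φ : ℝ → ℝ) (l Q t : ℝ) (ε : Fin T → Bool)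
    (q : (Fin T → Ω) × (Fin T → Ω)) :
    PoolBad e φ l Q t (swapPair ε q) ↔ ∃ p ∈ poolSet e Q q,
      l * (8 * radAvg (swapSel ε '' poolSet e Q q) + 108 * Q * √t)
        < |∑ i, boolSign (ε i) * (φ (p.1 i) - φ (p.2 i))| := by
  simp only [PoolBad, poolSet_swapPair, Set.image_image, Set.exists_mem_image]
  simp only [swapPair, boolSign_mul_sub_eq]

lemma zero_mem_poolSet {e : J → Fin T → Ω → ℝ} {j₀ : J} (h : ∀ t x, e j₀ t x = 0) (Q : ℝ)
    (q : (Fin T → Ω) × (Fin T → Ω)) : 0 ∈ poolSet e Q q := by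
  refine ⟨j₀, ?_, ?_⟩
  · ext <;> simp [h]
  · simp; positivity

variable [MeasurableSpace Ω]

lemma measurable_radAvg_poolSet [Countable J] {e : J → Fin T → Ω → ℝ} {j₀ : J}
    (h : ∀ t x, e j₀ t x = 0) (he : ∀ j t, Measurable (e j t)) (Q : ℝ) :
    Measurable fun q => radAvg (Prod.fst '' poolSet e Q q) := by
  unfold radAvg
  refine Measurable.div_const (Finset.measurable_sum _ fun s _ => ?_) _
  -- The index set on the right no longer depends on `q`: indices that violate the localization
  -- contribute `0`, a value attained anyway by the zero function.
  have hrange : ∀ q : (Fin T → Ω) × (Fin T → Ω), signSup (Prod.fst '' poolSet e Q q) s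
      = ⨆ j, if ∑ i, (e j i (q.1 i) ^ 2 + e j i (q.2 i) ^ 2) ≤ 2 * Q ^ 2 then
          ∑ i, boolSign (s i) * e j i (q.1 i) else 0 := by
    intro q
    rw [signSup, iSup]
    congr 1
    ext v
    constructor
    · rintro ⟨_, ⟨_, ⟨j, rfl, hj⟩, rfl⟩, rfl⟩
      exact ⟨j, if_pos hj⟩
    · rintro ⟨j, rfl⟩
      simp only
      split_ifs with hj
      · exact ⟨_, ⟨_, ⟨j, rfl, hj⟩, rfl⟩, rfl⟩
      · exact ⟨0, ⟨0, zero_mem_poolSet h Q q, rfl⟩, by simp⟩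
  simp only [hrange]
  refine Measurable.iSup fun j => Measurable.ite ?_ ?_ measurable_const
  · refine measurableSet_le (Finset.measurable_sum _ fun i _ => ?_) measurable_const
    exact (((he j i).comp (by fun_prop)).pow_const 2).add (((he j i).comp (by fun_prop)).pow_const 2)
  · exact Finset.measurable_sum _ fun i _ => ((he j i).comp (by fun_prop)).const_mul _

lemma measurableSet_poolBad [Countable J] {e : J → Fin T → Ω → ℝ} {j₀ : J}
    (h : ∀ t x, e j₀ t x = 0) (he : ∀ j t, Measurable (e j t)) {φ : ℝ → ℝ} (hφ : Measurable φ)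
    (l Q t : ℝ) : MeasurableSet {q | PoolBad e φ l Q t q} := by
  have e1 : {q | PoolBad e φ l Q t q} = ⋃ j, ({q : (Fin T → Ω) × (Fin T → Ω) |
      ∑ i, (e j i (q.1 i) ^ 2 + e j i (q.2 i) ^ 2) ≤ 2 * Q ^ 2} ∩
      {q | l * (8 * radAvg (Prod.fst '' poolSet e Q q) + 108 * Q * √t)
        < |∑ i, (φ (e j i (q.1 i)) - φ (e j i (q.2 i)))|}) := by
    ext q
    simp only [Set.mem_iUnion]
    constructor
    · rintro ⟨_, ⟨j, rfl, hj⟩, hlt⟩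
      exact ⟨j, hj, hlt⟩
    · rintro ⟨j, hj, hlt⟩
      exact ⟨_, ⟨j, rfl, hj⟩, hlt⟩
  rw [e1]
  have m1 : ∀ j i, Measurable fun q : (Fin T → Ω) × (Fin T → Ω) => e j i (q.1 i) := fun j i =>
    (he j i).comp (by fun_prop)
  have m2 : ∀ j i, Measurable fun q : (Fin T → Ω) × (Fin T → Ω) => e j i (q.2 i) := fun j i =>
    (he j i).comp (by fun_prop)
  refine MeasurableSet.iUnion fun j => MeasurableSet.inter ?_ ?_
  · exact measurableSet_le (Finset.measurable_sum _ fun i _ =>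
      ((m1 j i).pow_const 2).add ((m2 j i).pow_const 2)) measurable_const
  · refine measurableSet_lt ?_ ?_
    · exact (((measurable_radAvg_poolSet h he Q).const_mul 8).add_const _).const_mul l
    · have : Measurable fun q : (Fin T → Ω) × (Fin T → Ω) =>
          ∑ i, (φ (e j i (q.1 i)) - φ (e j i (q.2 i))) :=
        Finset.measurable_sum _ fun i _ => (hφ.comp (m1 j i)).sub (hφ.comp (m2 j i))
      exact this.abs

/-- After regrouping by trials the swap acts separately on each factor `m t ⊗ m t`, as the identity
or the flip. -/
lemma measurePreserving_swapPair (m : Fin T → Measure Ω) [∀ t, SigmaFinite (m t)]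
    (ε : Fin T → Bool) :
    MeasurePreserving (swapPair ε) ((Measure.pi m).prod (Measure.pi m))
      ((Measure.pi m).prod (Measure.pi m)) := by
  have h1 := measurePreserving_arrowProdEquivProdArrow Ω Ω (Fin T) m m
  have h2 := measurePreserving_pi (fun t => (m t).prod (m t)) (fun t => (m t).prod (m t))
    (f := fun t => if ε t then id else Prod.swap) (fun t => by
      split_ifs
      · exact MeasurePreserving.id _
      · exact Measure.measurePreserving_swap)
  have h3 := (h1.comp h2).comp h1.symm
  convert h3 using 1
  funext q
  refine Prod.ext ?_ ?_ <;> funext t <;> cases h : ε t <;>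
    simp [swapPair, swapSel, MeasurableEquiv.arrowProdEquivProdArrow, Equiv.arrowProdEquivProdArrow,
      h, MeasurableEquiv.symm]

/-- The uncontrolled increments between a sample and its ghost have small probability. -/
theorem measure_poolBad_le [Countable J] (m : Fin T → Measure Ω) [∀ t, IsProbabilityMeasure (m t)]
    {e : J → Fin T → Ω → ℝ} {j₀ : J} (h0 : ∀ t x, e j₀ t x = 0) (he : ∀ j t, Measurable (e j t))
    {c l Q : ℝ} (hl : 0 ≤ l) (hbd : ∀ t, ∀ᵐ x ∂m t, ∀ j, |e j t x| ≤ c) {φ : ℝ → ℝ}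
    (hφm : Measurable φ) (hφ0 : φ 0 = 0)
    (hφ : ∀ x y, |x| ≤ c → |y| ≤ c → |φ x - φ y| ≤ l * |x - y|) (hQ0 : 0 ≤ Q) {t : ℝ} (ht : 1 ≤ t) :
    ((Measure.pi m).prod (Measure.pi m)) {q | PoolBad e φ l Q t q}
      ≤ ENNReal.ofReal (4 * Real.exp (-t)) := by
  classical
  set P := (Measure.pi m).prod (Measure.pi m) with hP
  set B := {q | PoolBad e φ l Q t q} with hB
  have hBm : MeasurableSet B := measurableSet_poolBad h0 he hφm l Q t
  have hpi : ∀ᵐ w ∂Measure.pi m, ∀ t j, |e j t (w t)| ≤ c := by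
    rw [ae_all_iff]
    intro t
    exact (Measure.quasiMeasurePreserving_eval m t).ae (hbd t)
  have hae : ∀ᵐ q ∂P, (∀ t j, |e j t (q.1 t)| ≤ c) ∧ (∀ t j, |e j t (q.2 t)| ≤ c) :=
    (Measure.quasiMeasurePreserving_fst.ae hpi).and (Measure.quasiMeasurePreserving_snd.ae hpi)
  -- By invariance `P B` equals its average over all swaps. After exchanging sum and integral only
  -- the fraction of bad swaps of a frozen pair has to be counted.
  have hswap : ∀ ε : Fin T → Bool, P B = ∫⁻ q, B.indicator 1 (swapPair ε q) ∂P := by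
    intro ε
    have hmp := measurePreserving_swapPair m ε
    rw [← hP] at hmp
    rw [hmp.lintegral_comp (measurable_one.indicator hBm), lintegral_indicator_one hBm]
  have hcount : ∀ᵐ q ∂P, ∑ ε : Fin T → Bool, B.indicator (1 : (Fin T → Ω) × (Fin T → Ω) → ENNReal) (swapPair ε q)
      ≤ ENNReal.ofReal (4 * Real.exp (-t) * 2 ^ T) := by
    filter_upwards [hae] with q hq
    have hbound : ∀ p ∈ poolSet e Q q, ∀ i, |p.1 i| ≤ c ∧ |p.2 i| ≤ c := by
      rintro _ ⟨j, rfl, _⟩ i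
      exact ⟨hq.1 i j, hq.2 i j⟩
    have hc := card_swap_deviation_le hl (zero_mem_poolSet h0 Q q) hφ0 hφ hbound hQ0
      (by rintro _ ⟨j, rfl, hj⟩; exact hj) ht
    have : ∑ ε : Fin T → Bool, B.indicator (1 : (Fin T → Ω) × (Fin T → Ω) → ENNReal) (swapPair ε q)
        = ((Finset.univ.filter fun ε : Fin T → Bool => ∃ p ∈ poolSet e Q q,
          l * (8 * radAvg (swapSel ε '' poolSet e Q q) + 108 * Q * √t)
            < |∑ i, boolSign (ε i) * (φ (p.1 i) - φ (p.2 i))|).card : ENNReal) := by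
      rw [Finset.card_filter]
      push_cast
      refine Finset.sum_congr rfl fun ε _ => ?_
      simp only [Set.indicator_apply, Pi.one_apply]
      refine if_congr ?_ rfl rfl
      exact poolBad_swapPair_iff e φ l Q t ε q
    rw [this, ← ENNReal.ofReal_natCast]
    exact ENNReal.ofReal_le_ofReal hc
  have hsum : (2 : ENNReal) ^ T * P B ≤ ENNReal.ofReal (4 * Real.exp (-t) * 2 ^ T) := by
    calc (2 : ENNReal) ^ T * P B = ∑ _ε : Fin T → Bool, P B := by simp
      _ = ∑ ε : Fin T → Bool, ∫⁻ q, B.indicator 1 (swapPair ε q) ∂P :=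
          Finset.sum_congr rfl fun ε _ => hswap ε
      _ = ∫⁻ q, ∑ ε : Fin T → Bool, B.indicator 1 (swapPair ε q) ∂P := by
          rw [lintegral_finsetSum]
          intro ε _
          exact (measurable_one.indicator hBm).comp (measurePreserving_swapPair m ε).measurable
      _ ≤ ∫⁻ _q, ENNReal.ofReal (4 * Real.exp (-t) * 2 ^ T) ∂P := lintegral_mono_ae hcount
      _ = _ := by simp
  rw [mul_comm, ENNReal.ofReal_mul (by positivity), ENNReal.ofReal_pow (by norm_num),
    ENNReal.ofReal_ofNat] at hsum
  exact (ENNReal.mul_le_mul_iff_left (by positivity) (by simp)).1 hsum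

/-- If each point of `B` sees a section of `G` of probability at least `1/2`, then
`P B ≤ 2 (P × P) G`; no measurability is needed. -/
lemma measure_le_two_mul_prod {Ω' : Type*} [MeasurableSpace Ω'] (P : Measure Ω') [SFinite P]
    {B : Set Ω'} {G : Set (Ω' × Ω')} (h : ∀ w ∈ B, (2 : ENNReal)⁻¹ ≤ P {w' | (w, w') ∈ G}) :
    P B ≤ 2 * (P.prod P) G := by
  set G' := toMeasurable (P.prod P) G
  have hG' : MeasurableSet G' := measurableSet_toMeasurable _ _
  have hsub : B ⊆ {w | (2 : ENNReal)⁻¹ ≤ P (Prod.mk w ⁻¹' G')} := fun w hw =>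
    (h w hw).trans (measure_mono fun w' hw' => subset_toMeasurable _ _ hw')
  have h2 := mul_meas_ge_le_lintegral (μ := P) (measurable_measure_prodMk_left (ν := P) hG') (2 : ENNReal)⁻¹
  rw [← Measure.prod_apply hG', measure_toMeasurable] at h2
  calc P B ≤ P {w | (2 : ENNReal)⁻¹ ≤ P (Prod.mk w ⁻¹' G')} := measure_mono hsub
    _ = 2 * (2⁻¹ * P {w | (2 : ENNReal)⁻¹ ≤ P (Prod.mk w ⁻¹' G')}) := by
        rw [← mul_assoc, ENNReal.mul_inv_cancel (by simp) (by simp), one_mul]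
    _ ≤ _ := by gcongr

end Symmetrization

end

noncomputable section

/-! ### Uniform deviations in terms of critical radii -/

section UniformDeviation

variable {T : ℕ} {W : Type u} {Ω : Type*}

/-- The sample obtained by recording `V` on the trials in `S`. -/
def obsSample (S : Finset (Fin T)) (V : Ω → W) (w : Fin T → Ω) : Fin T → Option W :=
  fun t => if t ∈ S then some (V (w t)) else none

/-- The value of `f` at the `t`-th trial, `0` on the trials outside `S`. -/
def evalOn (S : Finset (Fin T)) (V : Ω → W) (f : W → ℝ) (t : Fin T) (x : Ω) : ℝ :=
  if t ∈ S then f (V x) else 0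

variable {S : Finset (Fin T)} {V : Ω → W}

lemma sampleSize_obsSample (w : Fin T → Ω) : sampleSize (obsSample S V w) = S.card := by
  unfold sampleSize obsSample
  congr 1
  ext t
  by_cases h : t ∈ S <;> simp [h]

lemma obsSample_elim (w : Fin T → Ω) (f : W → ℝ) (t : Fin T) :
    (obsSample S V w t).elim 0 f = evalOn S V f t (w t) := by
  unfold obsSample evalOn
  split_ifs <;> rfl

lemma empMean_obsSample (w : Fin T → Ω) (f : W → ℝ) :
    empMean (obsSample S V w) f = (∑ t, evalOn S V f t (w t)) / S.card := by
  rw [empMean, sampleSize_obsSample]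
  simp only [obsSample_elim]

lemma evalOn_sq (f : W → ℝ) (t : Fin T) (x : Ω) :
    evalOn S V (fun w => f w ^ 2) t x = evalOn S V f t x ^ 2 := by
  unfold evalOn
  split_ifs <;> simp

lemma evalOn_smul (a : ℝ) (f : W → ℝ) (t : Fin T) (x : Ω) :
    evalOn S V (a • f) t x = a * evalOn S V f t x := by
  unfold evalOn
  split_ifs <;> simp

lemma abs_evalOn_le {f : W → ℝ} {c : ℝ} (hc : 0 ≤ c) {x : Ω} (h : |f (V x)| ≤ c) (t : Fin T) :
    |evalOn S V f t x| ≤ c := by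
  unfold evalOn
  split_ifs <;> simp [*]

/-- The Rademacher average of a class localized in the pooled norm of two samples is controlled by a
critical radius of the first sample. -/
lemma radAvg_poolSet_le {𝓠 F₀ : Set (W → ℝ)} (hF : F₀ ⊆ 𝓠) (hstar : StarConvex ℝ 0 𝓠)
    (h0 : (0 : W → ℝ) ∈ F₀) {c δ ρ r : ℝ} (hc : 0 < c) (hS : S.Nonempty)
    (q : (Fin T → Ω) × (Fin T → Ω)) (hbd : ∀ f ∈ 𝓠, ∀ t ∈ S, |f (V (q.1 t))| ≤ c)
    (hδ : IsCriticalRadius (obsSample S V q.1) 𝓠 c δ) (hδρ : δ ≤ ρ) (hρr : ρ ≤ r) :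
    radAvg (Prod.fst '' poolSet (fun f : F₀ => evalOn S V f.1) (r * √S.card) q)
      ≤ 2 * S.card * r * ρ / c := by
  obtain ⟨hδ0, hδ⟩ := hδ
  have hn : (0 : ℝ) < S.card := by exact_mod_cast hS.card_pos
  have hr0 : 0 < r := by linarith
  have h2 : (0 : ℝ) < 2 ^ T := by positivity
  set d := obsSample S V q.1 with hd
  set X : (Fin T → Bool) → Set ℝ := fun s => (fun f : W → ℝ =>
        (∑ t, (if s t then (1 : ℝ) else -1) * (d t).elim 0 f) / (sampleSize d : ℝ)) ''
      {f | f ∈ 𝓠 ∧ √(empMean d fun w => f w ^ 2) ≤ δ} with hX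
  have hXbd : ∀ s, BddAbove (X s) := by
    intro s
    refine ⟨T * c / S.card, ?_⟩
    rintro _ ⟨f, ⟨hf, _⟩, rfl⟩
    rw [hd]
    simp only [sampleSize_obsSample, obsSample_elim]
    gcongr
    refine (le_abs_self _).trans (abs_sum_sign_mul_le s fun i => ?_)
    unfold evalOn
    split_ifs with hi
    · exact hbd f hf i hi
    · simpa using hc.le
  have hsup : ∀ s, signSup (Prod.fst '' poolSet (fun f : F₀ => evalOn S V f.1) (r * √S.card) q) s
      ≤ 2 * r / δ * S.card * sSup (X s) := by
    intro s
    refine csSup_le ⟨_, ⟨0, ⟨0, zero_mem_poolSet (j₀ := ⟨0, h0⟩) (fun t x => by simp [evalOn]) _ q,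
      rfl⟩, rfl⟩⟩ ?_
    rintro _ ⟨_, ⟨_, ⟨⟨f, hf⟩, rfl, hj⟩, rfl⟩, rfl⟩
    simp only at hj ⊢
    -- Pooled localization at `r` leaves the first empirical norm at most `√2 r`. Scaling by `δ / (2
    -- r) ≤ 1` stays in the star-shaped class and brings the norm below `δ`, where the critical
    -- radius applies.
    have hlam0 : 0 ≤ δ / (2 * r) := by positivity
    have hlam1 : δ / (2 * r) ≤ 1 := by rw [div_le_one (by positivity)]; linarith
    have hg := hstar.smul_mem (hF hf) hlam0 hlam1
    have hsq : ∑ t, evalOn S V f t (q.1 t) ^ 2 ≤ 2 * r ^ 2 * S.card := by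
      rw [Finset.sum_add_distrib, mul_pow, Real.sq_sqrt hn.le] at hj
      have : 0 ≤ ∑ t, evalOn S V f t (q.2 t) ^ 2 := Finset.sum_nonneg fun i _ => sq_nonneg _
      linarith
    have hloc : √(empMean d fun w => ((δ / (2 * r)) • f) w ^ 2) ≤ δ := by
      rw [Real.sqrt_le_left hδ0.le, hd, empMean_obsSample, div_le_iff₀ hn]
      simp only [evalOn_sq, evalOn_smul, mul_pow, ← Finset.mul_sum]
      calc (δ / (2 * r)) ^ 2 * ∑ t, evalOn S V f t (q.1 t) ^ 2
          ≤ (δ / (2 * r)) ^ 2 * (2 * r ^ 2 * S.card) := by gcongr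
        _ = δ ^ 2 * S.card / 2 := by field_simp
        _ ≤ _ := by nlinarith [mul_nonneg (sq_nonneg δ) hn.le]
    have hle := le_csSup (hXbd s) ⟨_, ⟨hg, hloc⟩, rfl⟩
    rw [hd] at hle
    simp only [sampleSize_obsSample, obsSample_elim, evalOn_smul] at hle
    rw [div_le_iff₀ hn] at hle
    have e : ∑ t, boolSign (s t) * evalOn S V f t (q.1 t) = 2 * r / δ *
        ∑ t, (if s t then (1 : ℝ) else -1) * (δ / (2 * r) * evalOn S V f t (q.1 t)) := by
      rw [Finset.mul_sum]
      refine Finset.sum_congr rfl fun t _ => ?_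
      simp only [boolSign]
      field_simp
    rw [e]
    calc _ ≤ 2 * r / δ * (sSup (X s) * S.card) := by gcongr
      _ = _ := by ring
  have hloc : (∑ s, sSup (X s)) / 2 ^ T ≤ δ ^ 2 / c := hδ
  calc radAvg _ ≤ (∑ s, 2 * r / δ * S.card * sSup (X s)) / 2 ^ T := by
        unfold radAvg
        gcongr with s
        exact hsup s
    _ = 2 * r / δ * S.card * ((∑ s, sSup (X s)) / 2 ^ T) := by rw [← Finset.mul_sum]; ring
    _ ≤ 2 * r / δ * S.card * (δ ^ 2 / c) := by gcongr
    _ = 2 * S.card * r * δ / c := by field_simp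
    _ ≤ _ := by gcongr

/-- Pointwise separability with a countable subclass containing `0`. -/
lemma PointwiseSeparable.exists_countable_zero_mem {𝓠 : Set (W → ℝ)} (h : PointwiseSeparable 𝓠)
    (h0 : (0 : W → ℝ) ∈ 𝓠) : ∃ F₀ ⊆ 𝓠, F₀.Countable ∧ (0 : W → ℝ) ∈ F₀ ∧ ∀ f ∈ 𝓠,
      ∃ s : ℕ → W → ℝ, (∀ n, s n ∈ F₀) ∧ ∀ w, Tendsto (fun n => s n w) atTop (𝓝 (f w)) := by
  obtain ⟨F₀, hF, hc, hd⟩ := h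
  refine ⟨insert 0 F₀, Set.insert_subset h0 hF, hc.insert 0, Set.mem_insert _ _, fun f hf => ?_⟩
  obtain ⟨s, hs, hs'⟩ := hd f hf
  exact ⟨s, fun n => Set.mem_insert_of_mem _ (hs n), hs'⟩

/-- Off the bad event, increments between the two samples are bounded for all functions whose
pooled norm is less than `r`. -/
lemma abs_empMean_sub_le_of_not_poolBad {𝓠 F₀ : Set (W → ℝ)} (hF : F₀ ⊆ 𝓠)
    (hstar : StarConvex ℝ 0 𝓠) (h0 : (0 : W → ℝ) ∈ F₀)
    (hd : ∀ f ∈ 𝓠, ∃ s : ℕ → W → ℝ, (∀ n, s n ∈ F₀) ∧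
      ∀ w, Tendsto (fun n => s n w) atTop (𝓝 (f w)))
    {c δ ρ r l : ℝ} (hc : 0 < c) (hl : 0 ≤ l) (hS : S.Nonempty)
    (q : (Fin T → Ω) × (Fin T → Ω)) (hbd : ∀ f ∈ 𝓠, ∀ t ∈ S, |f (V (q.1 t))| ≤ c)
    (hδ : IsCriticalRadius (obsSample S V q.1) 𝓠 c δ) (hδρ : δ ≤ ρ) (hρr : ρ ≤ r)
    {φ : ℝ → ℝ} (hφ : Continuous φ) (hφ0 : φ 0 = 0)
    (hbad : ¬ PoolBad (fun f : F₀ => evalOn S V f.1) φ l (r * √S.card) (S.card * ρ ^ 2) q)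
    {f : W → ℝ} (hf : f ∈ 𝓠)
    (hpool : (empMean (obsSample S V q.1) (fun w => f w ^ 2)
      + empMean (obsSample S V q.2) (fun w => f w ^ 2)) / 2 < r ^ 2) :
    |empMean (obsSample S V q.1) (fun w => φ (f w)) - empMean (obsSample S V q.2) (fun w => φ (f w))|
      ≤ l * ((16 / c + 108) * (r * ρ)) := by
  have hn : (0 : ℝ) < S.card := by exact_mod_cast hS.card_pos
  have hρ0 : 0 ≤ ρ := hδ.1.le.trans hδρ
  have hr0 : 0 ≤ r := hρ0.trans hρr
  have hrad := radAvg_poolSet_le hF hstar h0 hc hS q hbd hδ hδρ hρr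
  have hφe : ∀ (g : W → ℝ) t (x : Ω), evalOn S V (fun w => φ (g w)) t x = φ (evalOn S V g t x) := by
    intro g t x
    unfold evalOn
    split_ifs
    · rfl
    · exact hφ0.symm
  rw [empMean_obsSample, empMean_obsSample, ← sub_div, abs_div, abs_of_pos hn, div_le_iff₀ hn,
    ← Finset.sum_sub_distrib]
  simp only [hφe]
  rw [empMean_obsSample, empMean_obsSample, ← add_div, div_div, div_lt_iff₀ (by positivity),
    ← Finset.sum_add_distrib] at hpool
  simp only [evalOn_sq] at hpool
  obtain ⟨s, hs, hlim⟩ := hd f hf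
  have hev : ∀ t x, Tendsto (fun n => evalOn S V (s n) t x) atTop (𝓝 (evalOn S V f t x)) := by
    intro t x
    unfold evalOn
    split_ifs
    · exact hlim _
    · exact tendsto_const_nhds
  have hpl : Tendsto (fun n => ∑ t, (evalOn S V (s n) t (q.1 t) ^ 2 + evalOn S V (s n) t (q.2 t) ^ 2))
      atTop (𝓝 (∑ t, (evalOn S V f t (q.1 t) ^ 2 + evalOn S V f t (q.2 t) ^ 2))) :=
    tendsto_finsetSum _ fun t _ => ((hev t _).pow 2).add ((hev t _).pow 2)
  have htarget : Tendsto (fun n => |∑ t, (φ (evalOn S V (s n) t (q.1 t))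
      - φ (evalOn S V (s n) t (q.2 t)))|) atTop
      (𝓝 |∑ t, (φ (evalOn S V f t (q.1 t)) - φ (evalOn S V f t (q.2 t)))|) :=
    (tendsto_finsetSum _ fun t _ =>
      ((hφ.tendsto _).comp (hev t _)).sub ((hφ.tendsto _).comp (hev t _))).abs
  refine le_of_tendsto htarget ?_
  -- The bad event concerns only the countable subclass. Since the pooled norm of `f` is strictly
  -- below `r`, its approximants eventually satisfy the same localization and the bound passes to
  -- the limit.
  filter_upwards [hpl.eventually (gt_mem_nhds hpool)] with n hlt
  have hnb : |∑ t, (φ (evalOn S V (s n) t (q.1 t)) - φ (evalOn S V (s n) t (q.2 t)))|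
      ≤ l * (8 * radAvg (Prod.fst '' poolSet (fun f : F₀ => evalOn S V f.1) (r * √S.card) q)
        + 108 * (r * √S.card) * √(S.card * ρ ^ 2)) := by
    by_contra! hcon
    refine hbad ⟨_, ⟨⟨s n, hs n⟩, rfl, ?_⟩, hcon⟩
    simp only
    rw [mul_pow, Real.sq_sqrt hn.le]
    linarith
  refine hnb.trans ?_
  rw [Real.sqrt_mul hn.le, Real.sqrt_sq hρ0, mul_assoc l]
  gcongr
  have e : 108 * (r * √S.card) * (√S.card * ρ) = 108 * r * ρ * S.card := by
    have := Real.mul_self_sqrt hn.le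
    linear_combination (108 * r * ρ) * this
  rw [e]
  calc 8 * radAvg _ + 108 * r * ρ * S.card ≤ 8 * (2 * S.card * r * ρ / c) + 108 * r * ρ * S.card := by
        gcongr
    _ = _ := by ring

/-- Two-sided control of the empirical mean and of the empirical second moment of `f`. -/
def Deviates [MeasurableSpace W] (μ : Measure W) (d : Fin T → Option W) (f : W → ℝ) (η : ℝ) : Prop :=
  ¬ (|empMean d f - ∫ w, f w ∂μ| ≤ η * (√(∫ w, f w ^ 2 ∂μ) + η) ∧
    |empMean d (fun w => f w ^ 2) - ∫ w, f w ^ 2 ∂μ| ≤ 1 / 2 * ((∫ w, f w ^ 2 ∂μ) + η ^ 2))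

/-- The constant `C₀` for a class bounded by `c`. -/
def devConst (c : ℝ) : ℝ :=
  2 + 8 * (16 / c + 108) + 4 * (128 * (16 + 108 * c)) + 6 * c

/-- Here `a`, `D`, `D'` are the population, sample and ghost second moments. The mixed term `2 c √a
s` is split as `a / 16 + 16 c ^ 2 s ^ 2`; in the second bound `D` is absorbed on the left. -/
lemma ghost_norm_arith {c s r a D D' M : ℝ} (ha : 0 ≤ a)
    (hM : M ^ 2 ≤ r ^ 2 + (D + D') / 2) (h2 : |D - D'| ≤ M ^ 2 / 16)
    (h4 : |D' - a| ≤ 2 * c * (√a + s) * s) :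
    |D' - a| ≤ a / 16 + (16 * c ^ 2 + 2 * c) * s ^ 2 ∧ |D - D'| ≤ (r ^ 2 + D') / 8 := by
  constructor
  · refine h4.trans ?_
    have h5 : 0 ≤ (√a / 4 - 4 * c * s) ^ 2 := sq_nonneg _
    have h6 := Real.sq_sqrt ha
    have e : (√a / 4 - 4 * c * s) ^ 2 = √a ^ 2 / 16 - 2 * c * √a * s + 16 * c ^ 2 * s ^ 2 := by ring
    rw [e, h6] at h5
    linarith
  · obtain ⟨b1, b2⟩ := abs_le.1 h2
    have : 0 ≤ r ^ 2 := sq_nonneg r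
    rw [abs_le]
    constructor <;> linarith

/-- The relative errors `1/16` and `1/8` combine to less than `1/2`. The additive errors, of order
`r ^ 2` and `s ^ 2`, fit into `η ^ 2` because `η` dominates `(K + 6 c + 1) σ`. -/
lemma deviation_norm_arith {c A K s σ r a D D' η : ℝ} (hc : 0 < c) (hA : 0 ≤ A) (hK : 0 ≤ K)
    (hs : 0 ≤ s) (hsσ : s ≤ σ) (hr0 : 0 ≤ r) (hr : r ≤ 2 * K * σ) (ha : 0 ≤ a)
    (h1 : |D' - a| ≤ a / 16 + (16 * c ^ 2 + 2 * c) * s ^ 2) (h2 : |D - D'| ≤ (r ^ 2 + D') / 8)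
    (hη : (2 + 8 * A + 4 * K + 6 * c) * σ ≤ η) : |D - a| ≤ 1 / 2 * (a + η ^ 2) := by
  have hσ0 : 0 ≤ σ := hs.trans hsσ
  have hrr : r ^ 2 ≤ (2 * K * σ) ^ 2 := by gcongr
  have hη2 : ((K + (6 * c + 1)) * σ) ^ 2 ≤ η ^ 2 := by
    have : (K + (6 * c + 1)) * σ ≤ η :=
      (mul_le_mul_of_nonneg_right (by linarith) hσ0).trans hη
    gcongr
  have hE : 9 / 4 * (16 * c ^ 2 + 2 * c) * s ^ 2 ≤ (6 * c + 1) ^ 2 * σ ^ 2 := by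
    gcongr
    nlinarith
  have hE0 : 0 ≤ (16 * c ^ 2 + 2 * c) * s ^ 2 := by positivity
  have hcross : 0 ≤ 2 * (K * (6 * c + 1)) * σ ^ 2 := by positivity
  have e1 : ((K + (6 * c + 1)) * σ) ^ 2
      = K ^ 2 * σ ^ 2 + (6 * c + 1) ^ 2 * σ ^ 2 + 2 * (K * (6 * c + 1)) * σ ^ 2 := by ring
  have e2 : (2 * K * σ) ^ 2 = 4 * (K ^ 2 * σ ^ 2) := by ring
  rw [e1] at hη2
  rw [e2] at hrr
  obtain ⟨b3, b4⟩ := abs_le.1 h1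
  obtain ⟨b5, b6⟩ := abs_le.1 h2
  have : 0 ≤ r ^ 2 := sq_nonneg r
  rw [abs_le]
  constructor <;> linarith

/-- The truncated pooled norm `M` is of order `r + √a + s`. The increment bound `2 A M ρ` therefore
splits into a multiple of `σ √a` and a multiple of `σ ^ 2`, matching `η √a + η ^ 2`. -/
lemma deviation_mean_arith {c A K s σ ρ r a P m m' D D' M η : ℝ} (hc : 0 < c) (hA : 0 ≤ A)
    (hK : 0 ≤ K) (hs : 0 ≤ s) (hsσ : s ≤ σ) (hρ0 : 0 ≤ ρ) (hρ : ρ ≤ 2 * σ)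
    (hr0 : 0 ≤ r) (hr : r ≤ 2 * K * σ) (ha : 0 ≤ a) (hM0 : 0 ≤ M)
    (hM : M ^ 2 ≤ r ^ 2 + (D + D') / 2)
    (h1 : |D' - a| ≤ a / 16 + (16 * c ^ 2 + 2 * c) * s ^ 2) (h2 : |D - D'| ≤ (r ^ 2 + D') / 8)
    (h3 : |m - m'| ≤ 2 * A * M * ρ) (h4 : |m' - P| ≤ 2 * (√a + s) * s)
    (hη : (2 + 8 * A + 4 * K + 6 * c) * σ ≤ η) : |m - P| ≤ η * (√a + η) := by
  have hσ0 : 0 ≤ σ := hs.trans hsσ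
  have hsa := Real.sq_sqrt ha
  have hsa0 := Real.sqrt_nonneg a
  have hMM : M ≤ 2 * r + 2 * √a + (8 * c + 2) * s := by
    rw [← sq_le_sq₀ hM0 (by positivity)]
    obtain ⟨b3, b4⟩ := abs_le.1 h1
    obtain ⟨b5, b6⟩ := abs_le.1 h2
    have hE0 : 0 ≤ (16 * c ^ 2 + 2 * c) * s ^ 2 := by positivity
    have hr2 : 0 ≤ r ^ 2 := sq_nonneg r
    have e1 : M ^ 2 ≤ 2 * r ^ 2 + 2 * a + 2 * ((16 * c ^ 2 + 2 * c) * s ^ 2) := by linarith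
    have e2 : 2 * ((16 * c ^ 2 + 2 * c) * s ^ 2) ≤ ((8 * c + 2) * s) ^ 2 := by
      have : 2 * (16 * c ^ 2 + 2 * c) ≤ (8 * c + 2) ^ 2 := by nlinarith
      calc _ = 2 * (16 * c ^ 2 + 2 * c) * s ^ 2 := by ring
        _ ≤ (8 * c + 2) ^ 2 * s ^ 2 := by gcongr
        _ = _ := by ring
    have e3 : 0 ≤ (2 * r) * (2 * √a) := by positivity
    have e4 : 0 ≤ (2 * r) * ((8 * c + 2) * s) := by positivity
    have e5 : 0 ≤ (2 * √a) * ((8 * c + 2) * s) := by positivity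
    have e6 : (2 * r + 2 * √a + (8 * c + 2) * s) ^ 2 = 4 * r ^ 2 + 4 * √a ^ 2 + ((8 * c + 2) * s) ^ 2
        + 2 * ((2 * r) * (2 * √a)) + 2 * ((2 * r) * ((8 * c + 2) * s))
        + 2 * ((2 * √a) * ((8 * c + 2) * s)) := by ring
    rw [e6, hsa]
    linarith
  have e1 : |m - P| ≤ 2 * A * M * ρ + 2 * (√a + s) * s :=
    (abs_sub_le m m' P).trans (add_le_add h3 h4)
  have e2 : 2 * A * M * ρ ≤ 2 * A * (2 * (2 * K * σ) + 2 * √a + (8 * c + 2) * σ) * (2 * σ) := by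
    have : M ≤ 2 * (2 * K * σ) + 2 * √a + (8 * c + 2) * σ := hMM.trans (by gcongr)
    gcongr
  have e3 : 2 * (√a + s) * s ≤ 2 * (√a + σ) * σ := by gcongr
  have e4 : (2 + 8 * A) * σ * √a ≤ η * √a := by
    gcongr
    exact (mul_le_mul_of_nonneg_right (by linarith) hσ0).trans hη
  have e5 : (2 + 16 * (A * K) + 32 * (A * c) + 8 * A) * σ ^ 2 ≤ η ^ 2 := by
    have h5 : (2 + 8 * A + 4 * K + 6 * c) ^ 2 * σ ^ 2 ≤ η ^ 2 := by
      rw [← mul_pow]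
      gcongr
    refine le_trans ?_ h5
    gcongr
    have q1 := mul_nonneg hA hK
    have q2 := mul_nonneg hA hc.le
    have q3 := mul_nonneg hK hc.le
    have q4 : (2 + 8 * A + 4 * K + 6 * c) ^ 2 = 4 + 64 * A ^ 2 + 16 * K ^ 2 + 36 * c ^ 2 + 32 * A
      + 16 * K + 24 * c + 64 * (A * K) + 96 * (A * c) + 48 * (K * c) := by ring
    rw [q4]
    linarith [sq_nonneg A, sq_nonneg K, sq_nonneg c]
  have e6 : 2 * A * (2 * (2 * K * σ) + 2 * √a + (8 * c + 2) * σ) * (2 * σ) + 2 * (√a + σ) * σ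
      = (2 + 8 * A) * σ * √a + (2 + 16 * (A * K) + 32 * (A * c) + 8 * A) * σ ^ 2 := by ring
  calc |m - P| ≤ _ := e1.trans (add_le_add e2 e3)
    _ = _ := e6
    _ ≤ η * √a + η ^ 2 := add_le_add e4 e5
    _ = _ := by ring

end UniformDeviation

end

noncomputable section

/-! ### Ghost samples by Chebyshev's inequality, and the passage from increments to deviations. -/

section UniformDeviationProb

variable {T : ℕ} {W : Type u} {Ω : Type*} [MeasurableSpace W] [MeasurableSpace Ω]
  {S : Finset (Fin T)} {V : Ω → W} {μ : Measure W} {m : Fin T → Measure Ω}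

lemma measurable_evalOn (hV : Measurable V) {f : W → ℝ} (hf : Measurable f) (t : Fin T) :
    Measurable (evalOn S V f t) := by
  unfold evalOn
  split_ifs
  · exact hf.comp hV
  · exact measurable_const

lemma integral_evalOn (hV : Measurable V) (hmap : ∀ t ∈ S, (m t).map V = μ)
    {f : W → ℝ} (hf : Measurable f) (t : Fin T) :
    ∫ x, evalOn S V f t x ∂m t = if t ∈ S then ∫ w, f w ∂μ else 0 := by
  unfold evalOn
  split_ifs with h
  · rw [← hmap t h, integral_map hV.aemeasurable hf.aestronglyMeasurable]
  · simp

/-- Chebyshev's inequality for the average over the recorded trials. -/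
lemma prob_empMean_deviation_le [∀ t, IsProbabilityMeasure (m t)] (hV : Measurable V)
    (hmap : ∀ t ∈ S, (m t).map V = μ) (hS : S.Nonempty) {f : W → ℝ} (hf : Measurable f) {c : ℝ}
    (hbd : ∀ᵐ w ∂μ, |f w| ≤ c) {κ : ℝ} (hκ : 0 < κ) :
    Measure.pi m {w | κ ≤ |empMean (obsSample S V w) f - ∫ w, f w ∂μ|}
      ≤ ENNReal.ofReal ((∫ w, f w ^ 2 ∂μ) / (S.card * κ ^ 2)) := by
  have hn : (0 : ℝ) < S.card := by exact_mod_cast hS.card_pos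
  have hc0 : ∀ t, ∀ᵐ x ∂m t, ‖evalOn S V f t x‖ ≤ |c| := by
    intro t
    unfold evalOn
    split_ifs with h
    · rw [← hmap t h] at hbd
      filter_upwards [ae_of_ae_map hV.aemeasurable hbd] with x hx
      exact hx.trans (le_abs_self c)
    · simp
  have hL2 : ∀ t, MemLp (evalOn S V f t) 2 (m t) := fun t =>
    MemLp.of_bound (measurable_evalOn hV hf t).aestronglyMeasurable _ (hc0 t)
  set X : (Fin T → Ω) → ℝ := ∑ t, fun w => evalOn S V f t (w t) with hX
  have hXL2 : MemLp X 2 (Measure.pi m) := memLp_finsetSum' _ fun t _ =>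
    (hL2 t).comp_measurePreserving (measurePreserving_eval m t)
  have hvar : variance X (Measure.pi m) ≤ S.card * ∫ w, f w ^ 2 ∂μ := by
    rw [hX, variance_sum_pi hL2]
    calc ∑ t, variance (evalOn S V f t) (m t)
        ≤ ∑ t, if t ∈ S then ∫ w, f w ^ 2 ∂μ else 0 := by
          refine Finset.sum_le_sum fun t _ => ?_
          rw [← integral_evalOn hV hmap (hf.pow_const 2) t]
          refine (variance_le_expectation_sq
            (measurable_evalOn hV hf t).aestronglyMeasurable).trans (le_of_eq ?_)
          refine integral_congr_ae (ae_of_all _ fun x => ?_)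
          simp only [evalOn_sq, Pi.pow_apply]
      _ = _ := by simp
  have hmean : ∫ w, X w ∂Measure.pi m = S.card * ∫ w, f w ∂μ := by
    simp only [hX, Finset.sum_apply]
    rw [integral_finsetSum]
    · calc ∑ t, ∫ w, evalOn S V f t (w t) ∂Measure.pi m = ∑ t, if t ∈ S then ∫ w, f w ∂μ else 0 := by
            refine Finset.sum_congr rfl fun t _ => ?_
            rw [integral_comp_eval (μ := m) (f := evalOn S V f t)
              (measurable_evalOn hV hf t).aestronglyMeasurable, integral_evalOn hV hmap hf]
        _ = _ := by simp
    · intro t _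
      exact ((hL2 t).comp_measurePreserving (measurePreserving_eval m t)).integrable one_le_two
  have hcheb := meas_ge_le_variance_div_sq hXL2 (c := S.card * κ) (by positivity)
  have hset : {w | κ ≤ |empMean (obsSample S V w) f - ∫ w, f w ∂μ|}
      = {w | S.card * κ ≤ |X w - ∫ w, X w ∂Measure.pi m|} := by
    ext w
    simp only [Set.mem_ofPred_eq]
    rw [hmean, empMean_obsSample, hX, Finset.sum_apply]
    have : (∑ t, evalOn S V f t (w t)) / S.card - ∫ w, f w ∂μ
        = (∑ t, evalOn S V f t (w t) - S.card * ∫ w, f w ∂μ) / S.card := by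
      field_simp
    rw [this, abs_div, abs_of_pos hn, le_div_iff₀ hn, mul_comm]
  rw [hset]
  refine hcheb.trans (ENNReal.ofReal_le_ofReal ?_)
  calc variance X (Measure.pi m) / (S.card * κ) ^ 2
      ≤ (S.card * ∫ w, f w ^ 2 ∂μ) / (S.card * κ) ^ 2 := by gcongr
    _ = _ := by field_simp

/-- A ghost sample has mean and second moment close to those of `μ` with probability at least
`1/2`. -/
lemma half_le_prob_ghost [IsProbabilityMeasure μ] [∀ t, IsProbabilityMeasure (m t)]
    (hV : Measurable V)
    (hmap : ∀ t ∈ S, (m t).map V = μ) (hS : S.Nonempty) {f : W → ℝ} (hf : Measurable f) {c s : ℝ}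
    (hc : 0 < c) (hbd : ∀ᵐ w ∂μ, |f w| ≤ c) (hs : 0 < s) (hns : 1 ≤ S.card * s ^ 2) :
    (2 : ENNReal)⁻¹ ≤ Measure.pi m {w | |empMean (obsSample S V w) f - ∫ w, f w ∂μ|
        ≤ 2 * (√(∫ w, f w ^ 2 ∂μ) + s) * s ∧
      |empMean (obsSample S V w) (fun w => f w ^ 2) - ∫ w, f w ^ 2 ∂μ|
        ≤ 2 * c * (√(∫ w, f w ^ 2 ∂μ) + s) * s} := by
  set a := ∫ w, f w ^ 2 ∂μ with ha
  have ha0 : 0 ≤ a := integral_nonneg fun w => sq_nonneg _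
  have hn : (0 : ℝ) < S.card := by exact_mod_cast hS.card_pos
  have hsa := Real.sqrt_nonneg a
  have hasq := Real.sq_sqrt ha0
  have hkey : a ≤ (√a + s) ^ 2 * (S.card * s ^ 2) := by
    calc a ≤ (√a + s) ^ 2 * 1 := by nlinarith
      _ ≤ _ := by gcongr
  have h1 := prob_empMean_deviation_le hV hmap hS hf hbd (κ := 2 * (√a + s) * s) (by positivity)
  have h2 := prob_empMean_deviation_le hV hmap hS (hf.pow_const 2) (c := c ^ 2)
    (by filter_upwards [hbd] with w hw; rw [abs_pow]; gcongr) (κ := 2 * c * (√a + s) * s)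
    (by positivity)
  have hint : Integrable (fun w => f w ^ 2) μ :=
    Integrable.of_bound (hf.pow_const 2).aestronglyMeasurable (c ^ 2) (by
      filter_upwards [hbd] with w hw
      rw [norm_pow, Real.norm_eq_abs]; gcongr)
  have h4 : ∫ w, (f w ^ 2) ^ 2 ∂μ ≤ c ^ 2 * a := by
    rw [ha, ← integral_const_mul]
    refine integral_mono_of_nonneg (ae_of_all _ fun w => by positivity) (hint.const_mul _) ?_
    filter_upwards [hbd] with w hw
    have : f w ^ 2 ≤ c ^ 2 := by rw [← sq_abs]; gcongr
    have h0 := sq_nonneg (f w)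
    nlinarith
  -- The thresholds are chosen so that each of the two Chebyshev bounds fails with probability at
  -- most `1/4`; this is where `1 ≤ n s ^ 2` enters.
  have b1 : a / (S.card * (2 * (√a + s) * s) ^ 2) ≤ 1 / 4 := by
    rw [div_le_iff₀ (by positivity)]
    calc a ≤ _ := hkey
      _ = _ := by ring
  have b2 : (∫ w, (f w ^ 2) ^ 2 ∂μ) / (S.card * (2 * c * (√a + s) * s) ^ 2) ≤ 1 / 4 := by
    rw [div_le_iff₀ (by positivity)]
    calc _ ≤ c ^ 2 * a := h4
      _ ≤ c ^ 2 * ((√a + s) ^ 2 * (S.card * s ^ 2)) := by gcongr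
      _ = _ := by ring
  set B1 := {w | 2 * (√a + s) * s ≤ |empMean (obsSample S V w) f - ∫ w, f w ∂μ|}
  set B2 := {w | 2 * c * (√a + s) * s
    ≤ |empMean (obsSample S V w) (fun w => f w ^ 2) - ∫ w, f w ^ 2 ∂μ|}
  set G := {w | |empMean (obsSample S V w) f - ∫ w, f w ∂μ| ≤ 2 * (√a + s) * s ∧
      |empMean (obsSample S V w) (fun w => f w ^ 2) - a| ≤ 2 * c * (√a + s) * s}
  have hcover : (Set.univ : Set (Fin T → Ω)) ⊆ G ∪ (B1 ∪ B2) := by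
    intro w _
    by_contra hcon
    simp only [Set.mem_union, not_or] at hcon
    exact hcon.1 ⟨(not_le.1 hcon.2.1).le, (not_le.1 hcon.2.2).le⟩
  have hB : Measure.pi m (B1 ∪ B2) ≤ 2⁻¹ := by
    calc _ ≤ Measure.pi m B1 + Measure.pi m B2 := measure_union_le _ _
      _ ≤ ENNReal.ofReal (1 / 4) + ENNReal.ofReal (1 / 4) :=
          add_le_add (h1.trans (ENNReal.ofReal_le_ofReal b1)) (h2.trans (ENNReal.ofReal_le_ofReal b2))
      _ = 2⁻¹ := by
          rw [← ENNReal.ofReal_add (by norm_num) (by norm_num), ← ENNReal.ofReal_ofNat,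
            ← ENNReal.ofReal_inv_of_pos (by norm_num)]
          norm_num
  have h3 : (1 : ENNReal) ≤ Measure.pi m G + 2⁻¹ := by
    calc (1 : ENNReal) = Measure.pi m Set.univ := measure_univ.symm
      _ ≤ Measure.pi m (G ∪ (B1 ∪ B2)) := measure_mono hcover
      _ ≤ Measure.pi m G + Measure.pi m (B1 ∪ B2) := measure_union_le _ _
      _ ≤ _ := by gcongr
  rw [← ENNReal.inv_two_add_inv_two] at h3
  exact (ENNReal.add_le_add_iff_right (by simp)).1 h3

/-- A function that satisfies the increment bounds of the good event, and whose ghost moments are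
close to the population ones, does not deviate. -/
lemma not_deviates_of_increments {𝓠 : Set (W → ℝ)} (hstar : StarConvex ℝ 0 𝓠) {c s ρ δ : ℝ}
    (hc : 0 < c) (hs : 0 ≤ s) (hδ : 0 ≤ δ) (hρ0 : 0 < ρ) (hρ : ρ ≤ 2 * (δ + s))
    {d d' : Fin T → Option W}
    (hinc : ∀ g ∈ 𝓠, (empMean d (fun w => g w ^ 2) + empMean d' (fun w => g w ^ 2)) / 2
        < (128 * (16 + 108 * c) * ρ) ^ 2 →
      |empMean d g - empMean d' g| ≤ (16 / c + 108) * (128 * (16 + 108 * c) * ρ * ρ) ∧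
      |empMean d (fun w => g w ^ 2) - empMean d' (fun w => g w ^ 2)|
        ≤ 2 * c * ((16 / c + 108) * (128 * (16 + 108 * c) * ρ * ρ)))
    {f : W → ℝ} (hf : f ∈ 𝓠)
    (h1 : |empMean d' f - ∫ w, f w ∂μ| ≤ 2 * (√(∫ w, f w ^ 2 ∂μ) + s) * s)
    (h2 : |empMean d' (fun w => f w ^ 2) - ∫ w, f w ^ 2 ∂μ|
      ≤ 2 * c * (√(∫ w, f w ^ 2 ∂μ) + s) * s) :
    ¬ Deviates μ d f (devConst c * (δ + s)) := by
  set A := 16 / c + 108 with hA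
  set K := 128 * (16 + 108 * c) with hK
  have hA0 : 0 < A := by positivity
  have hK0 : 0 < K := by positivity
  have hKA : K = 128 * (c * A) := by rw [hK, hA]; field_simp
  set r := K * ρ with hr
  have hr0 : 0 < r := by positivity
  have hmean0 : ∀ (d : Fin T → Option W) (g : W → ℝ), 0 ≤ empMean d (fun w => g w ^ 2) := by
    intro d g
    unfold empMean
    refine div_nonneg (Finset.sum_nonneg fun t _ => ?_) (Nat.cast_nonneg _)
    cases d t <;> simp
    positivity
  have hsmul : ∀ (d : Fin T → Option W) (b : ℝ) (g : W → ℝ),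
      empMean d (fun w => b * g w) = b * empMean d g := by
    intro d b g
    unfold empMean
    rw [← mul_div_assoc, Finset.mul_sum]
    congr 1
    refine Finset.sum_congr rfl fun t _ => ?_
    cases d t <;> simp
  set D := empMean d (fun w => f w ^ 2) with hD
  set D' := empMean d' (fun w => f w ^ 2) with hD'
  have hD0 : 0 ≤ D := hmean0 d f
  have hD'0 : 0 ≤ D' := hmean0 d' f
  set p := (D + D') / 2 with hp
  have hp0 : 0 ≤ p := by positivity
  -- Functions of large norm are handled by rescaling: `r / (2 M) • f` has pooled norm at most `r /
  -- 2`, strictly inside the localization, and lies in the star-shaped class.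
  set M := max r (√p) with hM
  have hMr : r ≤ M := le_max_left _ _
  have hM0 : 0 < M := hr0.trans_le hMr
  have hMsq : M ^ 2 ≤ r ^ 2 + p := by
    rcases max_cases r (√p) with ⟨h, _⟩ | ⟨h, _⟩
    · rw [hM, h]; linarith
    · rw [hM, h, Real.sq_sqrt hp0]; linarith [sq_nonneg r]
  have hpM : p ≤ M ^ 2 := by
    calc p = √p ^ 2 := (Real.sq_sqrt hp0).symm
      _ ≤ M ^ 2 := by gcongr; exact le_max_right _ _
  set b := r / (2 * M) with hb
  have hb0 : 0 < b := by positivity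
  have hb1 : b ≤ 1 := by rw [hb, div_le_one (by positivity)]; linarith
  have hg := hstar.smul_mem hf hb0.le hb1
  have hgsq : ∀ d : Fin T → Option W, empMean d (fun w => (b • f) w ^ 2)
      = b ^ 2 * empMean d (fun w => f w ^ 2) := by
    intro d
    rw [← hsmul]
    simp only [Pi.smul_apply, smul_eq_mul, mul_pow]
  have hgm : ∀ d : Fin T → Option W, empMean d (b • f) = b * empMean d f := fun d => hsmul d b f
  have hpg : (b ^ 2 * D + b ^ 2 * D') / 2 < r ^ 2 := by
    have e : (b ^ 2 * D + b ^ 2 * D') / 2 = b ^ 2 * p := by rw [hp]; ring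
    rw [e]
    calc b ^ 2 * p ≤ b ^ 2 * M ^ 2 := by gcongr
      _ = r ^ 2 / 4 := by rw [hb]; field_simp; norm_num
      _ < r ^ 2 := by nlinarith [sq_pos_of_pos hr0]
  have hi := hinc _ hg (by rw [hgsq, hgsq]; exact hpg)
  rw [hgsq, hgsq, hgm, hgm, ← mul_sub, ← mul_sub, abs_mul, abs_mul, abs_of_pos hb0,
    abs_of_pos (by positivity : 0 < b ^ 2)] at hi
  obtain ⟨hi1, hi2⟩ := hi
  have hi1' : |empMean d f - empMean d' f| ≤ 2 * A * M * ρ := by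
    refine le_of_mul_le_mul_left (hi1.trans (le_of_eq ?_)) hb0
    rw [hb]; field_simp
  have hi2' : |D - D'| ≤ M ^ 2 / 16 := by
    refine le_of_mul_le_mul_left (hi2.trans (le_of_eq ?_)) (by positivity : 0 < b ^ 2)
    have e : b ^ 2 * (M ^ 2 / 16) = r * (K * ρ) / 64 := by rw [hb, ← hr]; field_simp; norm_num
    rw [e, hKA]; ring
  have ha0 : 0 ≤ ∫ w, f w ^ 2 ∂μ := integral_nonneg fun w => sq_nonneg _
  obtain ⟨g1, g2⟩ := ghost_norm_arith ha0 (by rw [← hp]; exact hMsq) hi2' h2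
  have hη : (2 + 8 * A + 4 * K + 6 * c) * (δ + s) ≤ devConst c * (δ + s) := le_of_eq rfl
  have hr2 : r ≤ 2 * K * (δ + s) := by
    calc r = K * ρ := rfl
      _ ≤ K * (2 * (δ + s)) := by gcongr
      _ = _ := by ring
  rw [Deviates, not_not]
  exact ⟨deviation_mean_arith hc hA0.le hK0.le hs (by linarith) hρ0.le hρ hr0.le hr2 ha0 hM0.le
    (by rw [← hp]; exact hMsq) g1 g2 hi1' h1 hη,
    deviation_norm_arith hc hA0.le hK0.le hs (by linarith) hr0.le hr2 ha0 g1 g2 hη⟩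

end UniformDeviationProb

end

noncomputable section

/-! ### Peeling over dyadic radii and the uniform bound for a fixed set of recorded trials. -/

section UniformDeviationMain

/-- The levels `2 ^ j * s` form a countable grid independent of the data, so a union bound over them
covers every random radius `δ` at the cost of a factor `2` and an additive `s`. -/
lemma exists_dyadic_level {δ s : ℝ} (hs : 0 < s) (hδ : 0 ≤ δ) :
    ∃ j : ℕ, δ ≤ 2 ^ j * s ∧ 2 ^ j * s ≤ 2 * (δ + s) := by
  have hex : ∃ j : ℕ, δ ≤ 2 ^ j * s := by
    obtain ⟨j, hj⟩ := pow_unbounded_of_one_lt (δ / s) (one_lt_two : (1 : ℝ) < 2)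
    exact ⟨j, ((div_lt_iff₀ hs).1 hj).le⟩
  classical
  refine ⟨Nat.find hex, Nat.find_spec hex, ?_⟩
  rcases h : Nat.find hex with _ | k
  · simp; linarith
  · have := Nat.find_min hex (m := k) (by omega)
    rw [pow_succ]
    linarith

/-- The peeling costs only a constant: as `4 ^ j ≥ j + 1`, the doubly exponential tail is dominated
by a geometric series in `x ≤ 1/2`. -/
lemma tsum_exp_four_pow_le {x ℓ : ℝ} (hx0 : 0 < x) (hx : x ≤ 1 / 2) (hℓ : Real.exp (-ℓ) = x)
    (hℓ0 : 0 ≤ ℓ) :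
    ∑' j : ℕ, ENNReal.ofReal (8 * Real.exp (-(4 ^ j * ℓ))) ≤ ENNReal.ofReal (16 * x) := by
  have hle : ∀ j : ℕ, 8 * Real.exp (-(4 ^ j * ℓ)) ≤ 8 * x * x ^ j := by
    intro j
    have h1 : ((j : ℝ) + 1) ≤ 4 ^ j := by
      have := one_add_mul_le_pow (a := (3 : ℝ)) (by norm_num) j
      norm_num at this
      have hj : (0 : ℝ) ≤ j := Nat.cast_nonneg _
      linarith
    have h2 : Real.exp (-(4 ^ j * ℓ)) ≤ x ^ (j + 1) := by
      rw [← hℓ, ← Real.exp_nat_mul]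
      apply Real.exp_le_exp.2
      push_cast
      nlinarith
    rw [pow_succ] at h2
    linarith
  have hx1 : x < 1 := by linarith
  calc _ ≤ ∑' j : ℕ, ENNReal.ofReal (8 * x * x ^ j) :=
        ENNReal.tsum_le_tsum fun j => ENNReal.ofReal_le_ofReal (hle j)
    _ = ENNReal.ofReal (∑' j : ℕ, 8 * x * x ^ j) := by
        rw [ENNReal.ofReal_tsum_of_nonneg (fun j => by positivity)
          ((summable_geometric_of_lt_one hx0.le hx1).mul_left _)]
    _ ≤ _ := by
        rw [tsum_mul_left, tsum_geometric_of_lt_one hx0.le hx1]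
        apply ENNReal.ofReal_le_ofReal
        rw [← div_eq_mul_inv, div_le_iff₀ (by linarith)]
        nlinarith

variable {T : ℕ} {W : Type u} {Ω : Type*} [MeasurableSpace W] [MeasurableSpace Ω]
  {S : Finset (Fin T)} {V : Ω → W} {μ : Measure W} {m : Fin T → Measure Ω}

/-- Covers the empty sample, whose empirical means are `0` by convention. There `η ≥ max 1 c` makes
both inequalities trivial, from `|∫ f| ≤ √(∫ f ^ 2) ≤ c`. -/
lemma not_deviates_of_isEmpty [IsProbabilityMeasure μ] {f : W → ℝ} (hf : Measurable f) {c : ℝ}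
    (hc : 0 < c) (hbd : ∀ᵐ w ∂μ, |f w| ≤ c) {d : Fin T → Option W} (hd : ∀ g, empMean d g = 0) {η : ℝ}
    (h1 : 1 ≤ η) (h2 : c ≤ η) : ¬ Deviates μ d f η := by
  have hint : Integrable f μ := Integrable.of_bound hf.aestronglyMeasurable c hbd
  have hint2 : MemLp f 2 μ := MemLp.of_bound hf.aestronglyMeasurable c hbd
  have ha0 : 0 ≤ ∫ w, f w ^ 2 ∂μ := integral_nonneg fun w => sq_nonneg _
  have hvar : (∫ w, f w ∂μ) ^ 2 ≤ ∫ w, f w ^ 2 ∂μ := by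
    have h := variance_eq_sub hint2
    have h0 := variance_nonneg f μ
    simp only [Pi.pow_apply] at h
    linarith
  have hac : ∫ w, f w ^ 2 ∂μ ≤ c ^ 2 := by
    calc ∫ w, f w ^ 2 ∂μ ≤ ∫ _w, c ^ 2 ∂μ := by
          refine integral_mono_of_nonneg (ae_of_all _ fun w => sq_nonneg _) (integrable_const _) ?_
          filter_upwards [hbd] with w hw
          rw [← sq_abs]; gcongr
      _ = c ^ 2 := by simp
  rw [Deviates, not_not, hd, hd, zero_sub, zero_sub, abs_neg, abs_neg, abs_of_nonneg ha0]
  have hs := Real.sqrt_nonneg (∫ w, f w ^ 2 ∂μ)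
  constructor
  · have : |∫ w, f w ∂μ| ≤ √(∫ w, f w ^ 2 ∂μ) := Real.abs_le_sqrt hvar
    nlinarith
  · nlinarith

/-- Uniform deviation bound: with probability at least `1 - ξ`, whatever the critical radius of the
sample, no function of the class deviates. -/
theorem measure_exists_deviates_le [IsProbabilityMeasure μ] [∀ t, IsProbabilityMeasure (m t)]
    (hV : Measurable V) (hmap : ∀ t ∈ S, (m t).map V = μ) {𝓠 : Set (W → ℝ)}
    (hstar : StarConvex ℝ 0 𝓠) (hne : 𝓠.Nonempty) (hmeas : ∀ f ∈ 𝓠, Measurable f)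
    (hsep : PointwiseSeparable 𝓠) {c : ℝ} (hc : 0 < c) (hbd : ∀ᵐ w ∂μ, ∀ f ∈ 𝓠, |f w| ≤ c)
    {ξ : ℝ} (hξ0 : 0 < ξ) (hξ1 : ξ < 1) :
    Measure.pi m {w | ∃ δ, IsCriticalRadius (obsSample S V w) 𝓠 c δ ∧ ∃ f ∈ 𝓠,
      Deviates μ (obsSample S V w) f
        (devConst c * (δ + √(Real.log (32 / ξ) / (max S.card 1 : ℕ))))} ≤ ENNReal.ofReal ξ := by
  have hlog : 1 ≤ Real.log (32 / ξ) := by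
    rw [Real.le_log_iff_exp_le (by positivity)]
    have h1 : (32 : ℝ) ≤ 32 / ξ := by rw [le_div_iff₀ hξ0]; linarith
    have := Real.exp_one_lt_d9
    linarith
  set ℓ := Real.log (32 / ξ) with hℓ
  rcases S.eq_empty_or_nonempty with rfl | hS
  · refine le_trans (le_of_eq ?_) (zero_le (a := ENNReal.ofReal ξ))
    convert measure_empty (μ := Measure.pi m)
    rw [Set.eq_empty_iff_forall_notMem]
    rintro w ⟨δ, ⟨hδ0, -⟩, f, hf, hdev⟩
    have hs : 1 ≤ √(ℓ / (max (∅ : Finset (Fin T)).card 1 : ℕ)) := by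
      rw [Real.one_le_sqrt]; simpa using hlog
    have hA : 0 < 16 / c + 108 := by positivity
    have hbig : 2 + 6 * c ≤ devConst c * (δ + √(ℓ / (max (∅ : Finset (Fin T)).card 1 : ℕ))) := by
      have h1 : 2 + 6 * c ≤ devConst c := by
        unfold devConst
        have : 0 < 4 * (128 * (16 + 108 * c)) := by positivity
        linarith
      calc 2 + 6 * c ≤ devConst c * 1 := by linarith
        _ ≤ _ := by
          have : 0 ≤ devConst c := by linarith
          gcongr
          linarith
    refine not_deviates_of_isEmpty (hmeas f hf) hc
      (by filter_upwards [hbd] with w hw using hw f hf) (fun g => ?_) ?_ ?_ hdev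
    · rw [empMean_obsSample]; simp
    · linarith
    · linarith
  have hn1 : 1 ≤ S.card := hS.card_pos
  have hn : (0 : ℝ) < S.card := by exact_mod_cast hn1
  rw [max_eq_left hn1]
  set s := √(ℓ / S.card) with hs
  have hs0 : 0 < s := Real.sqrt_pos.2 (by positivity)
  have hns : S.card * s ^ 2 = ℓ := by
    rw [hs, Real.sq_sqrt (by positivity)]; field_simp
  have h0mem : (0 : W → ℝ) ∈ 𝓠 := by
    obtain ⟨f, hf⟩ := hne
    simpa using hstar.smul_mem hf le_rfl zero_le_one
  obtain ⟨F₀, hF, hFc, hF0, hd⟩ := hsep.exists_countable_zero_mem h0mem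
  have : Countable F₀ := hFc.to_subtype
  set e : F₀ → Fin T → Ω → ℝ := fun f => evalOn S V f.1 with he
  have he0 : ∀ t x, e ⟨0, hF0⟩ t x = 0 := fun t x => by simp [he, evalOn]
  have hem : ∀ f t, Measurable (e f t) := fun f t => measurable_evalOn hV (hmeas _ (hF f.2)) t
  have hebd : ∀ t, ∀ᵐ x ∂m t, ∀ f, |e f t x| ≤ c := by
    intro t
    by_cases ht : t ∈ S
    · have hb := hbd
      rw [← hmap t ht] at hb
      filter_upwards [ae_of_ae_map hV.aemeasurable hb] with x hx f
      exact abs_evalOn_le hc.le (hx _ (hF f.2)) t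
    · filter_upwards with x f
      simp [he, evalOn, ht, hc.le]
  set K := 128 * (16 + 108 * c) with hK
  have hK1 : 1 ≤ K := by rw [hK]; linarith
  -- At level `j` the deviation parameter is `n ρ_j ^ 2 = 4 ^ j ℓ`. Two bad events of probability `4
  -- exp (-4 ^ j ℓ)`, for the means and the second moments, then sum to at most `16 * ξ / 32 = ξ /
  -- 2`.
  set ρ : ℕ → ℝ := fun j => 2 ^ j * s with hρ
  have hρ0 : ∀ j, 0 < ρ j := fun j => by positivity
  have htau : ∀ j, S.card * ρ j ^ 2 = 4 ^ j * ℓ := by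
    intro j
    have : (4 : ℝ) ^ j = (2 ^ j) ^ 2 := by rw [← pow_mul, mul_comm, pow_mul]; norm_num
    rw [hρ, this, ← hns]; ring
  have htau1 : ∀ j, 1 ≤ S.card * ρ j ^ 2 := by
    intro j
    rw [htau]
    have : (1 : ℝ) ≤ 4 ^ j := one_le_pow₀ (by norm_num)
    nlinarith
  set G₁ : ℕ → Set ((Fin T → Ω) × (Fin T → Ω)) := fun j =>
    {q | PoolBad e (fun x => x) 1 (K * ρ j * √S.card) (S.card * ρ j ^ 2) q} with hG₁
  set G₂ : ℕ → Set ((Fin T → Ω) × (Fin T → Ω)) := fun j =>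
    {q | PoolBad e (fun x => x ^ 2) (2 * c) (K * ρ j * √S.card) (S.card * ρ j ^ 2) q} with hG₂
  set G := ⋃ j, (G₁ j ∪ G₂ j) with hG
  set PP := (Measure.pi m).prod (Measure.pi m) with hPP
  have hG₁le : ∀ j, PP (G₁ j) ≤ ENNReal.ofReal (4 * Real.exp (-(4 ^ j * ℓ))) := by
    intro j
    have := measure_poolBad_le m he0 hem (φ := fun x => x) (l := 1) zero_le_one hebd measurable_id rfl
      (fun x y _ _ => by simp) (Q := K * ρ j * √S.card)
      (by have := hρ0 j; positivity) (htau1 j)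
    rw [htau] at this
    simpa only [hG₁, htau] using this
  have hG₂le : ∀ j, PP (G₂ j) ≤ ENNReal.ofReal (4 * Real.exp (-(4 ^ j * ℓ))) := by
    intro j
    have := measure_poolBad_le m he0 hem (φ := fun x => x ^ 2) (l := 2 * c) (by positivity) hebd
      (measurable_id.pow_const 2) (by norm_num)
      (fun x y hx hy => by
        have : x ^ 2 - y ^ 2 = (x + y) * (x - y) := by ring
        rw [this, abs_mul]
        gcongr
        exact (abs_add_le _ _).trans (by linarith)) (Q := K * ρ j * √S.card)
      (by have := hρ0 j; positivity) (htau1 j)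
    rw [htau] at this
    simpa only [hG₂, htau] using this
  have hexp : Real.exp (-ℓ) = ξ / 32 := by
    rw [Real.exp_neg, hℓ, Real.exp_log (by positivity), inv_div]
  have hGle : PP G ≤ ENNReal.ofReal (ξ / 2) := by
    calc PP G ≤ ∑' j, PP (G₁ j ∪ G₂ j) := measure_iUnion_le _
      _ ≤ ∑' j : ℕ, ENNReal.ofReal (8 * Real.exp (-(4 ^ j * ℓ))) := by
          refine ENNReal.tsum_le_tsum fun j => (measure_union_le _ _).trans ?_
          refine (add_le_add (hG₁le j) (hG₂le j)).trans ?_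
          rw [← ENNReal.ofReal_add (by positivity) (by positivity)]
          apply ENNReal.ofReal_le_ofReal
          linarith
      _ ≤ ENNReal.ofReal (16 * (ξ / 32)) :=
          tsum_exp_four_pow_le (by positivity) (by linarith) hexp (by linarith)
      _ = _ := by congr 1; ring
  set Bad := {w | ∃ δ, IsCriticalRadius (obsSample S V w) 𝓠 c δ ∧ ∃ f ∈ 𝓠,
    Deviates μ (obsSample S V w) f (devConst c * (δ + s))} with hBad
  set N := {w : Fin T → Ω | ¬ ∀ t ∈ S, ∀ f ∈ 𝓠, |f (V (w t))| ≤ c} with hN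
  have hN0 : Measure.pi m N = 0 := by
    have : ∀ᵐ w ∂Measure.pi m, ∀ t ∈ S, ∀ f ∈ 𝓠, |f (V (w t))| ≤ c := by
      rw [ae_all_iff]
      intro t
      by_cases ht : t ∈ S
      · have hb := hbd
        rw [← hmap t ht] at hb
        have := (Measure.quasiMeasurePreserving_eval m t).ae (ae_of_ae_map hV.aemeasurable hb)
        filter_upwards [this] with w hw _
        exact hw
      · exact ae_of_all _ fun w h => absurd h ht
    exact this
  -- For a bad sample, every ghost sample with moments near the population ones must fall in `G`,
  -- since outside `G` the deviating function could not deviate. Such ghosts have probability at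
  -- least `1/2`. The deviating function and `δ` may depend on `w` arbitrarily.
  have hghost : ∀ w ∈ Bad \ N, (2 : ENNReal)⁻¹ ≤ Measure.pi m {w' | (w, w') ∈ G} := by
    rintro w ⟨⟨δ, hδ, f, hf, hdev⟩, hwN⟩
    have hwb : ∀ f ∈ 𝓠, ∀ t ∈ S, |f (V (w t))| ≤ c := by
      rw [hN, Set.mem_ofPred_eq, not_not] at hwN
      exact fun f hf t ht => hwN t ht f hf
    refine (half_le_prob_ghost hV hmap hS (hmeas f hf) hc
      (by filter_upwards [hbd] with w hw using hw f hf) hs0 (by rw [hns]; exact hlog)).trans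
      (measure_mono ?_)
    rintro w' ⟨h1, h2⟩
    by_contra hcon
    obtain ⟨j, hj1, hj2⟩ := exists_dyadic_level hs0 hδ.1.le
    have hnot : (w, w') ∉ G₁ j ∧ (w, w') ∉ G₂ j := by
      refine ⟨fun h => hcon ?_, fun h => hcon ?_⟩
      · exact Set.mem_iUnion.2 ⟨j, Or.inl h⟩
      · exact Set.mem_iUnion.2 ⟨j, Or.inr h⟩
    have hρK : ρ j ≤ K * ρ j := by nlinarith [hρ0 j]
    refine not_deviates_of_increments hstar hc hs0.le hδ.1.le (hρ0 j) hj2 (fun g hg hpool => ?_)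
      hf h1 h2 hdev
    have i1 := abs_empMean_sub_le_of_not_poolBad hF hstar hF0 hd hc zero_le_one hS (w, w') hwb hδ hj1
      hρK continuous_id rfl hnot.1 hg hpool
    have i2 := abs_empMean_sub_le_of_not_poolBad hF hstar hF0 hd hc (by positivity) hS (w, w') hwb hδ
      hj1 hρK (continuous_pow 2) (by norm_num) hnot.2 hg hpool
    rw [one_mul] at i1
    exact ⟨i1, i2⟩
  calc Measure.pi m Bad ≤ Measure.pi m ((Bad \ N) ∪ N) := measure_mono (by simp)
    _ ≤ Measure.pi m (Bad \ N) + Measure.pi m N := measure_union_le _ _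
    _ = Measure.pi m (Bad \ N) := by rw [hN0, add_zero]
    _ ≤ 2 * PP G := measure_le_two_mul_prod _ hghost
    _ ≤ 2 * ENNReal.ofReal (ξ / 2) := by gcongr
    _ = ENNReal.ofReal ξ := by
        rw [← ENNReal.ofReal_ofNat, ← ENNReal.ofReal_mul (by norm_num)]
        congr 1; ring

end UniformDeviationMain

end

noncomputable section

/-! ### Random sample sizes -/

section Patterns

variable {T : ℕ} {W : Type u} {Ω : Type*} [MeasurableSpace W] [MeasurableSpace Ω]

lemma MeasureTheory.Measure.pi_smul_pi {ι : Type*} [Fintype ι] {α : ι → Type*}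
    [∀ i, MeasurableSpace (α i)] (m : ∀ i, Measure (α i)) [∀ i, SigmaFinite (m i)]
    (a : ι → NNReal) : Measure.pi (fun i => a i • m i) = (∏ i, a i) • Measure.pi m := by
  refine Measure.pi_eq fun s _ => ?_
  rw [Measure.smul_apply, Measure.pi_pi]
  simp only [Measure.smul_apply]
  simp only [ENNReal.smul_def, smul_eq_mul, Finset.prod_mul_distrib]
  push_cast
  rfl

open Classical in
/-- The sample that records `V` on the trials in the event `E`. -/
def eventSample (E : Set Ω) (V : Ω → W) (ω : Fin T → Ω) : Fin T → Option W :=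
  fun t => if ω t ∈ E then some (V (ω t)) else none

/-- Uniform deviation bound for a sample that records `V` on the trials in the event `E`. -/
theorem measure_eventSample_deviates_le (P : Measure Ω) [IsProbabilityMeasure P] {E : Set Ω}
    (hE : MeasurableSet E) {V : Ω → W} (hV : Measurable V) {μ : Measure W} [IsProbabilityMeasure μ]
    (hμ : μ = (P[|E]).map V) {𝓠 : Set (W → ℝ)}
    (hstar : StarConvex ℝ 0 𝓠) (hmeas : ∀ f ∈ 𝓠, Measurable f)
    (hsep : PointwiseSeparable 𝓠) {c : ℝ} (hc : 0 < c) (hbd : ∀ᵐ w ∂μ, ∀ f ∈ 𝓠, |f w| ≤ c)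
    {ξ : ℝ} (hξ0 : 0 < ξ) (hξ1 : ξ < 1) :
    Measure.pi (fun _ : Fin T => P) {ω | ∃ δ, IsCriticalRadius (eventSample E V ω) 𝓠 c δ ∧ ∃ f ∈ 𝓠,
      Deviates μ (eventSample E V ω) f (devConst c *
        (δ + √(Real.log (32 / ξ) / (max (sampleSize (eventSample E V ω)) 1 : ℕ))))}
      ≤ ENNReal.ofReal ξ := by
  classical
  rcases 𝓠.eq_empty_or_nonempty with rfl | hne
  · simp
  set PT := Measure.pi (fun _ : Fin T => P) with hPT
  set Bad := {ω : Fin T → Ω | ∃ δ, IsCriticalRadius (eventSample E V ω) 𝓠 c δ ∧ ∃ f ∈ 𝓠,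
      Deviates μ (eventSample E V ω) f (devConst c *
        (δ + √(Real.log (32 / ξ) / (max (sampleSize (eventSample E V ω)) 1 : ℕ))))} with hBad
  -- The sample space is partitioned according to the set `S` of recorded trials.
  set ev : Finset (Fin T) → Fin T → Set Ω := fun S t => if t ∈ S then E else Eᶜ with hev
  set pat : Finset (Fin T) → Set (Fin T → Ω) := fun S => Set.univ.pi (ev S) with hpat
  have hevm : ∀ S t, MeasurableSet (ev S t) := by
    intro S t
    simp only [hev]
    split_ifs
    exacts [hE, hE.compl]
  have hpatm : ∀ S, MeasurableSet (pat S) := fun S => MeasurableSet.univ_pi (hevm S)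
  have hcover : ∀ ω, ω ∈ pat (Finset.univ.filter fun t => ω t ∈ E) := by
    intro ω t _
    by_cases h : ω t ∈ E <;> simp [hev, h]
  have hsample : ∀ S, ∀ ω ∈ pat S, eventSample E V ω = obsSample S V ω := by
    intro S ω hω
    funext t
    have ht := hω t (Set.mem_univ t)
    by_cases h : t ∈ S
    · simp only [hev, h, if_true] at ht
      simp [eventSample, obsSample, h, ht]
    · simp only [hev, h, if_false, Set.mem_compl_iff] at ht
      simp [eventSample, obsSample, h, ht]
  have hone : ∀ S, PT (Bad ∩ pat S) ≤ PT (pat S) * ENNReal.ofReal ξ := by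
    intro S
    by_cases h0 : PT (pat S) = 0
    · rw [h0, zero_mul]
      exact (measure_mono Set.inter_subset_right).trans h0.le
    have hpat_eq : PT (pat S) = ∏ t, P (ev S t) := Measure.pi_pi _ _
    have hev0 : ∀ t, P (ev S t) ≠ 0 := fun t ht =>
      h0 (by rw [hpat_eq]; exact Finset.prod_eq_zero (Finset.mem_univ t) ht)
    have hprob : ∀ t, IsProbabilityMeasure (P[|ev S t]) := fun t =>
      cond_isProbabilityMeasure (hev0 t)
    -- On one pattern the trials remain independent, with law conditioned on `E` or on its
    -- complement. The mass of the pattern factors out, so the fixed-`S` bound applies and the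
    -- patterns sum to at most `ξ`.
    have hrestr : PT.restrict (pat S)
        = (∏ t, (P (ev S t)).toNNReal) • Measure.pi (fun t => P[|ev S t]) := by
      rw [hPT, hpat, Measure.restrict_pi_pi, ← Measure.pi_smul_pi]
      congr 1
      funext t
      ext A _
      change P.restrict (ev S t) A = _
      simp only [ProbabilityTheory.cond, Measure.smul_apply, ENNReal.smul_def, smul_eq_mul]
      rw [ENNReal.coe_toNNReal (measure_ne_top _ _), ← mul_assoc,
        ENNReal.mul_inv_cancel (hev0 t) (measure_ne_top _ _), one_mul]
    have hmap : ∀ t ∈ S, (P[|ev S t]).map V = μ := by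
      intro t ht
      simp only [hev, ht, if_true]
      exact hμ.symm
    have hmain := measure_exists_deviates_le hV hmap hstar hne hmeas hsep hc hbd hξ0 hξ1
    calc PT (Bad ∩ pat S) = PT.restrict (pat S) (Bad ∩ pat S) := by
          rw [Measure.restrict_apply' (hpatm S), Set.inter_assoc, Set.inter_self]
      _ ≤ PT.restrict (pat S) {w | ∃ δ, IsCriticalRadius (obsSample S V w) 𝓠 c δ ∧ ∃ f ∈ 𝓠,
            Deviates μ (obsSample S V w) f
              (devConst c * (δ + √(Real.log (32 / ξ) / (max S.card 1 : ℕ))))} := by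
          refine measure_mono ?_
          rintro ω ⟨hω, hωS⟩
          simp only [hBad, Set.mem_ofPred_eq, hsample S ω hωS, sampleSize_obsSample] at hω
          exact hω
      _ ≤ PT (pat S) * ENNReal.ofReal ξ := by
          rw [hrestr, Measure.smul_apply, hpat_eq, ENNReal.smul_def, smul_eq_mul,
            ENNReal.ofNNReal_finsetProd]
          simp only [ENNReal.coe_toNNReal (measure_ne_top P _)]
          gcongr
  have hdisj : Set.PairwiseDisjoint (↑(Finset.univ : Finset (Finset (Fin T)))) pat := by
    intro S _ S' _ hSS'
    rw [Function.onFun, Set.disjoint_left]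
    intro ω hω hω'
    apply hSS'
    ext t
    have h1 := hω t (Set.mem_univ t)
    have h2 := hω' t (Set.mem_univ t)
    simp only [hev] at h1 h2
    by_cases a : t ∈ S <;> by_cases b : t ∈ S' <;> simp_all
  have hsum : ∑ S, PT (pat S) ≤ 1 := by
    have := sum_measure_le_measure_univ (μ := PT) (s := Finset.univ)
      (fun S _ => (hpatm S).nullMeasurableSet) hdisj.aedisjoint
    simpa using this
  calc PT Bad ≤ PT (⋃ S ∈ (Finset.univ : Finset (Finset (Fin T))), Bad ∩ pat S) := by
        refine measure_mono fun ω hω => ?_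
        simp only [Finset.mem_univ, Set.iUnion_true, Set.mem_iUnion]
        exact ⟨_, hω, hcover ω⟩
    _ ≤ ∑ S, PT (Bad ∩ pat S) := measure_biUnion_finset_le _ _
    _ ≤ ∑ S, PT (pat S) * ENNReal.ofReal ξ := Finset.sum_le_sum fun S _ => hone S
    _ = (∑ S, PT (pat S)) * ENNReal.ofReal ξ := by rw [Finset.sum_mul]
    _ ≤ 1 * ENNReal.ofReal ξ := by gcongr
    _ = _ := one_mul _

end Patterns

/-! ### The concentration event of one moment equation -/

section Classes

variable {W V' : Type u}

lemma starConvex_productClass {R : Set (W → ℝ)} {inst : W → V'} {Θ : Set (V' → ℝ)}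
    (h : StarConvex ℝ 0 Θ) : StarConvex ℝ 0 (productClass R inst Θ) := by
  rw [starConvex_zero_iff] at h ⊢
  rintro _ ⟨r, hr, θ, hθ, rfl⟩ a ha0 ha1
  refine ⟨r, hr, a • θ, h hθ ha0 ha1, ?_⟩
  funext w
  simp
  ring

lemma starConvex_image_comp {inst : W → V'} {Θ : Set (V' → ℝ)} (h : StarConvex ℝ 0 Θ) :
    StarConvex ℝ 0 ((fun θ w => θ (inst w)) '' Θ) := by
  rw [starConvex_zero_iff] at h ⊢
  rintro _ ⟨θ, hθ, rfl⟩ a ha0 ha1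
  exact ⟨a • θ, h hθ ha0 ha1, rfl⟩

lemma PointwiseSeparable.productClass {R : Set (W → ℝ)} {inst : W → V'} {Θ : Set (V' → ℝ)}
    (hR : PointwiseSeparable R) (hΘ : PointwiseSeparable Θ) :
    PointwiseSeparable (productClass R inst Θ) := by
  obtain ⟨R₀, hR₀, hRc, hR⟩ := hR
  obtain ⟨Θ₀, hΘ₀, hΘc, hΘ⟩ := hΘ
  refine ⟨(fun p : (W → ℝ) × (V' → ℝ) => fun w => p.1 w * p.2 (inst w)) '' (R₀ ×ˢ Θ₀), ?_,
    (hRc.prod hΘc).image _, ?_⟩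
  · rintro _ ⟨⟨r, θ⟩, ⟨hr, hθ⟩, rfl⟩
    exact ⟨r, hR₀ hr, θ, hΘ₀ hθ, rfl⟩
  · rintro _ ⟨r, hr, θ, hθ, rfl⟩
    obtain ⟨s, hs, hs'⟩ := hR r hr
    obtain ⟨s', hs2, hs2'⟩ := hΘ θ hθ
    exact ⟨fun n w => s n w * s' n (inst w), fun n => ⟨(s n, s' n), ⟨hs n, hs2 n⟩, rfl⟩,
      fun w => (hs' w).mul (hs2' _)⟩

lemma PointwiseSeparable.image_comp {inst : W → V'} {Θ : Set (V' → ℝ)}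
    (hΘ : PointwiseSeparable Θ) : PointwiseSeparable ((fun θ w => θ (inst w)) '' Θ) := by
  obtain ⟨Θ₀, hΘ₀, hΘc, hΘ⟩ := hΘ
  refine ⟨(fun θ w => θ (inst w)) '' Θ₀, Set.image_mono hΘ₀, hΘc.image _, ?_⟩
  rintro _ ⟨θ, hθ, rfl⟩
  obtain ⟨s, hs, hs'⟩ := hΘ θ hθ
  exact ⟨fun n w => s n (inst w), fun n => ⟨s n, hs n, rfl⟩, fun w => hs' _⟩

end Classes

section ConcentrationEvent

variable {T : ℕ} {W V' : Type u} {Ω : Type*} [MeasurableSpace W] [MeasurableSpace V']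
  [MeasurableSpace Ω]

lemma bounds_of_not_deviates {μ : Measure W} {d : Fin T → Option W} {f : W → ℝ} {η' η : ℝ}
    (h0 : 0 ≤ η') (h : η' ≤ η) (hf : ¬ Deviates μ d f η') :
    |empMean d f - ∫ w, f w ∂μ| ≤ η * (√(∫ w, f w ^ 2 ∂μ) + η) ∧
    |empMean d (fun w => f w ^ 2) - ∫ w, f w ^ 2 ∂μ| ≤ 1 / 2 * ((∫ w, f w ^ 2 ∂μ) + η ^ 2) := by
  rw [Deviates, not_not] at hf
  have hη : 0 ≤ η := h0.trans h
  refine ⟨hf.1.trans (by gcongr), hf.2.trans (by gcongr)⟩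

/-- The concentration event of one moment equation has probability at least `1 - 2 ξ`. -/
theorem measure_not_concentrates_le (P : Measure Ω) [IsProbabilityMeasure P] {E : Set Ω}
    (hE : MeasurableSet E) {V : Ω → W} (hV : Measurable V) {μ : Measure W} [IsProbabilityMeasure μ]
    (hμ : μ = (P[|E]).map V) {R : Set (W → ℝ)} {inst : W → V'} (hinst : Measurable inst)
    {Θ : Set (V' → ℝ)} {Lα Lθ C₀ ξ : ℝ} (hLα : 0 < Lα) (hLθ : 0 < Lθ)
    (hC₁ : devConst (Lα * Lθ) ≤ C₀) (hC₂ : devConst Lθ ≤ C₀) (hΘ : TestClass Θ Lθ)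
    (hRm : ∀ r ∈ R, Measurable r) (hRsep : PointwiseSeparable R)
    (hRbd : ∀ᵐ w ∂μ, ∀ r ∈ R, |r w| ≤ Lα) (hξ0 : 0 < ξ) (hξ1 : ξ < 1) {η : (Fin T → Ω) → ℝ}
    (hη : ∀ ω, BoundsCriticalRadius (eventSample E V ω) R inst Θ Lα Lθ C₀ 32 ξ (η ω)) :
    Measure.pi (fun _ : Fin T => P)
      {ω | ¬ Concentrates μ (eventSample E V ω) R inst Θ Lα (η ω)} ≤ ENNReal.ofReal (2 * ξ) := by
  have h1 := measure_eventSample_deviates_le (T := T) P hE hV hμ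
    (𝓠 := productClass R inst Θ) (starConvex_productClass hΘ.starShaped)
    (by
      rintro _ ⟨r, hr, θ, hθ, rfl⟩
      exact (hRm r hr).mul ((hΘ.measurable θ hθ).comp hinst))
    (hRsep.productClass hΘ.separable) (c := Lα * Lθ) (by positivity)
    (by
      filter_upwards [hRbd] with w hw
      rintro _ ⟨r, hr, θ, hθ, rfl⟩
      rw [abs_mul]
      gcongr
      exacts [hw r hr, hΘ.bounded θ hθ _]) hξ0 hξ1
  have h2 := measure_eventSample_deviates_le (T := T) P hE hV hμ
    (𝓠 := (fun θ w => θ (inst w)) '' Θ) (starConvex_image_comp hΘ.starShaped)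
    (by
      rintro _ ⟨θ, hθ, rfl⟩
      exact (hΘ.measurable θ hθ).comp hinst)
    hΘ.separable.image_comp hLθ
    (by
      refine ae_of_all _ fun w => ?_
      rintro _ ⟨θ, hθ, rfl⟩
      exact hΘ.bounded θ hθ _) hξ0 hξ1
  set B1 := {ω : Fin T → Ω | ∃ δ, IsCriticalRadius (eventSample E V ω) (productClass R inst Θ)
    (Lα * Lθ) δ ∧ ∃ f ∈ productClass R inst Θ, Deviates μ (eventSample E V ω) f (devConst (Lα * Lθ) *
        (δ + √(Real.log (32 / ξ) / (max (sampleSize (eventSample E V ω)) 1 : ℕ))))}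
  set B2 := {ω : Fin T → Ω | ∃ δ, IsCriticalRadius (eventSample E V ω) ((fun θ w => θ (inst w)) '' Θ)
    Lθ δ ∧ ∃ f ∈ (fun θ w => θ (inst w)) '' Θ, Deviates μ (eventSample E V ω) f (devConst Lθ *
        (δ + √(Real.log (32 / ξ) / (max (sampleSize (eventSample E V ω)) 1 : ℕ))))}
  have hdev0 : ∀ {c : ℝ}, 0 < c → 0 ≤ devConst c := by
    intro c hc
    unfold devConst
    positivity
  have hsub : {ω | ¬ Concentrates μ (eventSample E V ω) R inst Θ Lα (η ω)} ⊆ B1 ∪ B2 := by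
    intro ω hω
    by_contra hcon
    simp only [Set.mem_union, not_or] at hcon
    obtain ⟨hn1, hn2⟩ := hcon
    apply hω
    obtain ⟨δ, hδ1, hδ2, hδη⟩ := hη ω
    set σ := δ + √(Real.log (32 / ξ) / (max (sampleSize (eventSample E V ω)) 1 : ℕ)) with hσ
    have hσ0 : 0 ≤ σ := add_nonneg hδ1.1.le (Real.sqrt_nonneg _)
    have hη0 : 0 ≤ η ω :=
      (mul_nonneg ((hdev0 hLθ).trans hC₂) hσ0).trans hδη
    intro θ hθ
    have hθint : Integrable (fun w => θ (inst w) ^ 2) μ :=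
      Integrable.of_bound (((hΘ.measurable θ hθ).comp hinst).pow_const 2).aestronglyMeasurable
        (Lθ ^ 2) (ae_of_all _ fun w => by
          rw [norm_pow, Real.norm_eq_abs]
          have := hΘ.bounded θ hθ (inst w)
          gcongr)
    constructor
    · intro r hr
      have hnd : ¬ Deviates μ (eventSample E V ω) (fun w => r w * θ (inst w))
          (devConst (Lα * Lθ) * σ) := fun h => hn1 ⟨δ, hδ1, _, ⟨r, hr, θ, hθ, rfl⟩, h⟩
      refine (bounds_of_not_deviates (mul_nonneg (hdev0 (by positivity)) hσ0)
        ((mul_le_mul_of_nonneg_right hC₁ hσ0).trans hδη) hnd).1.trans ?_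
      gcongr
      -- The deviation is measured by `‖r θ‖`, which is at most `Lα ‖θ‖` since `|r| ≤ Lα` almost
      -- surely.
      rw [l2norm, Real.sqrt_le_left (by positivity), mul_pow, Real.sq_sqrt
        (integral_nonneg fun w => sq_nonneg _), ← integral_const_mul]
      refine integral_mono_of_nonneg (ae_of_all _ fun w => sq_nonneg _) (hθint.const_mul _) ?_
      filter_upwards [hRbd] with w hw
      rw [mul_pow]
      exact mul_le_mul_of_nonneg_right (sq_le_sq.2 ((hw r hr).trans (le_abs_self _))) (sq_nonneg _)
    · have hnd : ¬ Deviates μ (eventSample E V ω) (fun w => θ (inst w)) (devConst Lθ * σ) :=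
        fun h => hn2 ⟨δ, hδ2, _, ⟨θ, hθ, rfl⟩, h⟩
      exact (bounds_of_not_deviates (mul_nonneg (hdev0 hLθ) hσ0)
        ((mul_le_mul_of_nonneg_right hC₂ hσ0).trans hδη) hnd).2
  calc _ ≤ Measure.pi (fun _ : Fin T => P) (B1 ∪ B2) := measure_mono hsub
    _ ≤ _ := measure_union_le _ _
    _ ≤ ENNReal.ofReal ξ + ENNReal.ofReal ξ := add_le_add h1 h2
    _ = _ := by rw [← ENNReal.ofReal_add hξ0.le hξ0.le, two_mul]

end ConcentrationEvent

end

noncomputable section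

/-! ### The minimax loss on the concentration event -/

section L2

variable {W : Type u} [MeasurableSpace W] {μ : Measure W}

lemma l2norm_nonneg (f : W → ℝ) : 0 ≤ l2norm μ f := Real.sqrt_nonneg _

lemma l2norm_sq (f : W → ℝ) : l2norm μ f ^ 2 = ∫ w, f w ^ 2 ∂μ :=
  Real.sq_sqrt (integral_nonneg fun _ => sq_nonneg _)

lemma abs_integral_mul_le_l2norm {f g : W → ℝ} (hf : MemLp f 2 μ) (hg : MemLp g 2 μ) :
    |∫ w, f w * g w ∂μ| ≤ l2norm μ f * l2norm μ g := by
  have hfg : Integrable (fun w => f w * g w) μ := hf.integrable_mul hg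
  have h : ∀ x : ℝ, 0 ≤ (∫ w, f w ^ 2 ∂μ) * (x * x) + (2 * ∫ w, f w * g w ∂μ) * x
      + ∫ w, g w ^ 2 ∂μ := by
    intro x
    have e : (∫ w, f w ^ 2 ∂μ) * (x * x) + (2 * ∫ w, f w * g w ∂μ) * x + ∫ w, g w ^ 2 ∂μ
        = ∫ w, (x * f w + g w) ^ 2 ∂μ := by
      have e1 : ∀ w, (x * f w + g w) ^ 2 = (x * x) * f w ^ 2 + (2 * x) * (f w * g w) + g w ^ 2 :=
        fun w => by ring
      have i1 : Integrable (fun w => (x * x) * f w ^ 2 + (2 * x) * (f w * g w)) μ :=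
        (hf.integrable_sq.const_mul _).add (hfg.const_mul _)
      simp only [e1]
      rw [integral_add i1 hg.integrable_sq,
        integral_add (hf.integrable_sq.const_mul _) (hfg.const_mul _), integral_const_mul,
        integral_const_mul]
      ring
    rw [e]
    exact integral_nonneg fun _ => sq_nonneg _
  have hd := discrim_le_zero h
  rw [discrim, ← l2norm_sq, ← l2norm_sq] at hd
  apply abs_le_of_sq_le_sq _ (mul_nonneg (l2norm_nonneg f) (l2norm_nonneg g))
  nlinarith

lemma l2norm_le_add_l2norm_sub {f g : W → ℝ} (hf : MemLp f 2 μ) (hg : MemLp g 2 μ) :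
    l2norm μ f ≤ l2norm μ g + l2norm μ (fun w => g w - f w) := by
  have hgf : MemLp (fun w => g w - f w) 2 μ := hg.sub hf
  rw [← sq_le_sq₀ (l2norm_nonneg f) (add_nonneg (l2norm_nonneg g) (l2norm_nonneg _))]
  have hcs := (abs_le.1 (abs_integral_mul_le_l2norm hg hgf)).1
  have hint : Integrable (fun w => g w * (g w - f w)) μ := hg.integrable_mul hgf
  have i2 : Integrable (fun w => g w ^ 2 - 2 * (g w * (g w - f w))) μ :=
    hg.integrable_sq.sub (hint.const_mul _)
  have e : l2norm μ f ^ 2 = l2norm μ g ^ 2 - 2 * ∫ w, g w * (g w - f w) ∂μ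
      + l2norm μ (fun w => g w - f w) ^ 2 := by
    rw [l2norm_sq, l2norm_sq, l2norm_sq, ← integral_const_mul,
      ← integral_sub hg.integrable_sq (hint.const_mul _),
      ← integral_add i2 hgf.integrable_sq]
    refine integral_congr_ae (ae_of_all _ fun w => ?_)
    simp only
    ring
  rw [e]
  nlinarith

end L2

section TestClassLoss

variable {T : ℕ} {W V' : Type u} [MeasurableSpace V'] {inst : W → V'}

lemma TestClass.bddAbove_empLoss {Θ : Set (V' → ℝ)} {Lθ : ℝ} (hΘ : TestClass Θ Lθ)
    (d : Fin T → Option W) (r : W → ℝ) :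
    BddAbove ((fun θ : V' → ℝ => empMean d (fun w => r w * θ (inst w))
      - 1 / 2 * empMean d (fun w => θ (inst w) ^ 2)) '' Θ) := by
  refine ⟨(∑ t, (d t).elim 0 (fun w => |r w| * Lθ)) / sampleSize d, ?_⟩
  rintro _ ⟨θ, hθ, rfl⟩
  have h1 : 0 ≤ empMean d (fun w => θ (inst w) ^ 2) := by
    unfold empMean
    refine div_nonneg (Finset.sum_nonneg fun t _ => ?_) (Nat.cast_nonneg _)
    cases d t <;> simp
    positivity
  have h2 : empMean d (fun w => r w * θ (inst w))
      ≤ (∑ t, (d t).elim 0 (fun w => |r w| * Lθ)) / sampleSize d := by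
    unfold empMean
    gcongr with t
    cases d t with
    | none => simp
    | some w =>
      simp only [Option.elim_some]
      refine (le_abs_self _).trans ?_
      rw [abs_mul]
      gcongr
      exact hΘ.bounded θ hθ _
  simp only
  linarith

lemma TestClass.empLoss_nonneg {Θ : Set (V' → ℝ)} {Lθ : ℝ} (hΘ : TestClass Θ Lθ)
    (d : Fin T → Option W) (r : W → ℝ) : 0 ≤ empLoss d inst Θ r := by
  have h0 : (0 : V' → ℝ) ∈ Θ := by
    obtain ⟨θ, hθ⟩ := hΘ.nonempty
    simpa using hΘ.starShaped.smul_mem hθ le_rfl zero_le_one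
  refine le_trans (le_of_eq ?_) (le_csSup (hΘ.bddAbove_empLoss d r) ⟨0, h0, rfl⟩)
  have : empMean d (fun _ : W => (0 : ℝ)) = 0 := by
    unfold empMean
    rw [Finset.sum_eq_zero, zero_div]
    intro t _
    cases d t <;> rfl
  simp [this]

end TestClassLoss

section Loss

variable {T : ℕ} {W V' : Type u} [MeasurableSpace W] [MeasurableSpace V'] {μ : Measure W}
  {inst : W → V'}

/-- The tower property: functions of the instrument see a residual only through its conditional
mean. This lets both the loss and the weights `b_k` be tested against `𝒯_k h`. -/
lemma integral_mul_comp_eq_integral_proj [IsFiniteMeasure μ] (hinst : Measurable inst) {r : W → ℝ}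
    (hr : MemLp r 2 μ) {θ : V' → ℝ} (hθ : Measurable θ) (hθ2 : MemLp (fun w => θ (inst w)) 2 μ) :
    ∫ w, r w * θ (inst w) ∂μ = ∫ w, proj μ inst r w * θ (inst w) ∂μ := by
  have hm := hinst.comap_le
  have hsm : StronglyMeasurable[MeasurableSpace.comap inst inferInstance] (fun w => θ (inst w)) :=
    (hθ.comp (comap_measurable inst)).stronglyMeasurable
  have h := condExp_mul_of_stronglyMeasurable_right hsm (hr.integrable_mul hθ2)
    (hr.integrable one_le_two)
  calc ∫ w, r w * θ (inst w) ∂μ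
      = ∫ w, (μ[r * (fun w => θ (inst w)) | MeasurableSpace.comap inst inferInstance]) w ∂μ :=
        (integral_condExp hm).symm
    _ = _ := integral_congr_ae h

lemma memLp_proj [IsFiniteMeasure μ] {r : W → ℝ} (hr : MemLp r 2 μ) : MemLp (proj μ inst r) 2 μ :=
  hr.condExp one_le_two

lemma TestClass.memLp [IsFiniteMeasure μ] (hinst : Measurable inst) {Θ : Set (V' → ℝ)} {Lθ : ℝ}
    (hΘ : TestClass Θ Lθ) {θ : V' → ℝ} (hθ : θ ∈ Θ) : MemLp (fun w => θ (inst w)) 2 μ :=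
  MemLp.of_bound ((hΘ.measurable θ hθ).comp hinst).aestronglyMeasurable Lθ
    (ae_of_all _ fun _ => hΘ.bounded θ hθ _)

/-- On the concentration event the loss is at most of the order of the squared projected residual. -/
lemma empLoss_le_of_concentrates [IsFiniteMeasure μ] (hinst : Measurable inst)
    {R : Set (W → ℝ)} {Θ : Set (V' → ℝ)} {Lθ Lα η : ℝ} (hΘ : TestClass Θ Lθ)
    {d : Fin T → Option W}
    (hconc : Concentrates μ d R inst Θ Lα η) {r : W → ℝ} (hr : r ∈ R) (hr2 : MemLp r 2 μ) :
    empLoss d inst Θ r ≤ 2 * l2norm μ (proj μ inst r) ^ 2 + (2 * Lα ^ 2 + 5 / 4) * η ^ 2 := by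
  refine csSup_le (hΘ.nonempty.image _) ?_
  rintro _ ⟨θ, hθ, rfl⟩
  obtain ⟨h1, h2⟩ := hconc θ hθ
  have h1 := (abs_le.1 (h1 r hr)).2
  have h2 := (abs_le.1 h2).1
  rw [integral_mul_comp_eq_integral_proj hinst hr2 (hΘ.measurable θ hθ) (hΘ.memLp hinst hθ)] at h1
  have h3 := (abs_le.1 (abs_integral_mul_le_l2norm (memLp_proj (inst := inst) hr2)
    (hΘ.memLp (μ := μ) hinst hθ))).2
  rw [← l2norm_sq] at h2
  set x := l2norm μ (fun w => θ (inst w))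
  set τ := l2norm μ (proj μ inst r)
  simp only
  -- The objective at `θ` is at most `(τ + η Lα) x - x ^ 2 / 4 + 5 η ^ 2 / 4`. Its maximum over `x`
  -- is `(τ + η Lα) ^ 2 + 5 η ^ 2 / 4`, and `(a + b) ^ 2 ≤ 2 a ^ 2 + 2 b ^ 2`.
  nlinarith [sq_nonneg (x / 2 - (τ + η * Lα)), sq_nonneg (τ - η * Lα)]

/-- On the concentration event a small loss forces a small projected residual. -/
lemma l2norm_proj_le_of_concentrates [IsFiniteMeasure μ] (hinst : Measurable inst)
    {R : Set (W → ℝ)} {Θ : Set (V' → ℝ)} {Lθ Lα η ε L : ℝ} (hΘ : TestClass Θ Lθ) (hLα : 0 ≤ Lα)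
    (hη : 0 ≤ η) {d : Fin T → Option W}
    (hconc : Concentrates μ d R inst Θ Lα η) (hcomp : Compatible μ R inst Θ ε) {r : W → ℝ}
    (hr : r ∈ R) (hr2 : MemLp r 2 μ) (hL0 : 0 ≤ L) (hL : empLoss d inst Θ r ≤ L) :
    l2norm μ (proj μ inst r) ≤ 5 * ε + (4 * Lα + 3) * η + 2 * √L := by
  refine le_of_forall_pos_le_add fun κ hκ => ?_
  -- The infimum in compatibility need not be attained. The slack is `κ / 5` because the distance
  -- from `θ` to the projection enters the final bound five times.
  obtain ⟨_, ⟨θ, hθ, rfl⟩, hlt⟩ := exists_lt_of_csInf_lt (hΘ.nonempty.image _)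
    (lt_of_le_of_lt (hcomp r hr) (lt_add_of_pos_right ε (by positivity : 0 < κ / 5)))
  obtain ⟨h1, h2⟩ := hconc θ hθ
  have h1 := (abs_le.1 (h1 r hr)).1
  have h2 := (abs_le.1 h2).2
  have hθ2 : MemLp (fun w => θ (inst w)) 2 μ := hΘ.memLp hinst hθ
  have hp2 := memLp_proj (inst := inst) hr2
  rw [integral_mul_comp_eq_integral_proj hinst hr2 (hΘ.measurable θ hθ) hθ2] at h1
  have hdiff : MemLp (fun w => θ (inst w) - proj μ inst r w) 2 μ := hθ2.sub hp2
  have h3 := (abs_le.1 (abs_integral_mul_le_l2norm hdiff hθ2)).2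
  have h4 : ∫ w, (θ (inst w) - proj μ inst r w) * θ (inst w) ∂μ
      = l2norm μ (fun w => θ (inst w)) ^ 2 - ∫ w, proj μ inst r w * θ (inst w) ∂μ := by
    have i3 : Integrable (fun w => proj μ inst r w * θ (inst w)) μ := hp2.integrable_mul hθ2
    rw [l2norm_sq, ← integral_sub hθ2.integrable_sq i3]
    refine integral_congr_ae (ae_of_all _ fun w => ?_)
    simp only
    ring
  have h5 := (le_csSup (hΘ.bddAbove_empLoss d r) ⟨θ, hθ, rfl⟩).trans hL
  have h6 := l2norm_le_add_l2norm_sub hp2 hθ2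
  rw [← l2norm_sq] at h2
  rw [h4] at h3
  simp only at h5
  set x := l2norm μ (fun w => θ (inst w))
  set e := l2norm μ (fun w => θ (inst w) - proj μ inst r w)
  have hx0 : 0 ≤ x := l2norm_nonneg _
  have he0 : 0 ≤ e := l2norm_nonneg _
  -- The test function `θ` near the projection gives `⟨proj, θ⟩ ≥ x ^ 2 - e x`, whereas half the
  -- empirical squared norm costs at most `3/4 x ^ 2 + 1/4 η ^ 2`. A quarter of `x ^ 2` survives.
  have hquad : x ^ 2 ≤ 4 * (e + η * Lα) * x + 4 * L + 5 * η ^ 2 := by nlinarith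
  have hs := Real.sq_sqrt hL0
  have hs0 := Real.sqrt_nonneg L
  have hb0 : 0 ≤ e + η * Lα := by positivity
  have hx : x ≤ 4 * (e + η * Lα) + (2 * √L + 3 * η) := by
    by_contra! hcon
    have hw0 : 0 ≤ 2 * √L + 3 * η := by positivity
    have c1 : (2 * √L + 3 * η) * (2 * √L + 3 * η) ≤ x * (x - 4 * (e + η * Lα)) := by
      apply mul_le_mul _ _ hw0 hx0 <;> linarith
    have c2 : (2 * √L + 3 * η) * (2 * √L + 3 * η) = 4 * √L ^ 2 + 9 * η ^ 2 + 12 * (√L * η) := by ring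
    have c3 : 0 ≤ √L * η := by positivity
    have c4 : (2 * √L + 3 * η) * x > (2 * √L + 3 * η) * (2 * √L + 3 * η) ∨ 2 * √L + 3 * η = 0 := by
      rcases hw0.eq_or_lt with h | h
      · exact Or.inr h.symm
      · left
        apply mul_lt_mul_of_pos_left _ h
        linarith
    have c5 : 0 < x := lt_of_le_of_lt (by positivity) hcon
    have c6 : x * (2 * √L + 3 * η) < x * (x - 4 * (e + η * Lα)) := by
      apply mul_lt_mul_of_pos_left _ c5
      linarith
    have c7 : (2 * √L + 3 * η) * (2 * √L + 3 * η) ≤ x * (2 * √L + 3 * η) := by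
      apply mul_le_mul_of_nonneg_right _ hw0
      linarith
    nlinarith [sq_nonneg η]
  change e < _ at hlt
  linarith

end Loss

end

noncomputable section

/-! ### The confidence set on the concentration event -/

section ConfidenceSet

variable {𝒰 𝒳 𝒵 𝒜 : Type u} [MeasurableSpace 𝒰] [MeasurableSpace 𝒳] [MeasurableSpace 𝒵]
  [MeasurableSpace 𝒜] {M : CCBIV 𝒰 𝒳 𝒵 𝒜} {T : ℕ} {d : Dataset 𝒳 𝒵 𝒜 T}
  {H : Set ((ℝ × 𝒜 × 𝒵 → ℝ) × (𝒳 × 𝒜 → ℝ))} {Θ₁ : Set (𝒵 → ℝ)} {Θ₂ : Set (𝒜 × 𝒳 × 𝒵 → ℝ)}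
  {Lα Lθ η₁ η₂ e : ℝ}

lemma measurable_inst₁ : Measurable (inst₁ : ℝ × 𝒜 × 𝒵 → 𝒵) :=
  measurable_snd.comp measurable_snd

lemma measurable_inst₂ : Measurable (inst₂ : 𝒳 × ℝ × 𝒜 × 𝒵 → 𝒜 × 𝒳 × 𝒵) := by
  unfold inst₂
  fun_prop

lemma lossD_nonneg (hΘ₁ : TestClass Θ₁ Lθ) (hΘ₂ : TestClass Θ₂ Lθ)
    (h : (ℝ × 𝒜 × 𝒵 → ℝ) × (𝒳 × 𝒜 → ℝ)) : 0 ≤ lossD d Θ₁ Θ₂ h :=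
  add_nonneg (hΘ₁.empLoss_nonneg _ _) (hΘ₂.empLoss_nonneg _ _)

/-- On the event `𝓔` a hypothesis with small projected residuals has a small loss. -/
lemma lossD_le_of_goodEvent [IsFiniteMeasure M.μ₁] [IsFiniteMeasure M.μ₂]
    (hΘ₁ : TestClass Θ₁ Lθ) (hΘ₂ : TestClass Θ₂ Lθ)
    (hgood : GoodEvent M d H Θ₁ Θ₂ Lα η₁ η₂) {h : (ℝ × 𝒜 × 𝒵 → ℝ) × (𝒳 × 𝒜 → ℝ)} (hh : h ∈ H)
    (h₁ : MemLp (α₁ h) 2 M.μ₁) (h₂ : MemLp (α₂ h) 2 M.μ₂) {ε : ℝ}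
    (hε : √(l2norm M.μ₁ (proj M.μ₁ inst₁ (α₁ h)) ^ 2
      + l2norm M.μ₂ (proj M.μ₂ inst₂ (α₂ h)) ^ 2) ≤ ε) :
    lossD d Θ₁ Θ₂ h ≤ 2 * ε ^ 2 + (2 * Lα ^ 2 + 5 / 4) * (η₁ ^ 2 + η₂ ^ 2) := by
  have b₁ := empLoss_le_of_concentrates measurable_inst₁ hΘ₁ hgood.1 ⟨h, hh, rfl⟩ h₁
  have b₂ := empLoss_le_of_concentrates measurable_inst₂ hΘ₂ hgood.2 ⟨h, hh, rfl⟩ h₂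
  have hε2 := (Real.sqrt_le_left ((Real.sqrt_nonneg _).trans hε)).1 hε
  unfold lossD
  linarith

/-- On the event `𝓔` a sufficiently realizable hypothesis belongs to the confidence set. -/
lemma mem_confH_of_lossD_le (hΘ₁ : TestClass Θ₁ Lθ) (hΘ₂ : TestClass Θ₂ Lθ)
    {h : (ℝ × 𝒜 × 𝒵 → ℝ) × (𝒳 × 𝒜 → ℝ)} (hh : h ∈ H) (hle : lossD d Θ₁ Θ₂ h ≤ e) :
    h ∈ confH d H Θ₁ Θ₂ e := by
  -- Losses are nonnegative because `0` is an admissible test function, so a loss of at most `e`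
  -- already meets the threshold above the infimum.
  refine ⟨hh, hle.trans (le_add_of_nonneg_left (Real.sInf_nonneg ?_))⟩
  rintro _ ⟨h', -, rfl⟩
  exact lossD_nonneg hΘ₁ hΘ₂ h'

/-- The losses of the members of the confidence set. -/
lemma lossD_le_of_mem_confH (hΘ₁ : TestClass Θ₁ Lθ) (hΘ₂ : TestClass Θ₂ Lθ)
    {h h₀ : (ℝ × 𝒜 × 𝒵 → ℝ) × (𝒳 × 𝒜 → ℝ)} (hh₀ : h₀ ∈ H) (hle : lossD d Θ₁ Θ₂ h₀ ≤ e)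
    (hh : h ∈ confH d H Θ₁ Θ₂ e) : lossD d Θ₁ Θ₂ h ≤ 2 * e := by
  have h1 : sInf (lossD d Θ₁ Θ₂ '' H) ≤ lossD d Θ₁ Θ₂ h₀ := by
    refine csInf_le ⟨0, ?_⟩ ⟨h₀, hh₀, rfl⟩
    rintro _ ⟨h', -, rfl⟩
    exact lossD_nonneg hΘ₁ hΘ₂ h'
  linarith [hh.2]

lemma two_mul_sqrt_two_mul_le (e : ℝ) : 2 * √(2 * e) ≤ 3 * √e := by
  rw [Real.sqrt_mul zero_le_two]
  have h : 2 * √2 ≤ 3 := by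
    have := Real.sq_sqrt (zero_le_two (α := ℝ))
    nlinarith [Real.sqrt_nonneg 2]
  nlinarith [mul_le_mul_of_nonneg_right h (Real.sqrt_nonneg e)]

/-- On the event `𝓔` the members of the confidence set have small projected residuals. -/
lemma l2norm_proj_le_of_goodEvent [IsFiniteMeasure M.μ₁] [IsFiniteMeasure M.μ₂]
    (hΘ₁ : TestClass Θ₁ Lθ) (hΘ₂ : TestClass Θ₂ Lθ) (hLα : 0 ≤ Lα) (hη₁ : 0 ≤ η₁) (hη₂ : 0 ≤ η₂)
    (hgood : GoodEvent M d H Θ₁ Θ₂ Lα η₁ η₂) {ε : ℝ}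
    (hc₁ : Compatible M.μ₁ (α₁ '' H) inst₁ Θ₁ ε) (hc₂ : Compatible M.μ₂ (α₂ '' H) inst₂ Θ₂ ε)
    {h : (ℝ × 𝒜 × 𝒵 → ℝ) × (𝒳 × 𝒜 → ℝ)} (hh : h ∈ H)
    (h₁ : MemLp (α₁ h) 2 M.μ₁) (h₂ : MemLp (α₂ h) 2 M.μ₂) (hle : lossD d Θ₁ Θ₂ h ≤ 2 * e) :
    l2norm M.μ₁ (proj M.μ₁ inst₁ (α₁ h))
        ≤ 5 * ε + (4 * Lα + 3) * √(η₁ ^ 2 + η₂ ^ 2) + 3 * √e ∧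
      l2norm M.μ₂ (proj M.μ₂ inst₂ (α₂ h))
        ≤ 5 * ε + (4 * Lα + 3) * √(η₁ ^ 2 + η₂ ^ 2) + 3 * √e := by
  have n₁ := hΘ₁.empLoss_nonneg (inst := inst₁) (data₁ d) (α₁ h)
  have n₂ := hΘ₂.empLoss_nonneg (inst := inst₂) (data₂ d) (α₂ h)
  unfold lossD at hle
  have b₁ := l2norm_proj_le_of_concentrates measurable_inst₁ hΘ₁ hLα hη₁ hgood.1 hc₁ ⟨h, hh, rfl⟩ h₁
    (by linarith) (show _ ≤ 2 * e by linarith)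
  have b₂ := l2norm_proj_le_of_concentrates measurable_inst₂ hΘ₂ hLα hη₂ hgood.2 hc₂ ⟨h, hh, rfl⟩ h₂
    (by linarith) (show _ ≤ 2 * e by linarith)
  have s₁ : η₁ ≤ √(η₁ ^ 2 + η₂ ^ 2) := Real.le_sqrt_of_sq_le (by nlinarith)
  have s₂ : η₂ ≤ √(η₁ ^ 2 + η₂ ^ 2) := Real.le_sqrt_of_sq_le (by nlinarith)
  have k : 0 ≤ 4 * Lα + 3 := by linarith
  have := two_mul_sqrt_two_mul_le e
  have := mul_le_mul_of_nonneg_left s₁ k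
  have := mul_le_mul_of_nonneg_left s₂ k
  constructor <;> linarith

lemma Compatible.nonneg {W V : Type u} [MeasurableSpace W] [MeasurableSpace V] {μ : Measure W}
    {R : Set (W → ℝ)} {inst : W → V} {Θ : Set (V → ℝ)} {ε : ℝ} (h : Compatible μ R inst Θ ε)
    (hR : R.Nonempty) : 0 ≤ ε := by
  obtain ⟨r, hr⟩ := hR
  refine le_trans (Real.sInf_nonneg ?_) (h r hr)
  rintro _ ⟨θ, -, rfl⟩
  exact l2norm_nonneg _

lemma BoundsCriticalRadius.nonneg {W V : Type u} {d : Fin T → Option W} {R : Set (W → ℝ)}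
    {inst : W → V} {Θ : Set (V → ℝ)} {C₀ C₁ ξ η : ℝ}
    (h : BoundsCriticalRadius d R inst Θ Lα Lθ C₀ C₁ ξ η) (hC₀ : 0 ≤ C₀) : 0 ≤ η := by
  obtain ⟨δ, hδ, -, hle⟩ := h
  have := hδ.1
  exact le_trans (by positivity) hle

end ConfidenceSet

end

noncomputable section

/-! ### Laws under the observational and the interventional process -/

section Generic

variable {α β γ : Type*} [MeasurableSpace α] [MeasurableSpace β] [MeasurableSpace γ]

lemma map_withDensity_comp {ν : Measure α} {S : α → β} (hS : Measurable S) {k : β → ENNReal}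
    (hk : Measurable k) : (ν.withDensity (k ∘ S)).map S = (ν.map S).withDensity k := by
  ext s hs
  rw [Measure.map_apply hS hs, withDensity_apply _ (hS hs), withDensity_apply _ hs,
    Measure.restrict_map hS hs, lintegral_map hk hS]
  rfl

/-- If `ν'` has a density with respect to `ν` that is a function of `S`, and the law of `S` under
`ν` is absolutely continuous with respect to its law under `ν'`, then `ν` has a density with respect
to `ν'` that is a function of `S`. -/
lemma eq_withDensity_rnDeriv_comp {ν ν' : Measure α} [IsFiniteMeasure ν] [IsFiniteMeasure ν']
    {S : α → β} (hS : Measurable S) {k : β → ENNReal} (hk : Measurable k)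
    (hν' : ν' = ν.withDensity (k ∘ S)) (hac : ν.map S ≪ ν'.map S) :
    ν = ν'.withDensity ((ν.map S).rnDeriv (ν'.map S) ∘ S) := by
  set ρ := (ν.map S).rnDeriv (ν'.map S) with hρ
  have hρm : Measurable ρ := Measure.measurable_rnDeriv _ _
  -- Passing from the law of `S` under `ν` to that under `ν'` and back is the identity, so `ρ` is a
  -- reciprocal of `k` almost everywhere, and this pulls back along `S`.
  have h1 : (ν.map S).withDensity (k * ρ) = (ν.map S).withDensity 1 := by
    rw [withDensity_mul _ hk hρm, ← map_withDensity_comp hS hk, ← hν',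
      Measure.withDensity_rnDeriv_eq _ _ hac, withDensity_one]
  have h2 : k * ρ =ᵐ[ν.map S] 1 :=
    (withDensity_eq_iff_of_sigmaFinite (hk.mul hρm).aemeasurable
      measurable_one.aemeasurable).1 h1
  have h3 : (k ∘ S) * (ρ ∘ S) =ᵐ[ν] 1 := ae_of_ae_map hS.aemeasurable h2
  calc ν = ν.withDensity 1 := withDensity_one.symm
    _ = ν.withDensity ((k ∘ S) * (ρ ∘ S)) := (withDensity_congr_ae h3).symm
    _ = _ := by rw [withDensity_mul _ (hk.comp hS) (hρm.comp hS), ← hν']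

lemma map_fst_restrict_compProd_bool (ν : Measure α) [SFinite ν] (κ : Kernel α Bool)
    [IsSFiniteKernel κ] :
    ((ν ⊗ₘ κ).restrict {p | p.2 = true}).map Prod.fst = ν.withDensity (fun a => κ a {true}) := by
  ext s hs
  rw [Measure.map_apply measurable_fst hs, Measure.restrict_apply (measurable_fst hs),
    withDensity_apply _ hs, ← Measure.compProd_apply_prod hs (measurableSet_singleton true)]
  congr 1

end Generic

namespace Trial

variable {𝒰 𝒳 𝒵 𝒜 : Type u} [MeasurableSpace 𝒰] [MeasurableSpace 𝒳] [MeasurableSpace 𝒵]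
  [MeasurableSpace 𝒜]

lemma measurable_X : Measurable (X : Trial 𝒰 𝒳 𝒵 𝒜 → 𝒳) := by unfold X; fun_prop
lemma measurable_Z : Measurable (Z : Trial 𝒰 𝒳 𝒵 𝒜 → 𝒵) := by unfold Z; fun_prop
lemma measurable_A : Measurable (A : Trial 𝒰 𝒳 𝒵 𝒜 → 𝒜) := by unfold A; fun_prop
lemma measurable_noise : Measurable (noise : Trial 𝒰 𝒳 𝒵 𝒜 → ℝ) := by unfold noise; fun_prop
lemma measurable_RZ : Measurable (RZ : Trial 𝒰 𝒳 𝒵 𝒜 → Bool) := by unfold RZ; fun_prop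
lemma measurable_RX : Measurable (RX : Trial 𝒰 𝒳 𝒵 𝒜 → Bool) := by unfold RX; fun_prop

lemma measurableSet_RZ : MeasurableSet {ω : Trial 𝒰 𝒳 𝒵 𝒜 | ω.RZ = true} :=
  measurable_RZ (measurableSet_singleton true)

lemma measurableSet_RX_RZ : MeasurableSet {ω : Trial 𝒰 𝒳 𝒵 𝒜 | ω.RX = true ∧ ω.RZ = true} :=
  (measurable_RX (measurableSet_singleton true)).inter measurableSet_RZ

end Trial

namespace CCBIV

variable {𝒰 𝒳 𝒵 𝒜 : Type u} [MeasurableSpace 𝒰] [MeasurableSpace 𝒳] [MeasurableSpace 𝒵]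
  [MeasurableSpace 𝒜] (M : CCBIV 𝒰 𝒳 𝒵 𝒜)

instance : IsProbabilityMeasure M.ctx := M.prob_ctx
instance : IsMarkovKernel M.latent := M.markov_latent
instance : IsMarkovKernel M.behavior := M.markov_behavior
instance : IsMarkovKernel M.missZ := M.markov_missZ
instance : IsMarkovKernel M.missX := M.markov_missX

instance : IsProbabilityMeasure M.obs := by unfold obs; infer_instance

lemma measurable_Y : Measurable M.Y :=
  (M.measurable_f.comp (Trial.measurable_A.prodMk Trial.measurable_X)).add Trial.measurable_noise

/-- The law of `((X, (U, Z, ε)), A)` in the observational process. -/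
def core : Measure ((𝒳 × (𝒰 × 𝒵 × ℝ)) × 𝒜) :=
  (M.ctx ⊗ₘ M.latent) ⊗ₘ M.behavior.comap
    (fun p : 𝒳 × (𝒰 × 𝒵 × ℝ) => (p.2.1, p.1, p.2.2.1)) (by fun_prop)

instance : IsProbabilityMeasure M.core := by unfold core; infer_instance

/-- The law of `(((X, (U, Z, ε)), A), R_Z)` in the observational process. -/
def coreRZ : Measure (((𝒳 × (𝒰 × 𝒵 × ℝ)) × 𝒜) × Bool) :=
  M.core ⊗ₘ M.missZ.comap (fun p : (𝒳 × (𝒰 × 𝒵 × ℝ)) × 𝒜 => (p.1.2.2.1, p.1.1)) (by fun_prop)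

instance : IsProbabilityMeasure M.coreRZ := by unfold coreRZ; infer_instance

lemma obs_eq_compProd : M.obs = M.coreRZ ⊗ₘ M.missX.comap
    (fun p : ((𝒳 × (𝒰 × 𝒵 × ℝ)) × 𝒜) × Bool => (p.1.1.2.2.1, p.1.1.1, p.1.2)) (by fun_prop) :=
  rfl

lemma map_restrict_RZ_eq : (M.obs.restrict {ω | ω.RZ = true}).map (fun ω => ω.1.1)
    = (M.coreRZ.restrict {p | p.2 = true}).map Prod.fst := by
  have hs : MeasurableSet {p : ((𝒳 × (𝒰 × 𝒵 × ℝ)) × 𝒜) × Bool | p.2 = true} :=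
    measurable_snd (measurableSet_singleton true)
  have h : (M.obs.restrict (Prod.fst ⁻¹' {p | p.2 = true})).map Prod.fst
      = M.coreRZ.restrict {p | p.2 = true} := by
    rw [← Measure.restrict_map measurable_fst hs]
    congr 1
    rw [obs_eq_compProd]
    exact Measure.fst_compProd _ _
  rw [← h, Measure.map_map measurable_fst measurable_fst]
  rfl

/-- The law of `((X, (U, Z, ε)), A)` given that the instrument is recorded, up to a constant. -/
lemma map_restrict_RZ : (M.obs.restrict {ω | ω.RZ = true}).map (fun ω => ω.1.1)
    = M.core.withDensity (fun j => M.missZ (j.1.2.2.1, j.1.1) {true}) := by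
  rw [map_restrict_RZ_eq, coreRZ, map_fst_restrict_compProd_bool]
  rfl

/-- The law of `((X, (U, Z, ε)), A)` given that instrument and context are recorded, up to a
constant. -/
lemma map_restrict_RX_RZ :
    (M.obs.restrict {ω | ω.RX = true ∧ ω.RZ = true}).map (fun ω => ω.1.1)
    = ((M.obs.restrict {ω | ω.RZ = true}).map (fun ω => ω.1.1)).withDensity
        (fun j => M.missX (j.1.2.2.1, j.1.1, j.2) {true}) := by
  have hs : MeasurableSet {p : ((𝒳 × (𝒰 × 𝒵 × ℝ)) × 𝒜) × Bool | p.2 = true} :=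
    measurable_snd (measurableSet_singleton true)
  have hk : Measurable (fun j : (𝒳 × (𝒰 × 𝒵 × ℝ)) × 𝒜 => M.missX (j.1.2.2.1, j.1.1, j.2) {true}) :=
    (M.missX.measurable_coe (measurableSet_singleton true)).comp (by fun_prop)
  have h : (M.obs.restrict {ω | ω.RX = true ∧ ω.RZ = true}).map Prod.fst
      = (M.coreRZ.restrict {p | p.2 = true}).withDensity
        ((fun j => M.missX (j.1.2.2.1, j.1.1, j.2) {true}) ∘ Prod.fst) := by
    have e : {ω : Trial 𝒰 𝒳 𝒵 𝒜 | ω.RX = true ∧ ω.RZ = true}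
        = Prod.fst ⁻¹' {p : ((𝒳 × (𝒰 × 𝒵 × ℝ)) × 𝒜) × Bool | p.2 = true} ∩ {ω | ω.2 = true} := by
      ext ω
      exact and_comm
    rw [e, ← Measure.restrict_restrict (measurable_fst hs), ← Measure.restrict_map measurable_fst hs,
      obs_eq_compProd, map_fst_restrict_compProd_bool, restrict_withDensity hs]
    rfl
  rw [map_restrict_RZ_eq, ← map_withDensity_comp measurable_fst hk, ← h,
    Measure.map_map measurable_fst measurable_fst]
  rfl

/-- The law of `((X, (U, Z, ε)), A)` given `R_Z = 1`. -/
lemma map_obsZ : M.obsZ.map (fun ω => ω.1.1) = (M.obs {ω | ω.RZ = true})⁻¹ •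
    M.core.withDensity (fun j => M.missZ (j.1.2.2.1, j.1.1) {true}) := by
  rw [obsZ, ProbabilityTheory.cond, Measure.map_smul, map_restrict_RZ]

/-- The law of `((X, (U, Z, ε)), A)` given `R_X = R_Z = 1` has a density with respect to its law
given `R_Z = 1`, which depends on `(A, X, Z)` only. -/
lemma map_obsXZ (h : M.obs {ω | ω.RZ = true} ≠ 0) :
    M.obsXZ.map (fun ω => ω.1.1) = (M.obsZ.map (fun ω => ω.1.1)).withDensity
      ((fun q : 𝒜 × 𝒳 × 𝒵 => (M.obs {ω | ω.RX = true ∧ ω.RZ = true})⁻¹ *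
        M.obs {ω | ω.RZ = true} * M.missX (q.2.2, q.2.1, q.1) {true}) ∘
        fun j : (𝒳 × (𝒰 × 𝒵 × ℝ)) × 𝒜 => (j.2, j.1.1, j.1.2.2.1)) := by
  have hk : Measurable (fun j : (𝒳 × (𝒰 × 𝒵 × ℝ)) × 𝒜 => M.missX (j.1.2.2.1, j.1.1, j.2) {true}) :=
    (M.missX.measurable_coe (measurableSet_singleton true)).comp (by fun_prop)
  have e : M.obs.restrict {ω | ω.RZ = true} = M.obs {ω | ω.RZ = true} • M.obsZ := by
    rw [obsZ, ProbabilityTheory.cond, smul_smul, ENNReal.mul_inv_cancel h (measure_ne_top _ _),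
      one_smul]
  rw [obsXZ, ProbabilityTheory.cond, Measure.map_smul, map_restrict_RX_RZ, e, Measure.map_smul,
    withDensity_smul_measure, smul_smul, ← withDensity_smul _ hk]
  rfl

/-- The laws of `((X, A), (U, Z, ε))` in the interventional process. -/
lemma map_interv (ptilde : Measure 𝒳) [SFinite ptilde] (π : Kernel 𝒳 𝒜) [IsSFiniteKernel π] :
    (M.interv ptilde π).map (fun p => ((p.1.1, p.2), p.1.2))
      = (ptilde ⊗ₘ π) ⊗ₘ M.latent.comap Prod.fst measurable_fst := by
  refine Measure.ext_of_lintegral _ fun F hF => ?_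
  have hm : Measurable (fun p : (𝒳 × (𝒰 × 𝒵 × ℝ)) × 𝒜 => ((p.1.1, p.2), p.1.2)) := by fun_prop
  have hFm : Measurable (fun p : (𝒳 × (𝒰 × 𝒵 × ℝ)) × 𝒜 => F ((p.1.1, p.2), p.1.2)) := hF.comp hm
  rw [lintegral_map hF hm, interv, Measure.lintegral_compProd hFm,
    Measure.lintegral_compProd hFm.lintegral_kernel_prod_right',
    Measure.lintegral_compProd hF,
    Measure.lintegral_compProd hF.lintegral_kernel_prod_right']
  refine lintegral_congr fun x => ?_
  simp only [Kernel.comap_apply]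
  -- Given the context, the policy ignores the latent variables, so treatment and latent variables
  -- may be integrated in either order.
  exact lintegral_lintegral_swap (hF.comp (by fun_prop :
    Measurable fun q : (𝒰 × 𝒵 × ℝ) × 𝒜 => ((x, q.2), q.1))).aemeasurable

end CCBIV

end

noncomputable section

namespace CCBIV

variable {𝒰 𝒳 𝒵 𝒜 : Type u} [MeasurableSpace 𝒰] [MeasurableSpace 𝒳] [MeasurableSpace 𝒵]
  [MeasurableSpace 𝒜] (M : CCBIV 𝒰 𝒳 𝒵 𝒜)

/-! ### Non-degeneracy of the recording events. -/

section Sampling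

/-- Conditioning on a null event gives the zero measure, under which every conditional expectation
vanishes; completeness with `σ = 1` would then force `1 = 0` almost surely. -/
lemma prob_RZ_ne_zero (hM : M.ValidIV) : M.obs {ω | ω.RZ = true} ≠ 0 := by
  intro h
  have h0 : M.obsZ = 0 := cond_eq_zero_of_meas_eq_zero h
  have h1 := (hM.complete (fun _ => 1) measurable_const (by rw [h0]; exact integrable_zero_measure)).1
    (by rw [h0]; simp [Filter.EventuallyEq])
  simp only [one_ne_zero, eventually_false_iff_eq_bot, ae_eq_bot] at h1
  exact IsProbabilityMeasure.ne_zero M.obs h1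

lemma isProbabilityMeasure_obsZ (hM : M.ValidIV) : IsProbabilityMeasure M.obsZ :=
  cond_isProbabilityMeasure (M.prob_RZ_ne_zero hM)

lemma prob_RX_RZ_ne_zero [IsProbabilityMeasure M.obsZ]
    (hac : M.obsZ.map (fun ω => (ω.A, ω.X, ω.Z)) ≪ M.obsXZ.map (fun ω => (ω.A, ω.X, ω.Z))) :
    M.obs {ω | ω.RX = true ∧ ω.RZ = true} ≠ 0 := by
  intro h
  have h0 : M.obsXZ = 0 := cond_eq_zero_of_meas_eq_zero h
  rw [h0, Measure.map_zero, Measure.absolutelyContinuous_zero_iff, Measure.map_eq_zero_iff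
    (Trial.measurable_A.prodMk
      (Trial.measurable_X.prodMk Trial.measurable_Z)).aemeasurable] at hac
  exact IsProbabilityMeasure.ne_zero M.obsZ hac

lemma obsXZ_absolutelyContinuous : M.obsXZ ≪ M.obsZ := by
  refine Measure.AbsolutelyContinuous.mk fun s hs h => ?_
  rw [obsZ, cond_apply Trial.measurableSet_RZ] at h
  rw [obsXZ, cond_apply Trial.measurableSet_RX_RZ]
  rcases mul_eq_zero.1 h with h | h
  · exact absurd h (ENNReal.inv_ne_zero.2 (measure_ne_top _ _))
  · have h' : M.obs ({ω | ω.RX = true ∧ ω.RZ = true} ∩ s) = 0 :=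
      measure_mono_null (Set.inter_subset_inter_left _ fun ω h => h.2) h
    rw [h', mul_zero]

lemma measurable_obs₁ : Measurable (fun ω : Trial 𝒰 𝒳 𝒵 𝒜 => (M.Y ω, ω.A, ω.Z)) :=
  M.measurable_Y.prodMk (Trial.measurable_A.prodMk Trial.measurable_Z)

lemma measurable_obs₂ : Measurable (fun ω : Trial 𝒰 𝒳 𝒵 𝒜 => (ω.X, M.Y ω, ω.A, ω.Z)) :=
  Trial.measurable_X.prodMk M.measurable_obs₁

end Sampling

/-! ### Policy values as integrals of the conditional average treatment effect. -/

section Value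

lemma measurable_structural : Measurable (fun q : (𝒳 × 𝒜) × (𝒰 × 𝒵 × ℝ) =>
    M.f (q.1.2, q.1.1) + q.2.2.2) :=
  (M.measurable_f.comp (by fun_prop)).add (by fun_prop)

lemma measurable_cate : Measurable M.cate := by
  have h := M.measurable_structural.stronglyMeasurable.integral_kernel_prod_right'
    (κ := M.latent.comap Prod.fst (measurable_fst : Measurable (Prod.fst : 𝒳 × 𝒜 → 𝒳)))
  exact h.measurable

lemma measurable_intervY : Measurable M.intervY :=
  (M.measurable_f.comp (by fun_prop)).add (by fun_prop)

variable (ptilde : Measure 𝒳) [SFinite ptilde] (π : Kernel 𝒳 𝒜) [IsMarkovKernel π]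

lemma integrable_structural (hint : Integrable M.intervY (M.interv ptilde π)) :
    Integrable (fun q : (𝒳 × 𝒜) × (𝒰 × 𝒵 × ℝ) => M.f (q.1.2, q.1.1) + q.2.2.2)
      ((ptilde ⊗ₘ π) ⊗ₘ M.latent.comap Prod.fst measurable_fst) := by
  rw [← map_interv, integrable_map_measure M.measurable_structural.aestronglyMeasurable
    (by fun_prop)]
  exact hint

lemma integrable_cate (hint : Integrable M.intervY (M.interv ptilde π)) :
    Integrable M.cate (ptilde ⊗ₘ π) :=
  (M.integrable_structural ptilde π hint).integral_compProd

/-- The average reward is the integral of the conditional average treatment effect. -/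
lemma value_eq_integral_cate (hint : Integrable M.intervY (M.interv ptilde π)) :
    M.value ptilde π = ∫ p, M.cate p ∂(ptilde ⊗ₘ π) := by
  have h := Measure.integral_compProd (M.integrable_structural ptilde π hint)
  rw [← map_interv, integral_map (by fun_prop) M.measurable_structural.aestronglyMeasurable] at h
  exact h

lemma valueOf_eq_integral {g : 𝒳 × 𝒜 → ℝ} (hg : Measurable g) :
    M.valueOf ptilde g π = ∫ p, g p ∂(ptilde ⊗ₘ π) := by
  have h : ptilde ⊗ₘ π = (M.interv ptilde π).map (fun p => (p.1.1, p.2)) := by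
    rw [← Measure.fst_compProd (ptilde ⊗ₘ π)
      (M.latent.comap Prod.fst (measurable_fst : Measurable (Prod.fst : 𝒳 × 𝒜 → 𝒳))),
      ← map_interv, Measure.fst, Measure.map_map measurable_fst (by fun_prop)]
    rfl
  rw [h, integral_map (by fun_prop) hg.aestronglyMeasurable]
  rfl

end Value

/-! ### Orthogonality of the instrument to the centered noise. -/

section Confounding

/-- The conditional mean of the noise given the context. -/
def noiseMean (x : 𝒳) : ℝ := ∫ l, l.2.2 ∂(M.latent x)

lemma measurable_noiseMean : Measurable M.noiseMean :=
  (StronglyMeasurable.integral_kernel_prod_right' (κ := M.latent)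
    (f := fun p : 𝒳 × (𝒰 × 𝒵 × ℝ) => p.2.2.2)
    (Measurable.stronglyMeasurable (by fun_prop))).measurable

lemma ae_integrable_noise (hM : M.ValidIV) :
    ∀ᵐ x ∂M.ctx, Integrable (fun l : 𝒰 × 𝒵 × ℝ => l.2.2) (M.latent x) :=
  ((Measure.integrable_compProd_iff hM.integrable_noise.aestronglyMeasurable).1
    hM.integrable_noise).1

lemma ae_cate_eq (hM : M.ValidIV) :
    ∀ᵐ x ∂M.ctx, ∀ a, M.cate (x, a) = M.f (a, x) + M.noiseMean x := by
  filter_upwards [M.ae_integrable_noise hM] with x hx a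
  rw [cate, integral_add (integrable_const _) hx]
  simp [noiseMean]

lemma ae_core_of_ae_ctx {p : 𝒳 → Prop} (h : ∀ᵐ x ∂M.ctx, p x) : ∀ᵐ j ∂M.core, p j.1.1 := by
  have h1 : M.core.map Prod.fst = M.ctx ⊗ₘ M.latent := Measure.fst_compProd _ _
  have h2 : (M.ctx ⊗ₘ M.latent).map Prod.fst = M.ctx := Measure.fst_compProd _ _
  rw [← h2] at h
  have h3 := ae_of_ae_map measurable_fst.aemeasurable h
  rw [← h1] at h3
  exact ae_of_ae_map measurable_fst.aemeasurable h3

/-- The instrument is uncorrelated with the centered reward, given that it is recorded. -/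
lemma integral_sub_cate_mul_eq_zero (hM : M.ValidIV) {b : 𝒵 → ℝ} (hb : Measurable b)
    (hint : Integrable (fun ω : Trial 𝒰 𝒳 𝒵 𝒜 => (M.Y ω - M.cate (ω.X, ω.A)) * b ω.Z) M.obsZ) :
    ∫ ω, (M.Y ω - M.cate (ω.X, ω.A)) * b ω.Z ∂M.obsZ = 0 := by
  have hmeas : Measurable (fun j : (𝒳 × (𝒰 × 𝒵 × ℝ)) × 𝒜 =>
      (M.intervY j - M.cate (j.1.1, j.2)) * b j.1.2.2.1) :=
    (M.measurable_intervY.sub (M.measurable_cate.comp (by fun_prop))).mul (hb.comp (by fun_prop))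
  have hπ : Measurable (fun ω : Trial 𝒰 𝒳 𝒵 𝒜 => ω.1.1) := by fun_prop
  have hm : Measurable (fun q : 𝒵 × 𝒳 => M.missZ q {true}) :=
    M.missZ.measurable_coe (measurableSet_singleton true)
  have hmj : Measurable (fun j : (𝒳 × (𝒰 × 𝒵 × ℝ)) × 𝒜 => M.missZ (j.1.2.2.1, j.1.1) {true}) :=
    hm.comp (by fun_prop)
  have hc0 : (M.obs {ω | ω.RZ = true})⁻¹ ≠ 0 := ENNReal.inv_ne_zero.2 (measure_ne_top _ _)
  have hct : (M.obs {ω | ω.RZ = true})⁻¹ ≠ ⊤ := ENNReal.inv_ne_top.2 (M.prob_RZ_ne_zero hM)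
  have hlt : ∀ᵐ j ∂M.core, M.missZ (j.1.2.2.1, j.1.1) {true} < ⊤ :=
    ae_of_all _ fun j => measure_lt_top _ _
  -- Subtracting `g*` cancels `f (A, X)`. What remains involves `(X, Z, ε)` only, so the confounded
  -- treatment can be integrated out.
  have hcore : ∀ᵐ j ∂M.core, (M.missZ (j.1.2.2.1, j.1.1) {true}).toReal •
      ((M.intervY j - M.cate (j.1.1, j.2)) * b j.1.2.2.1)
      = (M.missZ (j.1.2.2.1, j.1.1) {true}).toReal * b j.1.2.2.1
        * (j.1.2.2.2 - M.noiseMean j.1.1) := by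
    filter_upwards [M.ae_core_of_ae_ctx (M.ae_cate_eq hM)] with j hj
    rw [hj, intervY, smul_eq_mul]
    ring
  have hmeas' : Measurable (fun p : 𝒳 × (𝒰 × 𝒵 × ℝ) =>
      (M.missZ (p.2.2.1, p.1) {true}).toReal * b p.2.2.1 * (p.2.2.2 - M.noiseMean p.1)) := by
    have h1 : Measurable (fun p : 𝒳 × (𝒰 × 𝒵 × ℝ) => (M.missZ (p.2.2.1, p.1) {true}).toReal) :=
      (hm.comp (by fun_prop)).ennreal_toReal
    have h2 : Measurable (fun p : 𝒳 × (𝒰 × 𝒵 × ℝ) => M.noiseMean p.1) :=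
      M.measurable_noiseMean.comp measurable_fst
    exact (h1.mul (hb.comp (by fun_prop))).mul ((by fun_prop : Measurable
      fun p : 𝒳 × (𝒰 × 𝒵 × ℝ) => p.2.2.2).sub h2)
  have hfst : M.core.map Prod.fst = M.ctx ⊗ₘ M.latent := Measure.fst_compProd _ _
  have e1 : ∫ ω, (M.Y ω - M.cate (ω.X, ω.A)) * b ω.Z ∂M.obsZ
      = ∫ j, (M.intervY j - M.cate (j.1.1, j.2)) * b j.1.2.2.1 ∂(M.obsZ.map fun ω => ω.1.1) :=
    (integral_map hπ.aemeasurable hmeas.aestronglyMeasurable).symm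
  have i1 : Integrable (fun j : (𝒳 × (𝒰 × 𝒵 × ℝ)) × 𝒜 =>
      (M.intervY j - M.cate (j.1.1, j.2)) * b j.1.2.2.1) (M.obsZ.map fun ω => ω.1.1) :=
    (integrable_map_measure hmeas.aestronglyMeasurable hπ.aemeasurable).2 hint
  rw [map_obsZ, integrable_smul_measure hc0 hct,
    integrable_withDensity_iff_integrable_smul' hmj hlt] at i1
  have i2 : Integrable (fun p : 𝒳 × (𝒰 × 𝒵 × ℝ) => (M.missZ (p.2.2.1, p.1) {true}).toReal
      * b p.2.2.1 * (p.2.2.2 - M.noiseMean p.1)) (M.ctx ⊗ₘ M.latent) := by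
    rw [← hfst, integrable_map_measure hmeas'.aestronglyMeasurable measurable_fst.aemeasurable]
    exact i1.congr hcore
  rw [e1, map_obsZ, integral_smul_measure,
    integral_withDensity_eq_integral_toReal_smul hmj hlt, integral_congr_ae hcore,
    ← integral_map (f := fun p : 𝒳 × (𝒰 × 𝒵 × ℝ) => (M.missZ (p.2.2.1, p.1) {true}).toReal
      * b p.2.2.1 * (p.2.2.2 - M.noiseMean p.1)) measurable_fst.aemeasurable
      hmeas'.aestronglyMeasurable, hfst, Measure.integral_compProd i2]
  rw [integral_eq_zero_of_ae, smul_zero]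
  -- For fixed `x` the recording probability and `b` form a function of `Z` alone. IV independence
  -- factors the integral, and the centered noise has mean zero.
  filter_upwards [hM.indep, M.ae_integrable_noise hM] with x hx hn
  have hf : Measurable (fun z => (M.missZ (z, x) {true}).toReal * b z) :=
    (hm.comp (by fun_prop)).ennreal_toReal.mul hb
  have hg : Measurable (fun q : 𝒰 × ℝ => q.2 - M.noiseMean x) := by fun_prop
  have h := hx.integral_fun_comp_mul_comp (by fun_prop) (by fun_prop)
    hf.aestronglyMeasurable hg.aestronglyMeasurable
  simp only at h
  rw [h, integral_sub hn (integrable_const _)]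
  simp [noiseMean]

end Confounding

end CCBIV

end

noncomputable section

namespace CCBIV

variable {𝒰 𝒳 𝒵 𝒜 : Type u} [MeasurableSpace 𝒰] [MeasurableSpace 𝒳] [MeasurableSpace 𝒵]
  [MeasurableSpace 𝒜] (M : CCBIV 𝒰 𝒳 𝒵 𝒜)

/-! ### Importance weights for the policy shift and for the missing contexts. -/

section Shift

/-- Change of measure from the interventional to the observational process. -/
lemma integral_compProd_eq_integral_mul_shift [IsProbabilityMeasure M.obsZ] {ptilde : Measure 𝒳}
    [IsProbabilityMeasure ptilde] {π : Kernel 𝒳 𝒜} [IsMarkovKernel π] {b₁ : 𝒵 → ℝ}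
    (hshift : IsShift M ptilde π b₁)
    (hb2 : MemLp (fun ω : Trial 𝒰 𝒳 𝒵 𝒜 => b₁ ω.Z) 2 M.obsZ) {φ : 𝒳 × 𝒜 → ℝ} (hφ : Measurable φ)
    (hφ2 : MemLp (fun ω : Trial 𝒰 𝒳 𝒵 𝒜 => φ (ω.X, ω.A)) 2 M.obsZ) :
    ∫ p, φ p ∂(ptilde ⊗ₘ π) = ∫ ω, φ (ω.X, ω.A) * b₁ ω.Z ∂M.obsZ := by
  have hXA : Measurable (fun ω : Trial 𝒰 𝒳 𝒵 𝒜 => (ω.X, ω.A)) :=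
    Trial.measurable_X.prodMk Trial.measurable_A
  have hAX : Measurable (fun ω : Trial 𝒰 𝒳 𝒵 𝒜 => (ω.A, ω.X)) :=
    Trial.measurable_A.prodMk Trial.measurable_X
  have hsm : StronglyMeasurable[MeasurableSpace.comap
      (fun ω : Trial 𝒰 𝒳 𝒵 𝒜 => (ω.A, ω.X)) inferInstance] (fun ω => φ (ω.X, ω.A)) :=
    ((hφ.comp measurable_swap).comp (comap_measurable _)).stronglyMeasurable
  have hpull := condExp_mul_of_stronglyMeasurable_left hsm (hφ2.integrable_mul hb2)
    (hb2.integrable one_le_two)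
  have hd : Measurable (fun p => ((ptilde ⊗ₘ π).rnDeriv
      (M.obsZ.map (fun ω => (ω.X, ω.A))) p).toReal • φ p) :=
    (Measure.measurable_rnDeriv _ _).ennreal_toReal.smul hφ
  calc ∫ p, φ p ∂(ptilde ⊗ₘ π)
      = ∫ p, ((ptilde ⊗ₘ π).rnDeriv (M.obsZ.map (fun ω => (ω.X, ω.A))) p).toReal • φ p
          ∂(M.obsZ.map (fun ω => (ω.X, ω.A))) := (integral_rnDeriv_smul hshift.1).symm
    _ = ∫ ω, ((ptilde ⊗ₘ π).rnDeriv (M.obsZ.map (fun ω => (ω.X, ω.A))) (ω.X, ω.A)).toReal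
          • φ (ω.X, ω.A) ∂M.obsZ := integral_map hXA.aemeasurable hd.aestronglyMeasurable
    _ = ∫ ω, (M.obsZ[(fun ω => φ (ω.X, ω.A)) * (fun ω => b₁ ω.Z) | MeasurableSpace.comap
          (fun ω : Trial 𝒰 𝒳 𝒵 𝒜 => (ω.A, ω.X)) inferInstance]) ω ∂M.obsZ := by
        refine integral_congr_ae ?_
        filter_upwards [hpull, hshift.2] with ω h1 h2
        rw [h1, Pi.mul_apply, h2, smul_eq_mul, mul_comm]
    _ = _ := integral_condExp hAX.comap_le

/-- A weight towards a probability law has mean `1`, hence `L²` norm at least `1`. This lets the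
unweighted error `εH` be absorbed into the weighted bound. -/
lemma one_le_l2norm_shift [IsProbabilityMeasure M.obsZ] {ptilde : Measure 𝒳}
    [IsProbabilityMeasure ptilde] {π : Kernel 𝒳 𝒜} [IsMarkovKernel π] {b₁ : 𝒵 → ℝ}
    (hb : Measurable b₁) (hshift : IsShift M ptilde π b₁)
    (hb2 : MemLp (fun ω : Trial 𝒰 𝒳 𝒵 𝒜 => b₁ ω.Z) 2 M.obsZ)
    (hb2' : MemLp (fun w => b₁ (inst₁ w)) 2 M.μ₁) :
    1 ≤ l2norm M.μ₁ (fun w => b₁ (inst₁ w)) := by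
  have : IsProbabilityMeasure M.μ₁ := Measure.isProbabilityMeasure_map M.measurable_obs₁.aemeasurable
  have h := M.integral_compProd_eq_integral_mul_shift hshift hb2 (φ := fun _ => 1)
    measurable_const (memLp_const 1)
  have e : ∫ w, 1 * b₁ (inst₁ w) ∂M.μ₁ = 1 := by
    refine (integral_map M.measurable_obs₁.aemeasurable
      ((hb.comp measurable_inst₁).const_mul 1).aestronglyMeasurable).trans (h.symm.trans ?_)
    simp
  have h2 := abs_integral_mul_le_l2norm (memLp_const (1 : ℝ)) hb2'
  rw [e, abs_one] at h2
  simpa [l2norm] using h2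

/-- The importance weight for the context indicator turns `P_ob (· | R_Z = 1)` into
`P_ob (· | R_X = R_Z = 1)`. -/
lemma integral_mul_shift_eq_integral_b₂of (hM : M.ValidIV)
    (hac : M.obsZ.map (fun ω => (ω.A, ω.X, ω.Z)) ≪ M.obsXZ.map (fun ω => (ω.A, ω.X, ω.Z)))
    {b₁ : 𝒵 → ℝ} (hb : Measurable b₁) {φ : 𝒳 × ℝ × 𝒜 × 𝒵 → ℝ} (hφ : Measurable φ) :
    ∫ ω, φ (ω.X, M.Y ω, ω.A, ω.Z) * b₁ ω.Z ∂M.obsZ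
      = ∫ w, φ w * b₂of M b₁ (inst₂ w) ∂M.μ₂ := by
  have := M.isProbabilityMeasure_obsZ hM
  have hXZ : IsProbabilityMeasure M.obsXZ :=
    cond_isProbabilityMeasure (M.prob_RX_RZ_ne_zero hac)
  have hπ : Measurable (fun ω : Trial 𝒰 𝒳 𝒵 𝒜 => ω.1.1) := by fun_prop
  have hS : Measurable (fun j : (𝒳 × (𝒰 × 𝒵 × ℝ)) × 𝒜 => (j.2, j.1.1, j.1.2.2.1)) := by fun_prop
  have hk : Measurable (fun q : 𝒜 × 𝒳 × 𝒵 => (M.obs {ω | ω.RX = true ∧ ω.RZ = true})⁻¹ *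
        M.obs {ω | ω.RZ = true} * M.missX (q.2.2, q.2.1, q.1) {true}) :=
    ((M.missX.measurable_coe (measurableSet_singleton true)).comp (by fun_prop)).const_mul _
  have := Measure.isProbabilityMeasure_map (μ := M.obsZ) hπ.aemeasurable
  have := Measure.isProbabilityMeasure_map (μ := M.obsXZ) hπ.aemeasurable
  have hZmap : (M.obsZ.map fun ω => ω.1.1).map (fun j => (j.2, j.1.1, j.1.2.2.1))
      = M.obsZ.map (fun ω => (ω.A, ω.X, ω.Z)) := Measure.map_map hS hπ
  have hXZmap : (M.obsXZ.map fun ω => ω.1.1).map (fun j => (j.2, j.1.1, j.1.2.2.1))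
      = M.obsXZ.map (fun ω => (ω.A, ω.X, ω.Z)) := Measure.map_map hS hπ
  -- `R_X` depends on `(Z, X, A)` only, so the density ratio of `(A, X, Z)` reweights the joint law
  -- including the reward.
  have hden := eq_withDensity_rnDeriv_comp hS hk (M.map_obsXZ (M.prob_RZ_ne_zero hM))
    (by rw [hZmap, hXZmap]; exact hac)
  rw [hZmap, hXZmap] at hden
  set ρ := (M.obsZ.map (fun ω => (ω.A, ω.X, ω.Z))).rnDeriv
    (M.obsXZ.map (fun ω => (ω.A, ω.X, ω.Z))) with hρ
  have hρm : Measurable ρ := Measure.measurable_rnDeriv _ _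
  have hlt : ∀ᵐ j ∂(M.obsXZ.map fun ω => ω.1.1), (ρ ∘ fun j => (j.2, j.1.1, j.1.2.2.1)) j < ⊤ := by
    refine ae_of_ae_map (p := fun q => ρ q < ⊤) hS.aemeasurable ?_
    rw [hXZmap]
    exact Measure.rnDeriv_lt_top _ _
  have hmY : Measurable (fun j : (𝒳 × (𝒰 × 𝒵 × ℝ)) × 𝒜 =>
      (j.1.1, M.intervY j, j.2, j.1.2.2.1)) := by
    have := M.measurable_intervY
    fun_prop
  have hm : Measurable (fun j : (𝒳 × (𝒰 × 𝒵 × ℝ)) × 𝒜 =>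
      φ (j.1.1, M.intervY j, j.2, j.1.2.2.1) * b₁ j.1.2.2.1) :=
    (hφ.comp hmY).mul (hb.comp (by fun_prop))
  have hb₂ : Measurable (b₂of M b₁) :=
    (hb.comp (by fun_prop)).mul hρm.ennreal_toReal
  calc ∫ ω, φ (ω.X, M.Y ω, ω.A, ω.Z) * b₁ ω.Z ∂M.obsZ
      = ∫ j, φ (j.1.1, M.intervY j, j.2, j.1.2.2.1) * b₁ j.1.2.2.1 ∂(M.obsZ.map fun ω => ω.1.1) :=
        (integral_map hπ.aemeasurable hm.aestronglyMeasurable).symm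
    _ = ∫ j, ((ρ ∘ fun j => (j.2, j.1.1, j.1.2.2.1)) j).toReal •
          (φ (j.1.1, M.intervY j, j.2, j.1.2.2.1) * b₁ j.1.2.2.1)
          ∂(M.obsXZ.map fun ω => ω.1.1) := by
        rw [hden, integral_withDensity_eq_integral_toReal_smul (hρm.comp hS) hlt]
    _ = ∫ ω, (ρ (ω.A, ω.X, ω.Z)).toReal • (φ (ω.X, M.Y ω, ω.A, ω.Z) * b₁ ω.Z) ∂M.obsXZ :=
        integral_map hπ.aemeasurable
          ((hρm.comp hS).ennreal_toReal.smul hm).aestronglyMeasurable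
    _ = ∫ ω, φ (ω.X, M.Y ω, ω.A, ω.Z) * b₂of M b₁ (ω.A, ω.X, ω.Z) ∂M.obsXZ := by
        refine integral_congr_ae (ae_of_all _ fun ω => ?_)
        simp only [b₂of, smul_eq_mul, ← hρ]
        ring
    _ = _ := (integral_map M.measurable_obs₂.aemeasurable
        (hφ.mul (hb₂.comp measurable_inst₂)).aestronglyMeasurable).symm

end Shift

/-! ### Evaluation error as two weighted moment residuals. -/

section Identification

/-- `g*` is the conditional expectation of the square-integrable bridge function, and conditional
expectation contracts `L²`. -/
lemma memLp_cate (hbr : M.BridgeExists) :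
    MemLp (fun ω : Trial 𝒰 𝒳 𝒵 𝒜 => M.cate (ω.X, ω.A)) 2 M.obsZ := by
  obtain ⟨h₁, -, h2, heq⟩ := hbr
  exact (memLp_congr_ae heq).1 (h2.condExp one_le_two)

/-- The error of a hypothesis in evaluating the target policy, in terms of the two moment
equations. -/
lemma valueOf_sub_value_eq (hM : M.ValidIV) (hbr : M.BridgeExists)
    {ptilde : Measure 𝒳} [IsProbabilityMeasure ptilde] {π : Kernel 𝒳 𝒜} [IsMarkovKernel π]
    (hint : Integrable M.intervY (M.interv ptilde π)) {b₁ : 𝒵 → ℝ} (hb : Measurable b₁)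
    (hshift : IsShift M ptilde π b₁)
    (hac : M.obsZ.map (fun ω => (ω.A, ω.X, ω.Z)) ≪ M.obsXZ.map (fun ω => (ω.A, ω.X, ω.Z)))
    (hb2 : MemLp (fun w => b₁ (inst₁ w)) 2 M.μ₁)
    (hY : MemLp M.Y 2 M.obsZ) {Lh : ℝ}
    {h : (ℝ × 𝒜 × 𝒵 → ℝ) × (𝒳 × 𝒜 → ℝ)} (hm₁ : Measurable h.1) (hm₂ : Measurable h.2)
    (hbd₁ : ∀ w, |h.1 w| ≤ Lh) (hbd₂ : ∀ w, |h.2 w| ≤ Lh) :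
    M.valueOf ptilde h.2 π - M.value ptilde π
      = ∫ w, α₁ h w * b₁ (inst₁ w) ∂M.μ₁ + ∫ w, α₂ h w * b₂of M b₁ (inst₂ w) ∂M.μ₂ := by
  have := M.isProbabilityMeasure_obsZ hM
  have hXA : Measurable (fun ω : Trial 𝒰 𝒳 𝒵 𝒜 => (ω.X, ω.A)) :=
    Trial.measurable_X.prodMk Trial.measurable_A
  have hbZ : MemLp (fun ω : Trial 𝒰 𝒳 𝒵 𝒜 => b₁ ω.Z) 2 M.obsZ :=
    (memLp_map_measure_iff hb2.1 M.measurable_obs₁.aemeasurable).1 hb2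
  have hc2 := M.memLp_cate hbr
  have hg2 : MemLp (fun ω : Trial 𝒰 𝒳 𝒵 𝒜 => h.2 (ω.X, ω.A)) 2 M.obsZ :=
    MemLp.of_bound (hm₂.comp hXA).aestronglyMeasurable Lh (ae_of_all _ fun _ => hbd₂ _)
  have hh2 : MemLp (fun ω : Trial 𝒰 𝒳 𝒵 𝒜 => h.1 (M.Y ω, ω.A, ω.Z)) 2 M.obsZ :=
    MemLp.of_bound (hm₁.comp M.measurable_obs₁).aestronglyMeasurable Lh (ae_of_all _ fun _ => hbd₁ _)
  have i1 : Integrable (fun ω : Trial 𝒰 𝒳 𝒵 𝒜 => (M.Y ω - M.cate (ω.X, ω.A)) * b₁ ω.Z) M.obsZ :=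
    (hY.sub hc2).integrable_mul hbZ
  have i2 : Integrable (fun ω : Trial 𝒰 𝒳 𝒵 𝒜 =>
      (h.1 (M.Y ω, ω.A, ω.Z) - M.Y ω) * b₁ ω.Z) M.obsZ := (hh2.sub hY).integrable_mul hbZ
  have i3 : Integrable (fun ω : Trial 𝒰 𝒳 𝒵 𝒜 =>
      (h.2 (ω.X, ω.A) - h.1 (M.Y ω, ω.A, ω.Z)) * b₁ ω.Z) M.obsZ := (hg2.sub hh2).integrable_mul hbZ
  have hα₁ : Measurable (α₁ h) := hm₁.sub measurable_fst
  have hα₂ : Measurable (α₂ h) := (hm₂.comp (by fun_prop)).sub (hm₁.comp measurable_snd)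
  have e1 : ∫ w, α₁ h w * b₁ (inst₁ w) ∂M.μ₁
      = ∫ ω, (h.1 (M.Y ω, ω.A, ω.Z) - M.Y ω) * b₁ ω.Z ∂M.obsZ :=
    integral_map M.measurable_obs₁.aemeasurable
      (hα₁.mul (hb.comp measurable_inst₁)).aestronglyMeasurable
  have e2 := M.integral_mul_shift_eq_integral_b₂of hM hac hb hα₂
  have e3 := M.integral_sub_cate_mul_eq_zero hM hb i1
  have hgint : Integrable h.2 (ptilde ⊗ₘ π) :=
    Integrable.of_bound hm₂.aestronglyMeasurable Lh (ae_of_all _ hbd₂)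
  rw [M.valueOf_eq_integral ptilde π hm₂, M.value_eq_integral_cate ptilde π hint,
    ← integral_sub hgint (M.integrable_cate ptilde π hint),
    M.integral_compProd_eq_integral_mul_shift hshift hbZ (φ := fun p => h.2 p - M.cate p)
      (hm₂.sub M.measurable_cate) (hg2.sub hc2), e1, ← e2]
  -- The vanishing term `E[(Y - g*) b₁]` is inserted so that the sum telescopes to `g - g*`.
  rw [← add_zero (∫ ω, (h.1 (M.Y ω, ω.A, ω.Z) - M.Y ω) * b₁ ω.Z ∂M.obsZ), ← e3,
    ← integral_add i2 i1]
  simp only [α₂]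
  have i4 : Integrable (fun ω : Trial 𝒰 𝒳 𝒵 𝒜 => (h.1 (M.Y ω, ω.A, ω.Z) - M.Y ω) * b₁ ω.Z
    + (M.Y ω - M.cate (ω.X, ω.A)) * b₁ ω.Z) M.obsZ := i2.add i1
  rw [← integral_add i4 i3]
  refine integral_congr_ae (ae_of_all _ fun ω => ?_)
  ring

end Identification

end CCBIV

end

noncomputable section

/-! ### The event `𝓔` and the sub-optimality bound -/

section Residuals

variable {𝒳 𝒵 𝒜 : Type u}

lemma PointwiseSeparable.image_α₁ {H₁ : Set (ℝ × 𝒜 × 𝒵 → ℝ)} {𝒢 : Set (𝒳 × 𝒜 → ℝ)}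
    (h₁ : PointwiseSeparable H₁) (h₂ : PointwiseSeparable 𝒢) :
    PointwiseSeparable (α₁ '' (H₁ ×ˢ 𝒢)) := by
  obtain ⟨F₁, hF₁, hc₁, hs₁⟩ := h₁
  obtain ⟨F₂, hF₂, hc₂, hs₂⟩ := h₂
  refine ⟨α₁ '' (F₁ ×ˢ F₂), Set.image_mono (Set.prod_mono hF₁ hF₂), (hc₁.prod hc₂).image _, ?_⟩
  rintro _ ⟨h, hh, rfl⟩
  obtain ⟨s, hs, hs'⟩ := hs₁ h.1 hh.1
  -- `α₁` ignores the second component; an approximant is taken only to stay inside the countable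
  -- product.
  obtain ⟨t, ht, -⟩ := hs₂ h.2 hh.2
  exact ⟨fun n => α₁ (s n, t n), fun n => ⟨_, ⟨hs n, ht n⟩, rfl⟩,
    fun w => (hs' w).sub tendsto_const_nhds⟩

lemma PointwiseSeparable.image_α₂ {H₁ : Set (ℝ × 𝒜 × 𝒵 → ℝ)} {𝒢 : Set (𝒳 × 𝒜 → ℝ)}
    (h₁ : PointwiseSeparable H₁) (h₂ : PointwiseSeparable 𝒢) :
    PointwiseSeparable (α₂ '' (H₁ ×ˢ 𝒢)) := by
  obtain ⟨F₁, hF₁, hc₁, hs₁⟩ := h₁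
  obtain ⟨F₂, hF₂, hc₂, hs₂⟩ := h₂
  refine ⟨α₂ '' (F₁ ×ˢ F₂), Set.image_mono (Set.prod_mono hF₁ hF₂), (hc₁.prod hc₂).image _, ?_⟩
  rintro _ ⟨h, hh, rfl⟩
  obtain ⟨s, hs, hs'⟩ := hs₁ h.1 hh.1
  obtain ⟨t, ht, ht'⟩ := hs₂ h.2 hh.2
  exact ⟨fun n => α₂ (s n, t n), fun n => ⟨_, ⟨hs n, ht n⟩, rfl⟩,
    fun w => (ht' _).sub (hs' _)⟩

variable [MeasurableSpace 𝒵] [MeasurableSpace 𝒜] {h : (ℝ × 𝒜 × 𝒵 → ℝ) × (𝒳 × 𝒜 → ℝ)}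

lemma measurable_α₁ (h₁ : Measurable h.1) : Measurable (α₁ h) := h₁.sub measurable_fst

lemma measurable_α₂ [MeasurableSpace 𝒳] (h₁ : Measurable h.1) (h₂ : Measurable h.2) : Measurable (α₂ h) :=
  (h₂.comp (by fun_prop)).sub (h₁.comp measurable_snd)

end Residuals

section Event

variable {𝒰 𝒳 𝒵 𝒜 : Type u} [MeasurableSpace 𝒰] [MeasurableSpace 𝒳] [MeasurableSpace 𝒵]
  [MeasurableSpace 𝒜] (M : CCBIV 𝒰 𝒳 𝒵 𝒜)

lemma data₁_dataset {T : ℕ} (ω : Fin T → Trial 𝒰 𝒳 𝒵 𝒜) : data₁ (M.dataset ω)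
    = eventSample {ω | ω.RZ = true} (fun ω => (M.Y ω, ω.A, ω.Z)) ω := by
  funext t
  by_cases h : (ω t).RZ = true <;> simp [data₁, CCBIV.dataset, CCBIV.observe, eventSample, h]

lemma data₂_dataset {T : ℕ} (ω : Fin T → Trial 𝒰 𝒳 𝒵 𝒜) : data₂ (M.dataset ω)
    = eventSample {ω | ω.RX = true ∧ ω.RZ = true} (fun ω => (ω.X, M.Y ω, ω.A, ω.Z)) ω := by
  funext t
  by_cases h : (ω t).RZ = true <;> by_cases h' : (ω t).RX = true <;>
    simp [data₂, CCBIV.dataset, CCBIV.observe, eventSample, h, h']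

lemma ae_abs_le_μ₁ {LY : ℝ} (hY : ∀ᵐ ω ∂M.obsZ, |M.Y ω| ≤ LY) : ∀ᵐ w ∂M.μ₁, |w.1| ≤ LY := by
  rw [CCBIV.μ₁, ae_map_iff M.measurable_obs₁.aemeasurable
    (measurableSet_le (by fun_prop) measurable_const)]
  exact hY

lemma ae_abs_le_μ₂ {LY : ℝ} (hY : ∀ᵐ ω ∂M.obsZ, |M.Y ω| ≤ LY) : ∀ᵐ w ∂M.μ₂, |w.2.1| ≤ LY := by
  rw [CCBIV.μ₂, ae_map_iff M.measurable_obs₂.aemeasurable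
    (measurableSet_le (by fun_prop) measurable_const)]
  exact M.obsXZ_absolutelyContinuous.ae_le hY

variable {H₁ : Set (ℝ × 𝒜 × 𝒵 → ℝ)} {𝒢 : Set (𝒳 × 𝒜 → ℝ)} {Θ₁ : Set (𝒵 → ℝ)}
  {Θ₂ : Set (𝒜 × 𝒳 × 𝒵 → ℝ)} {Lα Lθ LY Lh : ℝ}

/-- The event `𝓔` has probability at least `1 - 4 ξ`. -/
lemma measure_not_goodEvent_le [IsProbabilityMeasure M.μ₁] [IsProbabilityMeasure M.μ₂]
    {C₀ : ℝ} (hLα : 0 < Lα) (hLθ : 0 < Lθ) (hC₁ : devConst (Lα * Lθ) ≤ C₀) (hC₂ : devConst Lθ ≤ C₀)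
    (hH₁ : HypothesisClass H₁ Lh) (h𝒢 : HypothesisClass 𝒢 Lh)
    (hΘ₁ : TestClass Θ₁ Lθ) (hΘ₂ : TestClass Θ₂ Lθ) (hY : ∀ᵐ ω ∂M.obsZ, |M.Y ω| ≤ LY)
    (hα₁ : ∀ h ∈ H₁ ×ˢ 𝒢, ∀ w, |w.1| ≤ LY → |α₁ h w| ≤ Lα)
    (hα₂ : ∀ h ∈ H₁ ×ˢ 𝒢, ∀ w, |w.2.1| ≤ LY → |α₂ h w| ≤ Lα)
    {T : ℕ} {ξ : ℝ} (hξ0 : 0 < ξ) (hξ1 : ξ < 1) {η₁ η₂ : Dataset 𝒳 𝒵 𝒜 T → ℝ}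
    (hη₁ : ∀ d, BoundsCriticalRadius (data₁ d) (α₁ '' (H₁ ×ˢ 𝒢)) inst₁ Θ₁ Lα Lθ C₀ 32 ξ (η₁ d))
    (hη₂ : ∀ d, BoundsCriticalRadius (data₂ d) (α₂ '' (H₁ ×ˢ 𝒢)) inst₂ Θ₂ Lα Lθ C₀ 32 ξ (η₂ d)) :
    Measure.pi (fun _ : Fin T => M.obs)
      {ω | ¬ GoodEvent M (M.dataset ω) (H₁ ×ˢ 𝒢) Θ₁ Θ₂ Lα
        (η₁ (M.dataset ω)) (η₂ (M.dataset ω))} ≤ ENNReal.ofReal (4 * ξ) := by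
  have k₁ := measure_not_concentrates_le (T := T) M.obs Trial.measurableSet_RZ M.measurable_obs₁
    (μ := M.μ₁) rfl (R := α₁ '' (H₁ ×ˢ 𝒢)) measurable_inst₁ hLα hLθ hC₁ hC₂ hΘ₁
    (by rintro _ ⟨h, hh, rfl⟩; exact measurable_α₁ (hH₁.measurable _ hh.1))
    (hH₁.separable.image_α₁ h𝒢.separable)
    (by
      filter_upwards [ae_abs_le_μ₁ M hY] with w hw
      rintro _ ⟨h, hh, rfl⟩
      exact hα₁ h hh w hw)
    hξ0 hξ1 (η := fun ω => η₁ (M.dataset ω))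
    (fun ω => by rw [← data₁_dataset]; exact hη₁ _)
  have k₂ := measure_not_concentrates_le (T := T) M.obs Trial.measurableSet_RX_RZ M.measurable_obs₂
    (μ := M.μ₂) rfl (R := α₂ '' (H₁ ×ˢ 𝒢)) measurable_inst₂ hLα hLθ hC₁ hC₂ hΘ₂
    (by
      rintro _ ⟨h, hh, rfl⟩
      exact measurable_α₂ (hH₁.measurable _ hh.1) (h𝒢.measurable _ hh.2))
    (hH₁.separable.image_α₂ h𝒢.separable)
    (by
      filter_upwards [ae_abs_le_μ₂ M hY] with w hw
      rintro _ ⟨h, hh, rfl⟩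
      exact hα₂ h hh w hw)
    hξ0 hξ1 (η := fun ω => η₂ (M.dataset ω))
    (fun ω => by rw [← data₂_dataset]; exact hη₂ _)
  simp only [← data₁_dataset] at k₁
  simp only [← data₂_dataset] at k₂
  calc Measure.pi (fun _ : Fin T => M.obs)
        {ω | ¬ GoodEvent M (M.dataset ω) (H₁ ×ˢ 𝒢) Θ₁ Θ₂ Lα (η₁ (M.dataset ω)) (η₂ (M.dataset ω))}
      ≤ ENNReal.ofReal (2 * ξ) + ENNReal.ofReal (2 * ξ) := by
        refine (measure_mono fun ω hω => ?_).trans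
          ((measure_union_le _ _).trans (add_le_add k₁ k₂))
        exact not_and_or.1 hω
    _ = ENNReal.ofReal (4 * ξ) := by
        rw [← ENNReal.ofReal_add (by positivity) (by positivity)]
        congr 1
        ring

variable {M}

/-- A hypothesis with small projected residuals evaluates the target policy well. -/
lemma abs_valueOf_sub_value_le [IsProbabilityMeasure M.μ₁] [IsProbabilityMeasure M.μ₂]
    (hM : M.ValidIV) (hbr : M.BridgeExists)
    {ptilde : Measure 𝒳} [IsProbabilityMeasure ptilde] {π : Kernel 𝒳 𝒜} [IsMarkovKernel π]
    (hint : Integrable M.intervY (M.interv ptilde π)) {b₁ : 𝒵 → ℝ} (hb : Measurable b₁)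
    (hshift : IsShift M ptilde π b₁)
    (hac : M.obsZ.map (fun ω => (ω.A, ω.X, ω.Z)) ≪ M.obsXZ.map (fun ω => (ω.A, ω.X, ω.Z)))
    (hb₁ : MemLp (fun w => b₁ (inst₁ w)) 2 M.μ₁)
    (hb₂ : MemLp (fun w => b₂of M b₁ (inst₂ w)) 2 M.μ₂)
    (hY : ∀ᵐ ω ∂M.obsZ, |M.Y ω| ≤ LY)
    {h : (ℝ × 𝒜 × 𝒵 → ℝ) × (𝒳 × 𝒜 → ℝ)} (hm₁ : Measurable h.1) (hm₂ : Measurable h.2)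
    (hbd₁ : ∀ w, |h.1 w| ≤ Lh) (hbd₂ : ∀ w, |h.2 w| ≤ Lh)
    (h₁ : MemLp (α₁ h) 2 M.μ₁) (h₂ : MemLp (α₂ h) 2 M.μ₂) :
    |M.valueOf ptilde h.2 π - M.value ptilde π|
      ≤ l2norm M.μ₁ (proj M.μ₁ inst₁ (α₁ h)) * l2norm M.μ₁ (fun w => b₁ (inst₁ w))
        + l2norm M.μ₂ (proj M.μ₂ inst₂ (α₂ h)) * l2norm M.μ₂ (fun w => b₂of M b₁ (inst₂ w)) := by
  have := M.isProbabilityMeasure_obsZ hM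
  have hY2 : MemLp M.Y 2 M.obsZ := MemLp.of_bound M.measurable_Y.aestronglyMeasurable LY hY
  have hb₂m : Measurable (b₂of M b₁) :=
    (hb.comp (by fun_prop)).mul (Measure.measurable_rnDeriv _ _).ennreal_toReal
  rw [M.valueOf_sub_value_eq hM hbr hint hb hshift hac hb₁ hY2 hm₁ hm₂ hbd₁ hbd₂,
    integral_mul_comp_eq_integral_proj measurable_inst₁ h₁ hb hb₁,
    integral_mul_comp_eq_integral_proj measurable_inst₂ h₂ hb₂m hb₂]
  exact (abs_add_le _ _).trans (add_le_add (abs_integral_mul_le_l2norm (memLp_proj h₁) hb₁)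
    (abs_integral_mul_le_l2norm (memLp_proj h₂) hb₂))

/-- A function close to the conditional average treatment effect evaluates a policy well. -/
lemma abs_valueOf_sub_value_le_of_eLpNorm_le
    {ptilde : Measure 𝒳} [IsProbabilityMeasure ptilde] {π : Kernel 𝒳 𝒜} [IsMarkovKernel π]
    (hint : Integrable M.intervY (M.interv ptilde π)) {g : 𝒳 × 𝒜 → ℝ} (hg : Measurable g)
    (hbd : ∀ p, |g p| ≤ Lh) {ε : ℝ} (hε : 0 ≤ ε)
    (hnorm : eLpNorm (fun p => g p - M.cate p) 2 (ptilde ⊗ₘ π) ≤ ENNReal.ofReal ε) :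
    |M.valueOf ptilde g π - M.value ptilde π| ≤ ε := by
  have hgi : Integrable g (ptilde ⊗ₘ π) :=
    Integrable.of_bound hg.aestronglyMeasurable Lh (ae_of_all _ hbd)
  have hmeas : Measurable (fun p => g p - M.cate p) := hg.sub M.measurable_cate
  rw [M.valueOf_eq_integral ptilde π hg, M.value_eq_integral_cate ptilde π hint,
    ← integral_sub hgi (M.integrable_cate ptilde π hint), ← Real.norm_eq_abs]
  have h1 : ENNReal.ofReal ‖∫ p, (g p - M.cate p) ∂(ptilde ⊗ₘ π)‖ ≤ ENNReal.ofReal ε := by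
    rw [ofReal_norm]
    refine (enorm_integral_le_lintegral_enorm _).trans ?_
    rw [← eLpNorm_one_eq_lintegral_enorm]
    exact (eLpNorm_le_eLpNorm_of_exponent_le one_le_two hmeas.aestronglyMeasurable).trans hnorm
  exact (ENNReal.ofReal_le_ofReal_iff hε).1 h1

/-- The regret of a pessimistic policy is controlled by the errors, over the confidence set, in
evaluating the optimal policy. -/
lemma value_sub_value_le_of_isPessimistic {ptilde : Measure 𝒳} {P : Set (Kernel 𝒳 𝒜)}
    {CI : Set (𝒳 × 𝒜 → ℝ)} {πhat πstar : Kernel 𝒳 𝒜} (hhat : IsPessimistic M ptilde P CI πhat)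
    (hstar : πstar ∈ P) (hbdd : BddBelow ((fun g => M.valueOf ptilde g πhat) '' CI))
    {B ε : ℝ} (hB : ∀ g ∈ CI, |M.valueOf ptilde g πstar - M.value ptilde πstar| ≤ B)
    {g₀ : 𝒳 × 𝒜 → ℝ} (hg₀ : g₀ ∈ CI)
    (hε : |M.valueOf ptilde g₀ πhat - M.value ptilde πhat| ≤ ε) :
    M.value ptilde πstar - M.value ptilde πhat ≤ B + ε := by
  have h1 : M.value ptilde πstar - B ≤ sInf ((fun g => M.valueOf ptilde g πstar) '' CI) := by
    refine le_csInf (Set.Nonempty.image _ ⟨g₀, hg₀⟩) ?_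
    rintro _ ⟨g, hg, rfl⟩
    have := (abs_le.1 (hB g hg)).1
    simp only
    linarith
  -- The chain is `v* - B ≤ inf v(·, π*) ≤ inf v(·, πhat) ≤ v(g₀, πhat) ≤ v^πhat + ε`, with `v* =
  -- v^π*`; no other member of the set needs to be accurate at `πhat`.
  have h2 := csInf_le hbdd ⟨g₀, hg₀, rfl⟩
  have h3 := hhat.2 πstar hstar
  have h4 := (abs_le.1 hε).2
  simp only at h2
  linarith

end Event

end

/-! ### Assembly of the main theorem. -/

theorem mainTheorem1 (Lα : ℝ) (hLα : 0 < Lα) :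
    ∃ C : ℝ, 0 < C ∧ ∀ Lθ : ℝ, 0 < Lθ → ∃ C₀ C₁ : ℝ, 0 < C₀ ∧ 0 < C₁ ∧
    ∀ (𝒰 𝒳 𝒵 𝒜 : Type u) [MeasurableSpace 𝒰] [MeasurableSpace 𝒳] [MeasurableSpace 𝒵]
      [MeasurableSpace 𝒜]
      -- the model, its assumptions, and existence of a bridge function
      (M : CCBIV 𝒰 𝒳 𝒵 𝒜) (_ : M.ValidIV) (_ : M.BridgeExists)
      -- the interventional process: context law, policy class, optimal policy
      (ptilde : Measure 𝒳) (_ : IsProbabilityMeasure ptilde)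
      (P : Set (Kernel 𝒳 𝒜)) (_ : ∀ π ∈ P, IsMarkovKernel π)
      (_ : ∀ π ∈ P, Integrable M.intervY (M.interv ptilde π))
      (πstar : Kernel 𝒳 𝒜) (_ : IsOptimal M ptilde P πstar)
      -- function classes and regularity
      (H₁ : Set (ℝ × 𝒜 × 𝒵 → ℝ)) (𝒢 : Set (𝒳 × 𝒜 → ℝ))
      (Θ₁ : Set (𝒵 → ℝ)) (Θ₂ : Set (𝒜 × 𝒳 × 𝒵 → ℝ))
      (LY Lh : ℝ)
      (_ : HypothesisClass H₁ Lh) (_ : HypothesisClass 𝒢 Lh)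
      (_ : TestClass Θ₁ Lθ) (_ : TestClass Θ₂ Lθ)
      (_ : ∀ᵐ ω ∂M.obsZ, |M.Y ω| ≤ LY)
      (_ : ∀ h ∈ H₁ ×ˢ 𝒢, ∀ w, |w.1| ≤ LY → |α₁ h w| ≤ Lα)
      (_ : ∀ h ∈ H₁ ×ˢ 𝒢, ∀ w, |w.2.1| ≤ LY → |α₂ h w| ≤ Lα)
      -- realizability and compatibility
      (εH εΘ : ℝ) (_ : Realizable M ptilde P (H₁ ×ˢ 𝒢) εH)
      (_ : Compatible M.μ₁ (α₁ '' (H₁ ×ˢ 𝒢)) inst₁ Θ₁ εΘ)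
      (_ : Compatible M.μ₂ (α₂ '' (H₁ ×ˢ 𝒢)) inst₂ Θ₂ εΘ)
      -- distribution-shift functions
      (b₁ : 𝒵 → ℝ) (_ : Measurable b₁) (_ : IsShift M ptilde πstar b₁)
      (_ : M.obsZ.map (fun ω => (ω.A, ω.X, ω.Z)) ≪ M.obsXZ.map (fun ω => (ω.A, ω.X, ω.Z)))
      (_ : MemLp (fun w => b₁ (inst₁ w)) 2 M.μ₁)
      (_ : MemLp (fun w => b₂of M b₁ (inst₂ w)) 2 M.μ₂)
      -- the sample size, the confidence level, the critical radii and the threshold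
      (T : ℕ) (ξ : ℝ) (_ : 0 < ξ) (_ : ξ < 1)
      (η₁ η₂ e : Dataset 𝒳 𝒵 𝒜 T → ℝ)
      (_ : ∀ d, BoundsCriticalRadius (data₁ d) (α₁ '' (H₁ ×ˢ 𝒢)) inst₁ Θ₁ Lα Lθ C₀ C₁ ξ (η₁ d))
      (_ : ∀ d, BoundsCriticalRadius (data₂ d) (α₂ '' (H₁ ×ˢ 𝒢)) inst₂ Θ₂ Lα Lθ C₀ C₁ ξ (η₂ d))
      (_ : ∀ d, 2 * εH ^ 2 + (2 * Lα ^ 2 + 5 / 4) * (η₁ d ^ 2 + η₂ d ^ 2) < e d),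
      -- the event has probability at least `1 - 4 ξ`
      Measure.pi (fun _ : Fin T => M.obs)
          {ω | ¬ GoodEvent M (M.dataset ω) (H₁ ×ˢ 𝒢) Θ₁ Θ₂ Lα
            (η₁ (M.dataset ω)) (η₂ (M.dataset ω))} ≤ ENNReal.ofReal (4 * ξ) ∧
      -- on the event, the sub-optimality of the pessimistic policy is bounded
      ∀ d : Dataset 𝒳 𝒵 𝒜 T, GoodEvent M d (H₁ ×ˢ 𝒢) Θ₁ Θ₂ Lα (η₁ d) (η₂ d) →
        ∀ πhat : Kernel 𝒳 𝒜,
          IsPessimistic M ptilde P (confG d (H₁ ×ˢ 𝒢) Θ₁ Θ₂ (e d)) πhat →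
          M.value ptilde πstar - M.value ptilde πhat ≤
            (l2norm M.μ₁ (fun w => b₁ (inst₁ w)) + l2norm M.μ₂ (fun w => b₂of M b₁ (inst₂ w))) *
              (C * εΘ + C * εH + C * √(e d) + C * √(η₁ d ^ 2 + η₂ d ^ 2)) := by
  -- `4 Lα + 5` dominates the coefficients `5` of `εΘ`, `4 Lα + 3` of `η`, `3` of `√e` and `1` of
  -- `εH`. `C₀` covers the deviation constants of the product class and of the test class, and `32`
  -- is the `C₁` used in the peeling.
  refine ⟨4 * Lα + 5, by positivity, fun Lθ hLθ => ?_⟩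
  refine ⟨max 1 (max (devConst (Lα * Lθ)) (devConst Lθ)), 32,
    lt_of_lt_of_le one_pos (le_max_left _ _), by norm_num, ?_⟩
  intro 𝒰 𝒳 𝒵 𝒜 _ _ _ _ M hM hbr ptilde _ P hP hPint πstar hopt H₁ 𝒢 Θ₁ Θ₂ LY Lh hH₁ h𝒢 hΘ₁ hΘ₂
    hY hα₁ hα₂ εH εΘ hreal hc₁ hc₂ b₁ hb hshift hac hb₁ hb₂ T ξ hξ0 hξ1 η₁ η₂ e hη₁ hη₂ he
  have hZ := M.isProbabilityMeasure_obsZ hM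
  have hXZ : IsProbabilityMeasure M.obsXZ := cond_isProbabilityMeasure (M.prob_RX_RZ_ne_zero hac)
  have hμ₁ : IsProbabilityMeasure M.μ₁ :=
    Measure.isProbabilityMeasure_map M.measurable_obs₁.aemeasurable
  have hμ₂ : IsProbabilityMeasure M.μ₂ :=
    Measure.isProbabilityMeasure_map M.measurable_obs₂.aemeasurable
  refine ⟨measure_not_goodEvent_le M hLα hLθ ((le_max_left _ _).trans (le_max_right _ _))
    ((le_max_right _ _).trans (le_max_right _ _)) hH₁ h𝒢 hΘ₁ hΘ₂ hY hα₁ hα₂ hξ0 hξ1 hη₁ hη₂, ?_⟩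
  intro d hgood πhat hhat
  have hC₀ : (0 : ℝ) ≤ max 1 (max (devConst (Lα * Lθ)) (devConst Lθ)) :=
    zero_le_one.trans (le_max_left _ _)
  have hη₁0 := (hη₁ d).nonneg hC₀
  have hη₂0 := (hη₂ d).nonneg hC₀
  have hr₁ : ∀ h ∈ H₁ ×ˢ 𝒢, MemLp (α₁ h) 2 M.μ₁ := fun h hh =>
    MemLp.of_bound (measurable_α₁ (hH₁.measurable _ hh.1)).aestronglyMeasurable Lα <| by
      filter_upwards [ae_abs_le_μ₁ M hY] with w hw using hα₁ h hh w hw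
  have hr₂ : ∀ h ∈ H₁ ×ˢ 𝒢, MemLp (α₂ h) 2 M.μ₂ := fun h hh =>
    MemLp.of_bound (measurable_α₂ (hH₁.measurable _ hh.1)
      (h𝒢.measurable _ hh.2)).aestronglyMeasurable Lα <| by
      filter_upwards [ae_abs_le_μ₂ M hY] with w hw using hα₂ h hh w hw
  obtain ⟨h₀, hh₀, hres, hnorm⟩ := hreal
  have hεH : 0 ≤ εH := (Real.sqrt_nonneg _).trans hres
  have hεΘ : 0 ≤ εΘ := hc₁.nonneg ⟨_, h₀, hh₀, rfl⟩
  have hloss : lossD d Θ₁ Θ₂ h₀ ≤ e d :=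
    (lossD_le_of_goodEvent hΘ₁ hΘ₂ hgood hh₀ (hr₁ h₀ hh₀) (hr₂ h₀ hh₀) hres).trans (he d).le
  have hmem := mem_confH_of_lossD_le hΘ₁ hΘ₂ hh₀ hloss
  have := hP _ hopt.1
  have := hP _ hhat.1
  have hbZ : MemLp (fun ω : Trial 𝒰 𝒳 𝒵 𝒜 => b₁ ω.Z) 2 M.obsZ :=
    (memLp_map_measure_iff hb₁.1 M.measurable_obs₁.aemeasurable).1 hb₁
  have hN₁ := M.one_le_l2norm_shift hb hshift hbZ hb₁
  have hN₂ := l2norm_nonneg (μ := M.μ₂) (fun w => b₂of M b₁ (inst₂ w))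
  have hB : ∀ g ∈ confG d (H₁ ×ˢ 𝒢) Θ₁ Θ₂ (e d),
      |M.valueOf ptilde g πstar - M.value ptilde πstar|
        ≤ (5 * εΘ + (4 * Lα + 3) * √(η₁ d ^ 2 + η₂ d ^ 2) + 3 * √(e d))
          * (l2norm M.μ₁ (fun w => b₁ (inst₁ w)) + l2norm M.μ₂ (fun w => b₂of M b₁ (inst₂ w))) := by
    rintro _ ⟨h, hh, rfl⟩
    have hle := lossD_le_of_mem_confH hΘ₁ hΘ₂ hh₀ hloss hh
    obtain ⟨p₁, p₂⟩ := l2norm_proj_le_of_goodEvent hΘ₁ hΘ₂ hLα.le hη₁0 hη₂0 hgood hc₁ hc₂ hh.1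
      (hr₁ h hh.1) (hr₂ h hh.1) hle
    refine (abs_valueOf_sub_value_le hM hbr (hPint _ hopt.1) hb hshift hac hb₁ hb₂ hY
      (hH₁.measurable _ hh.1.1) (h𝒢.measurable _ hh.1.2) (hH₁.bounded _ hh.1.1)
      (h𝒢.bounded _ hh.1.2) (hr₁ h hh.1) (hr₂ h hh.1)).trans ?_
    rw [mul_add]
    exact add_le_add (mul_le_mul_of_nonneg_right p₁ (zero_le_one.trans hN₁))
      (mul_le_mul_of_nonneg_right p₂ hN₂)
  have hbdd : BddBelow ((fun g => M.valueOf ptilde g πhat) ''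
      confG d (H₁ ×ˢ 𝒢) Θ₁ Θ₂ (e d)) := by
    refine ⟨-Lh, ?_⟩
    rintro _ ⟨_, ⟨h, hh, rfl⟩, rfl⟩
    simp only
    rw [M.valueOf_eq_integral ptilde πhat (h𝒢.measurable _ hh.1.2)]
    have := norm_integral_le_of_norm_le_const (μ := ptilde ⊗ₘ πhat) (f := h.2) (C := Lh)
      (ae_of_all _ (h𝒢.bounded _ hh.1.2))
    simp only [probReal_univ, mul_one] at this
    exact (abs_le.1 this).1
  have hfin := value_sub_value_le_of_isPessimistic hhat hopt.1 hbdd hB ⟨h₀, hmem, rfl⟩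
    (abs_valueOf_sub_value_le_of_eLpNorm_le (hPint _ hhat.1) (h𝒢.measurable _ hh₀.2)
      (h𝒢.bounded _ hh₀.2) hεH (hnorm _ hhat.1))
  refine hfin.trans ?_
  have hη0 := Real.sqrt_nonneg (η₁ d ^ 2 + η₂ d ^ 2)
  have he0 := Real.sqrt_nonneg (e d)
  generalize l2norm M.μ₁ (fun w => b₁ (inst₁ w)) = N₁ at *
  generalize l2norm M.μ₂ (fun w => b₂of M b₁ (inst₂ w)) = N₂ at *
  have h1 : εH ≤ (N₁ + N₂) * εH := le_mul_of_one_le_left hεH (by linarith)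
  have h2 : 5 * εΘ + (4 * Lα + 3) * √(η₁ d ^ 2 + η₂ d ^ 2) + 3 * √(e d) + εH
      ≤ (4 * Lα + 5) * εΘ + (4 * Lα + 5) * εH + (4 * Lα + 5) * √(e d)
        + (4 * Lα + 5) * √(η₁ d ^ 2 + η₂ d ^ 2) := by
    nlinarith [mul_nonneg hLα.le hεΘ, mul_nonneg hLα.le hεH, mul_nonneg hLα.le he0]
  have h3 := mul_le_mul_of_nonneg_left h2 (by linarith : 0 ≤ N₁ + N₂)
  linarith
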